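/- **Setting.** Fix $d\ge 1$, $\alpha>0$, $\beta\in(0,1]$ with $\alpha\beta\le 1$, and constants $L,\underline c,\bar c,D_0>0$, $\delta_0\in(0,1)$. Let $\gamma=\frac{\beta(1+\alpha)}{2\beta+d}\in(0,1)$ and $c_0=2Ld^{\beta/2}+1$. A bandit instance is the law of $(X,Y^{(1)},Y^{(-1)})$, where $X\in[0,1]^d$ has a density with values in $[\underline c,\bar c]$, $Y^{(k)}\in[0,1]$, $\mathbb E[Y^{(k)}\mid X]=f^{(k)}(X)$, $|f^{(k)}(x)-f^{(k)}(x')|\le L\|x-x'\|_2^\beta$ on $[0,1]^d$, and $\mathbb P(0<|f^{(1)}(X)-f^{(-1)}(X)|\le\delta)\le D_0\delta^\alpha$ for all $\delta\in[0,\delta_0]$. With $f^\star=\max(f^{(1)},f^{(-1)})$ and i.i.d. observations $(X_t,Y^{(1)}_t,Y^{(-1)}_t)$, $1\le t\le T$, the regret of a policy $\pi$ is $R_T(\pi)=\mathbb E\sum_{t=1}^T\big(f^\star(X_t)-f^{(\pi_t(X_t))}(X_t)\big)$. **Algorithm BaSEDB.** Inputs: $T$, $M\ge2$, a grid $0=t_0<t_1<\dots<t_M=T$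 and split factors $g_0,\dots,g_{M-1}$. Let $w_i=(\prod_{l<i}g_l)^{-1}$; layer $i$ is the regular partition of $[0,1]^d$ into cubes of width $w_i$. Initially the active bins are those of layer $1$, each with both arms active. In batch $i\le M-1$ (times $t_{i-1}<t\le t_i$) the active bin containing $X_t$ pulls its active arms in a round-robin way. At the end of the batch, in each active bin $C$ with two active arms, arm $k$ is eliminated if $\max_{k'}\bar Y^{(k')}_{C,i}-\bar Y^{(k)}_{C,i}>4\sqrt{\log(2T|C|^d)/m_{C,i}}$, where $m_{C,i}$ is the number of visits to $C$ and $\bar Y^{(k)}_{C,i}$ the empirical mean reward of arm $k$ in $C$ during batch $i$, and $|C|$ is the width of $C$; if no arm is eliminated, $C$ is replaced by its $g_i^d$ children in the next layer, with both arms active. In batch $M$ any active arm of the bin containing $X_t$ is pulled. **Tuning.** Given constants $\underline l,\underline b,\bar b>0$, the inputs are *admissible* if, for some $b$ with $$\underline b\,(\log T)^{-2(1-\gamma)}\,T^{\frac{1-\gamma}{1-\gamma^M}}\le b\le\bar b\,T^{\frac{1-\gamma}{1-\gamma^M}}$$ and some $l_i$, one has $g_0=\lfloor b^{1/(2\beta+d)}\rfloor$,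 $g_i=\lfloor g_{i-1}^\gamma\rfloor$ for $1\le i\le M-2$, $g_{M-1}=1$, and for $1\le i\le M-1$ $$t_i-t_{i-1}=\lfloor l_iw_i^{-(2\beta+d)}\log(Tw_i^d)\rfloor,\qquad l_i\ge\underline l,\qquad l_i\log(Tw_i^d)\le\frac{2}{c_0^2\bar c}\log(2Tw_i^d).$$ **Corollary 1.** For every $\gamma\in(0,1)$ there is $D_2>0$ depending only on $\gamma$ such that, for all $d,\alpha,\beta,L,\underline c,\bar c,\delta_0,D_0$ as above with $\frac{\beta(1+\alpha)}{2\beta+d}=\gamma$: 1. For all $\underline l,\underline b,\bar b>0$ there is $\tilde C>0$, independent of $T$, $M$ and the instance, such that for all $T\ge2$ and all $M\ge D_2\log\log T$, BaSEDB with any admissible inputs with $M$ batches (whatever the starting arms of the round-robins and the choices in the last batch) satisfies, on every instance, $$R_T(\hat\pi)\le\tilde C(\log T)^2\,T^{1-\gamma}.$$ 2. Such inputs exist: for every $D_1>0$ and every $\underline l\in(0,\frac{2}{c_0^2\bar c}]$ there are $\underline b,\bar b>0$ and $T_0$ such that for all $T\ge T_0$ and all $M\ge D_2\log\log T$ there are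 admissible inputs with some number $M'$ of batches, $D_2\log\log T\le M'\le M$, and with $M'=M$ if $M\le D_1\log T$. -/

import Mathlib

open MeasureTheory ProbabilityTheory

noncomputable section

namespace BatchedBandit

/-! ### The nonparametric two-armed bandit -/

/-- Covariates live in `ℝ^d` with the Euclidean norm. -/
abbrev Cov (d : ℕ) := EuclideanSpace ℝ (Fin d)

/-- The two arms: `true` is arm `1`, `false` is arm `-1`. -/
abbrev Arm := Bool

/-- The covariate space `[0,1]^d`. -/
def unitCube (d : ℕ) : Set (Cov d) := {x | ∀ j, 0 ≤ x j ∧ x j ≤ 1}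

/-- The exponent `γ = β (1 + α) / (2 β + d)`. -/
def gam (d : ℕ) (α β : ℝ) : ℝ := β * (1 + α) / (2 * β + d)

/-- The regularity constants of a class of bandit instances: margin exponent `α`, smoothness
`(β, L)`, density bounds `cLow, cUp`, and the margin constants `δ₀, D₀`. -/
structure ClassParams where
  α : ℝ
  β : ℝ
  L : ℝ
  cLow : ℝ
  cUp : ℝ
  δ₀ : ℝ
  D₀ : ℝ

/-- The standing assumptions on the constants. -/
structure ClassParams.Valid (p : ClassParams) : Prop where
  α_pos : 0 < p.α
  β_pos : 0 < p.β
  β_le : p.β ≤ 1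
  αβ_le : p.α * p.β ≤ 1
  L_pos : 0 < p.L
  cLow_pos : 0 < p.cLow
  cUp_pos : 0 < p.cUp
  δ₀_pos : 0 < p.δ₀
  δ₀_lt : p.δ₀ < 1
  D₀_pos : 0 < p.D₀

/-- `μ` is the law of one observation `(X, (Y^(1), Y^(-1)))` of a bandit instance with mean reward
functions `f`, and the instance belongs to the class with parameters `p`. -/
structure IsInstance {d : ℕ} (p : ClassParams) (μ : Measure (Cov d × (Arm → ℝ)))
    (f : Arm → Cov d → ℝ) : Prop where
  isProb : IsProbabilityMeasure μ
  /-- `X` lies in `[0,1]^d` and has a density there with values in `[cLow, cUp]`. -/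
  density : ∃ ρ : Cov d → ℝ, Measurable ρ ∧
    (∀ x ∈ unitCube d, p.cLow ≤ ρ x ∧ ρ x ≤ p.cUp) ∧
    μ.map Prod.fst = (volume.restrict (unitCube d)).withDensity (fun x => ENNReal.ofReal (ρ x))
  reward_mem : ∀ k : Arm, ∀ᵐ z ∂μ, 0 ≤ z.2 k ∧ z.2 k ≤ 1
  /-- `E[Y^(k) | X] = f^(k)(X)`. -/
  mean_reward : ∀ k : Arm,
    μ[fun z => z.2 k | MeasurableSpace.comap Prod.fst inferInstance] =ᵐ[μ] fun z => f k z.1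
  smooth : ∀ k : Arm, ∀ x ∈ unitCube d, ∀ y ∈ unitCube d, |f k x - f k y| ≤ p.L * ‖x - y‖ ^ p.β
  margin : ∀ δ : ℝ, 0 ≤ δ → δ ≤ p.δ₀ →
    (μ.map Prod.fst).real {x | 0 < |f true x - f false x| ∧ |f true x - f false x| ≤ δ}
      ≤ p.D₀ * δ ^ p.α

/-- The random vectors `Z t = (X_t, (Y_t^(1), Y_t^(-1)))`, `1 ≤ t ≤ T`, are i.i.d. with law `μ`. -/
structure IsIIDSample {d : ℕ} {Ω : Type*} [MeasurableSpace Ω] (P : Measure Ω) (T : ℕ)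
    (μ : Measure (Cov d × (Arm → ℝ))) (Z : ℕ → Ω → Cov d × (Arm → ℝ)) : Prop where
  measurable : ∀ t ∈ Set.Icc 1 T, Measurable (Z t)
  indep : iIndepFun (fun t : Set.Icc 1 T => Z t) P
  law : ∀ t ∈ Set.Icc 1 T, P.map (Z t) = μ

/-- `∑_{t=1}^T (f⋆(X_t) - f^(π_t(X_t))(X_t))` for covariates `x` and decision rules `π`. -/
def cumRegret {d : ℕ} (T : ℕ) (f : Arm → Cov d → ℝ) (x : ℕ → Cov d) (π : ℕ → Cov d → Arm) : ℝ :=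
  ∑ t ∈ Finset.Icc 1 T, (max (f true (x t)) (f false (x t)) - f (π t (x t)) (x t))

/-! ### The tree of bins -/

/-- The number `∏_{l<i} g_l` of bins of layer `i` along each axis. -/
def nBins (g : ℕ → ℕ) (i : ℕ) : ℕ := ∏ l ∈ Finset.range i, g l

/-- The width `w_i = (∏_{l<i} g_l)⁻¹` of the bins of layer `i`. -/
def width (g : ℕ → ℕ) (i : ℕ) : ℝ := (nBins g i : ℝ)⁻¹

/-- A node of the tree: its layer `i` and its position `(v_1 - 1, …, v_d - 1)` in that layer. -/
abbrev Node (d : ℕ) := ℕ × (Fin d → ℕ)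

/-- The bin of a node: the half-open cube `∏_j [(v_j - 1) w_i, v_j w_i)`, where the bins at the
upper end of an axis also contain the face `x_j = 1`, so that each layer partitions `[0,1]^d`. -/
def cell {d : ℕ} (g : ℕ → ℕ) (C : Node d) : Set (Cov d) :=
  {x | ∀ j, (C.2 j : ℝ) * width g C.1 ≤ x j ∧
    (x j < ((C.2 j : ℝ) + 1) * width g C.1 ∨ (C.2 j + 1 = nBins g C.1 ∧ x j = 1))}

/-- All the nodes of layer `i`. -/
def layer (d : ℕ) (g : ℕ → ℕ) (i : ℕ) : Finset (Node d) :=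
  (Fintype.piFinset fun _ : Fin d => Finset.range (nBins g i)).image fun v => (i, v)

/-- The nodes of the next layer obtained from `C` by cutting each side into `s` pieces. -/
def child {d : ℕ} (C : Node d) (s : ℕ) : Finset (Node d) :=
  (Fintype.piFinset fun j : Fin d => Finset.Ico (s * C.2 j) (s * (C.2 j + 1))).image
    fun v => (C.1 + 1, v)

/-- The node whose children, for the split factor `s`, include `C`. -/
def parent {d : ℕ} (C : Node d) (s : ℕ) : Node d := (C.1 - 1, fun j => C.2 j / s)

/-! ### The algorithm BaSEDB -/

/-- The inputs: horizon, number of batches, split factors and grid. -/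
structure Inputs where
  T : ℕ
  M : ℕ
  g : ℕ → ℕ
  t : ℕ → ℕ

/-- The active bins and the active arms of each bin. -/
structure ActiveSets (d : ℕ) where
  bins : Finset (Node d)
  arms : Node d → Finset Arm

/-- What the algorithm leaves open: the arm with which the round-robin in bin `C` begins in
batch `i`, and the preferred arm at each time of the last batch. -/
structure Choices (d : ℕ) where
  first : ℕ → Node d → Arm
  final : ℕ → Arm

open scoped Classical in
/-- The number of times `s ∈ (a, b]` with `x_s ∈ C`. -/
def visits {d : ℕ} (g : ℕ → ℕ) (x : ℕ → Cov d) (a b : ℕ) (C : Node d) : ℕ :=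
  ((Finset.Ioc a b).filter fun s => x s ∈ cell g C).card

open scoped Classical in
/-- The empirical mean reward of arm `k` in bin `C` over the times in `(a, b]`, for the covariates
`x`, the actions `A` and the received rewards `r`. -/
def meanReward {d : ℕ} (g : ℕ → ℕ) (x : ℕ → Cov d) (A : ℕ → Arm) (r : ℕ → ℝ) (a b : ℕ)
    (C : Node d) (k : Arm) : ℝ :=
  (∑ s ∈ (Finset.Ioc a b).filter (fun s => x s ∈ cell g C ∧ A s = k), r s) /
    (((Finset.Ioc a b).filter (fun s => x s ∈ cell g C ∧ A s = k)).card : ℝ)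

/-- The threshold `U(τ, T, C) = 4 √(log (2 T |C|^d) / τ)` for a bin of width `w`. -/
def threshold (d T τ : ℕ) (w : ℝ) : ℝ := 4 * √(Real.log (2 * T * w ^ d) / τ)

open scoped Classical in
/-- The arms of `I` that survive elimination: if `|I| ≠ 1`, arm `k` is removed when
`max_{k' ∈ I} Ybar k' - Ybar k > U`. -/
def survivors (I : Finset Arm) (Ybar : Arm → ℝ) (U : ℝ) : Finset Arm :=
  if I.card = 1 then I else I.filter fun k => ¬ ∃ k' ∈ I, Ybar k' - Ybar k > U

open scoped Classical in
/-- The tree growing subroutine at the end of a batch: `surv C` are the arms of `C` that survive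
elimination and `s` is the split factor. A bin that keeps more than one arm is replaced by its
children, which inherit its arms; the other bins stay. -/
def ActiveSets.grow {d : ℕ} (S : ActiveSets d) (surv : Node d → Finset Arm) (s : ℕ) :
    ActiveSets d where
  bins := S.bins.biUnion fun C => if 1 < (surv C).card then child C s else {C}
  arms := fun C => if C ∈ S.bins then surv C else surv (parent C s)

open scoped Classical in
/-- The bin of the collection `B` that contains `x` (with a dummy value if there is none). -/
def lookup {d : ℕ} (g : ℕ → ℕ) (B : Finset (Node d)) (x : Cov d) : Node d :=
  if h : ∃ C ∈ B, x ∈ cell g C then h.choose else (0, fun _ => 0)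

/-- The arm `k` if it belongs to `I`, and otherwise the other arm. -/
def pick (I : Finset Arm) (k : Arm) : Arm := if k ∈ I then k else !k

open scoped Classical in
/-- The decision at time `t` of a batch that starts after time `a`, when the active sets are `S`:
the bin of the covariate pulls its active arms in a round-robin way, beginning with `first C`. -/
def exploreRule {d : ℕ} (g : ℕ → ℕ) (S : ActiveSets d) (x : ℕ → Cov d) (a : ℕ)
    (first : Node d → Arm) (t : ℕ) (z : Cov d) : Arm :=
  let C := lookup g S.bins z
  pick (S.arms C) (if Even (visits g x a (t - 1) C) then first C else !first C)

/-- The active sets after `i` batches (that is, during batch `i + 1`), when the covariates and the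
potential rewards of both arms are `z`. Only the rewards of the pulled arms are used. -/
def activeAfter {d : ℕ} (A : Inputs) (c : Choices d) (z : ℕ → Cov d × (Arm → ℝ)) :
    ℕ → ActiveSets d
  | 0 => { bins := layer d A.g 1, arms := fun _ => Finset.univ }
  | i + 1 =>
    let S := activeAfter A c z i
    let x : ℕ → Cov d := fun s => (z s).1
    let act : ℕ → Arm := fun s => exploreRule A.g S x (A.t i) (c.first (i + 1)) s (x s)
    let rew : ℕ → ℝ := fun s => (z s).2 (act s)
    S.grow (fun C => survivors (S.arms C) (meanReward A.g x act rew (A.t i) (A.t (i + 1)) C)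
      (threshold d A.T (visits A.g x (A.t i) (A.t (i + 1)) C) (width A.g C.1))) (A.g (i + 1))

/-- The batch of time `t`: for `0 = t_0 < ⋯ < t_M = T` and `1 ≤ t ≤ T`, the unique `i` with
`t_{i-1} < t ≤ t_i`. -/
def batchOf (A : Inputs) (t : ℕ) : ℕ := ((Finset.range A.M).filter fun i => A.t i < t).card

/-- The decision rule `π_t` of BaSEDB: round-robin over the active arms of the active bin in the
batches `1, …, M - 1`, and any active arm of the active bin in batch `M`. -/
def basedb {d : ℕ} (A : Inputs) (c : Choices d) (z : ℕ → Cov d × (Arm → ℝ)) (t : ℕ) :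
    Cov d → Arm := fun x =>
  let i := batchOf A t
  let S := activeAfter A c z (i - 1)
  if i < A.M then exploreRule A.g S (fun s => (z s).1) (A.t (i - 1)) (c.first i) t x
  else pick (S.arms (lookup A.g S.bins x)) (c.final t)

/-! ### Grid and split factors -/

/-- `c₀ = 2 L d^{β/2} + 1`. -/
def c0 (d : ℕ) (p : ClassParams) : ℝ := 2 * p.L * (d : ℝ) ^ (p.β / 2) + 1

/-- The constants that the tuning of the algorithm is allowed to have: lower bound for the
batch-size constants `l_i`, and the constants of the window for `b`. -/
structure TuningConsts where
  lLow : ℝ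
  bLow : ℝ
  bUp : ℝ

/-- The grid and the split factors are chosen according to the recipe of BaSEDB with the base `b`
and the batch-size constants `l`. The upper bound on `l i` says `2 c₀ w_i^β ≤ U(2 m, T, C)` for the
bins of layer `i`, where `m = l_i w_i^{-(2β+d)} log (T w_i^d) · cUp w_i^d` is the largest expected
number of visits to such a bin. -/
structure IsTuned (d : ℕ) (p : ClassParams) (q : TuningConsts) (A : Inputs) (b : ℝ) (l : ℕ → ℝ) :
    Prop where
  two_le_M : 2 ≤ A.M
  b_lower : q.bLow * (A.T : ℝ) ^ ((1 - gam d p.α p.β) / (1 - gam d p.α p.β ^ A.M)) /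
    Real.log A.T ^ (2 * (1 - gam d p.α p.β)) ≤ b
  b_upper : b ≤ q.bUp * (A.T : ℝ) ^ ((1 - gam d p.α p.β) / (1 - gam d p.α p.β ^ A.M))
  g_zero : A.g 0 = ⌊b ^ (1 / (2 * p.β + d))⌋₊
  g_step : ∀ i, 1 ≤ i → i + 2 ≤ A.M → A.g i = ⌊(A.g (i - 1) : ℝ) ^ gam d p.α p.β⌋₊
  g_last : A.g (A.M - 1) = 1
  t_zero : A.t 0 = 0
  t_last : A.t A.M = A.T
  t_lt : ∀ i < A.M, A.t i < A.t (i + 1)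
  t_step : ∀ i, 1 ≤ i → i < A.M → A.t i = A.t (i - 1) +
    ⌊l i * width A.g i ^ (-(2 * p.β + d)) * Real.log (A.T * width A.g i ^ d)⌋₊
  l_lower : ∀ i, 1 ≤ i → i < A.M → q.lLow ≤ l i
  l_upper : ∀ i, 1 ≤ i → i < A.M → l i * Real.log (A.T * width A.g i ^ d) ≤
    2 / (c0 d p ^ 2 * p.cUp) * Real.log (2 * A.T * width A.g i ^ d)

end BatchedBandit

end

/-! Follow the active bin around a fixed covariate `x`. While it has both arms, the round-robin
estimates the gap between the arms from `m` visits with noise of order `√(log / m)` and with bias at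
most `2 L d^{β/2} w^β`; the upper bound on `l_i` keeps the threshold above twice `c₀ w^β`, hence
above the bias. As long as the statistics are reliable, an eliminated arm is therefore no better at
any point of the bin, and a bin that keeps both arms after the batch of layer `i` has a gap of order
`w_i^β` (`survAfter_of_good`, `pathStatus`). A decision in batch `i + 1` then costs something only
where the gap is that small, which by the margin condition is `O(w_i^{β(1+α)})` in expectation.

The failure event `Bad` is defined for every bin of a layer, active or not, and for both starting
arms of the round-robin, through the observations of a single batch. It thus involves neither the
history nor the free choices of the algorithm. It has probability at most `4 / (T w^d)`
(`measureReal_bad_le`) and is independent of later covariates (`integral_bad_mul`). After a failure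
the gap at `x` is still bounded by the radius known at that time, and since a covariate lies in only
one bin of a layer, no union bound over bins is paid. Over the whole horizon the failures of batch
`j` cost at most `cLow` times the main term of that batch, so the regret is bounded by `1 + cLow`
times the sum of batch length times cost per decision (`integral_cumRegret_le`).

The rest is deterministic. Let `N_i` be the number of bins of layer `i` along an axis. Batch `i + 1`
is not the last: its length is of order `N_{i+1}^{2β+d}` times a logarithm, while a decision in it
costs `N_i^{-γ(2β+d)}`, because `β(1+α) = γ(2β+d)`. The recipe for the split factors gives `N_{i+1}
≤ g_0 N_i^γ`, so the powers of `N_i` cancel and the batch costs `O(b log T)`, where `b` is at most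
of order `T^{1-γ}`. To avoid paying this for all the batches, the sum is cut at `i₀ ≈ log log T /
log (1/γ)`. There `γ^{i₀} ≤ 1 / log T`, hence `T^{γ^{i₀}} ≤ e`, so `N_{i₀}` has reached its limit
`g_0^{1/(1-γ)}` up to a constant, and all remaining batches together cost at most `T
N_{i₀}^{-γ(2β+d)}` (`IsSplit.horizon_mul_inv_le`). The rounding of the split factors costs only a
constant for any number of layers, because the losses telescope (`rpow_le_floor_mul_exp`).

For the existence of inputs, the same bounds on `N_i` show that at most `D₁ log T` batches of the
prescribed lengths fit into the horizon once `b` is a small enough multiple of its target. -/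

open MeasureTheory ProbabilityTheory

namespace BatchedBandit

/-! ### Geometry of the bins -/

/-- `y` lies in the `v`-th of the `N` intervals that partition `[0,1]`. -/
def InInterval (N v : ℕ) (y : ℝ) : Prop :=
  (v : ℝ) * (N : ℝ)⁻¹ ≤ y ∧ (y < ((v : ℝ) + 1) * (N : ℝ)⁻¹ ∨ (v + 1 = N ∧ y = 1))

lemma mem_cell_iff {d : ℕ} {g : ℕ → ℕ} {C : Node d} {x : Cov d} :
    x ∈ cell g C ↔ ∀ j, InInterval (nBins g C.1) (C.2 j) (x j) := Iff.rfl

lemma InInterval.exists {N : ℕ} (hN : 0 < N) {y : ℝ} (h0 : 0 ≤ y) (h1 : y ≤ 1) :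
    ∃ v < N, InInterval N v y := by
  have hN' : (0 : ℝ) < N := by exact_mod_cast hN
  rcases h1.lt_or_eq with h | h
  · have hy : 0 ≤ y * N := by positivity
    refine ⟨⌊y * N⌋₊, ?_, ?_, Or.inl ?_⟩
    · rw [Nat.floor_lt hy]; nlinarith
    · rw [← div_eq_mul_inv, div_le_iff₀ hN']; exact Nat.floor_le hy
    · rw [← div_eq_mul_inv, lt_div_iff₀ hN']; exact Nat.lt_floor_add_one _
  · refine ⟨N - 1, by omega, ?_, Or.inr ⟨by omega, h⟩⟩
    rw [← div_eq_mul_inv, div_le_iff₀ hN', h, one_mul]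
    exact_mod_cast Nat.sub_le _ _

lemma InInterval.le_of {N v u : ℕ} {y : ℝ} (hN : 0 < N) (hu : u < N)
    (hv : InInterval N v y) (hu' : InInterval N u y) : u ≤ v := by
  have hN' : (0 : ℝ) < N := by exact_mod_cast hN
  by_contra! h
  rcases hv.2 with h2 | h2
  · have h3 : ((v : ℝ) + 1) * (N : ℝ)⁻¹ ≤ u * (N : ℝ)⁻¹ := by
      gcongr; exact_mod_cast h
    linarith [hu'.1]
  · omega

lemma InInterval.unique {N v u : ℕ} {y : ℝ} (hv : v < N) (hu : u < N)
    (hv' : InInterval N v y) (hu' : InInterval N u y) : v = u :=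
  le_antisymm (InInterval.le_of (by omega) hv hu' hv') (InInterval.le_of (by omega) hu hv' hu')

lemma InInterval.of_child {N s v u : ℕ} {y : ℝ} (hN : 0 < N) (hs : 0 < s) (hv : v < N)
    (h1 : s * v ≤ u) (h2 : u < s * (v + 1)) (h : InInterval (N * s) u y) : InInterval N v y := by
  have hN' : (0 : ℝ) < N := by exact_mod_cast hN
  have hs' : (0 : ℝ) < s := by exact_mod_cast hs
  have e : ((N * s : ℕ) : ℝ)⁻¹ = (N : ℝ)⁻¹ * (s : ℝ)⁻¹ := by push_cast; rw [mul_inv]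
  have h1' : (s : ℝ) * v ≤ u := by exact_mod_cast h1
  have h2' : (u : ℝ) + 1 ≤ s * (v + 1) := by exact_mod_cast h2
  refine ⟨le_trans ?_ h.1, ?_⟩
  · rw [e]
    calc (v : ℝ) * (N : ℝ)⁻¹ = (s * v) * ((N : ℝ)⁻¹ * (s : ℝ)⁻¹) := by field_simp
      _ ≤ _ := by gcongr
  · rcases h.2 with h3 | ⟨h3, h4⟩
    · left
      refine h3.trans_le ?_
      rw [e]
      calc ((u : ℝ) + 1) * ((N : ℝ)⁻¹ * (s : ℝ)⁻¹)
          ≤ (s * (v + 1)) * ((N : ℝ)⁻¹ * (s : ℝ)⁻¹) := by gcongr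
        _ = _ := by field_simp
    -- The point `y = 1` belongs only to the last child, and the parent of the last child is the
    -- last interval.
    · right
      refine ⟨?_, h4⟩
      have : N * s ≤ (v + 1) * s := by nlinarith
      have := Nat.le_of_mul_le_mul_right this hs
      omega

/-- Take the interval `u` of the finer partition around `y`. Its parent `u / s` also contains `y`,
so it is `v` by uniqueness. -/
lemma InInterval.exists_child {N s v : ℕ} {y : ℝ} (hs : 0 < s) (hv : v < N)
    (h0 : 0 ≤ y) (h1 : y ≤ 1) (h : InInterval N v y) :
    ∃ u, (s * v ≤ u ∧ u < s * (v + 1)) ∧ InInterval (N * s) u y := by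
  have hN : 0 < N := by omega
  obtain ⟨u, hu, hu'⟩ := InInterval.exists (Nat.mul_pos hN hs) h0 h1
  refine ⟨u, ?_, hu'⟩
  have hdiv : InInterval N (u / s) y := by
    refine InInterval.of_child hN hs ?_ (Nat.mul_div_le u s) (Nat.lt_mul_div_succ u hs) hu'
    exact (Nat.div_lt_iff_lt_mul hs).2 hu
  have : v = u / s := InInterval.unique hv ((Nat.div_lt_iff_lt_mul hs).2 hu) h hdiv
  rw [this]
  exact ⟨Nat.mul_div_le u s, Nat.lt_mul_div_succ u hs⟩

lemma nBins_succ (g : ℕ → ℕ) (i : ℕ) : nBins g (i + 1) = nBins g i * g i :=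
  Finset.prod_range_succ _ _

lemma mem_layer {d : ℕ} {g : ℕ → ℕ} {i : ℕ} {C : Node d} :
    C ∈ layer d g i ↔ C.1 = i ∧ ∀ j, C.2 j < nBins g i := by
  simp only [layer, Finset.mem_image, Fintype.mem_piFinset, Finset.mem_range]
  constructor
  · rintro ⟨v, hv, rfl⟩; exact ⟨rfl, hv⟩
  · rintro ⟨rfl, h⟩; exact ⟨C.2, h, rfl⟩

lemma mem_child {d : ℕ} {s : ℕ} {C D : Node d} :
    D ∈ child C s ↔ D.1 = C.1 + 1 ∧ ∀ j, s * C.2 j ≤ D.2 j ∧ D.2 j < s * (C.2 j + 1) := by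
  simp only [child, Finset.mem_image, Fintype.mem_piFinset, Finset.mem_Ico]
  constructor
  · rintro ⟨v, hv, rfl⟩; exact ⟨rfl, hv⟩
  · rintro ⟨h0, h⟩; exact ⟨D.2, h, by rw [← h0]⟩

lemma exists_mem_layer {d : ℕ} {g : ℕ → ℕ} {i : ℕ} (hN : 0 < nBins g i) {x : Cov d}
    (hx : x ∈ unitCube d) : ∃ C ∈ layer d g i, x ∈ cell g C := by
  choose v hv hv' using fun j => InInterval.exists hN (hx j).1 (hx j).2
  exact ⟨(i, v), mem_layer.2 ⟨rfl, hv⟩, hv'⟩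

lemma layer_unique {d : ℕ} {g : ℕ → ℕ} {i : ℕ} {x : Cov d} {C D : Node d}
    (hC : C ∈ layer d g i) (hD : D ∈ layer d g i) (hxC : x ∈ cell g C) (hxD : x ∈ cell g D) :
    C = D := by
  rw [mem_layer] at hC hD
  rw [mem_cell_iff] at hxC hxD
  rw [hC.1] at hxC
  rw [hD.1] at hxD
  exact Prod.ext (hC.1.trans hD.1.symm)
    (funext fun j => InInterval.unique (hC.2 j) (hD.2 j) (hxC j) (hxD j))

lemma child_mem_layer {d : ℕ} {g : ℕ → ℕ} {i : ℕ} {C D : Node d} (hC : C ∈ layer d g i)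
    (hD : D ∈ child C (g i)) : D ∈ layer d g (i + 1) := by
  rw [mem_layer] at hC ⊢
  rw [mem_child] at hD
  refine ⟨by rw [hD.1, hC.1], fun j => ?_⟩
  rw [nBins_succ]
  have := (hD.2 j).2
  have := hC.2 j
  calc D.2 j < g i * (C.2 j + 1) := (hD.2 j).2
    _ ≤ g i * nBins g i := Nat.mul_le_mul_left _ this
    _ = _ := mul_comm _ _

lemma cell_child_subset {d : ℕ} {g : ℕ → ℕ} {i : ℕ} {C D : Node d} (hg : 0 < g i)
    (hC : C ∈ layer d g i) (hD : D ∈ child C (g i)) : cell g D ⊆ cell g C := by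
  intro x hx
  rw [mem_layer] at hC
  rw [mem_child] at hD
  rw [mem_cell_iff] at hx ⊢
  intro j
  have h := hx j
  rw [hD.1, hC.1, nBins_succ] at h
  rw [hC.1]
  exact h.of_child (by have := hC.2 j; omega) hg (hC.2 j) (hD.2 j).1 (hD.2 j).2

lemma exists_child {d : ℕ} {g : ℕ → ℕ} {i : ℕ} {C : Node d} (hg : 0 < g i) {x : Cov d}
    (hx : x ∈ unitCube d) (hC : C ∈ layer d g i) (hxC : x ∈ cell g C) :
    ∃ D ∈ child C (g i), x ∈ cell g D := by
  rw [mem_layer] at hC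
  rw [mem_cell_iff, hC.1] at hxC
  choose v hv hv' using fun j =>
    InInterval.exists_child hg (hC.2 j) (hx j).1 (hx j).2 (hxC j)
  refine ⟨(i + 1, v), mem_child.2 ⟨by rw [hC.1], hv⟩, ?_⟩
  rw [mem_cell_iff]
  intro j
  rw [nBins_succ]
  exact hv' j

lemma parent_of_mem_child {d : ℕ} {s : ℕ} {C D : Node d} (hD : D ∈ child C s) :
    parent D s = C := by
  rw [mem_child] at hD
  refine Prod.ext (by simp [parent, hD.1]) (funext fun j => ?_)
  show D.2 j / s = C.2 j
  refine Nat.div_eq_of_lt_le ?_ ?_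
  · rw [mul_comm]; exact (hD.2 j).1
  · have := (hD.2 j).2
    rw [mul_comm]; exact this

lemma norm_sub_le_of_mem_cell {d : ℕ} {g : ℕ → ℕ} {C : Node d} {x y : Cov d}
    (hN : 0 < nBins g C.1) (hx : x ∈ cell g C) (hy : y ∈ cell g C) :
    ‖x - y‖ ≤ √d * width g C.1 := by
  have hw : 0 < width g C.1 := by unfold width; positivity
  have key : ∀ (z : Cov d), z ∈ cell g C → ∀ j, z j ≤ (C.2 j + 1) * width g C.1 := by
    intro z hz j
    rcases (hz j).2 with h | ⟨h, h'⟩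
    · exact h.le
    · rw [h']
      have : ((C.2 j : ℝ) + 1) = nBins g C.1 := by exact_mod_cast h
      rw [this, width, mul_inv_cancel₀]
      positivity
  rw [EuclideanSpace.norm_eq]
  calc √(∑ j, ‖(x - y) j‖ ^ 2) ≤ √(∑ _j : Fin d, width g C.1 ^ 2) := by
        apply Real.sqrt_le_sqrt
        apply Finset.sum_le_sum
        intro j _
        have h1 := key x hx j
        have h2 := key y hy j
        have h3 := (hx j).1
        have h4 := (hy j).1
        apply pow_le_pow_left₀ (norm_nonneg _)
        rw [Real.norm_eq_abs, abs_le]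
        simp only [PiLp.sub_apply]
        constructor <;> linarith
    _ = √d * width g C.1 := by
        rw [Finset.sum_const, Finset.card_univ, Fintype.card_fin, nsmul_eq_mul, Real.sqrt_mul
          (by positivity), Real.sqrt_sq hw.le]

lemma cell_subset_unitCube {d : ℕ} {g : ℕ → ℕ} {i : ℕ} {C : Node d} (hC : C ∈ layer d g i) :
    cell g C ⊆ unitCube d := by
  intro x hx j
  rw [mem_layer] at hC
  have hN : 0 < nBins g C.1 := by have := hC.2 j; rw [hC.1]; omega
  have hN' : (0 : ℝ) < nBins g C.1 := by exact_mod_cast hN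
  have hw : 0 < width g C.1 := by unfold width; positivity
  refine ⟨le_trans (by positivity) (hx j).1, ?_⟩
  rcases (hx j).2 with h | h
  · refine h.le.trans ?_
    rw [width, ← div_eq_mul_inv, div_le_one hN']
    have := hC.2 j
    rw [hC.1]
    exact_mod_cast this
  · exact h.2.le

/-! ### Elimination and the evolution of the active sets -/

lemma survivors_of_card_one {I : Finset Arm} (h : I.card = 1) (Y : Arm → ℝ) (U : ℝ) :
    survivors I Y U = I := if_pos h

lemma survivors_univ_of_close {Y : Arm → ℝ} {U : ℝ} (hU : 0 ≤ U) (h : |Y true - Y false| ≤ U) :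
    survivors Finset.univ Y U = Finset.univ := by
  rw [abs_le] at h
  rw [survivors, if_neg (by simp)]
  ext k
  simp only [Finset.mem_filter, Finset.mem_univ, true_and, iff_true, not_exists]
  intro k'
  cases k <;> cases k' <;> simp <;> linarith

lemma survivors_univ_of_lt {Y : Arm → ℝ} {U : ℝ} (hU : 0 ≤ U) {k : Arm} (h : U < Y k - Y (!k)) :
    survivors Finset.univ Y U = {k} := by
  rw [survivors, if_neg (by simp)]
  ext k'
  simp only [Finset.mem_filter, Finset.mem_univ, true_and, not_exists, Finset.mem_singleton]
  cases k <;> cases k' <;> simp at h ⊢ <;> first | (constructor <;> linarith) | (intro _; linarith)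

lemma survivors_univ_cases (Y : Arm → ℝ) {U : ℝ} (hU : 0 ≤ U) :
    (|Y true - Y false| ≤ U ∧ survivors Finset.univ Y U = Finset.univ) ∨
      ∃ k, U < Y k - Y (!k) ∧ survivors Finset.univ Y U = {k} := by
  by_cases h : |Y true - Y false| ≤ U
  · exact Or.inl ⟨h, survivors_univ_of_close hU h⟩
  · right
    rw [not_le, lt_abs] at h
    rcases h with h | h
    · exact ⟨true, h, survivors_univ_of_lt hU h⟩
    · exact ⟨false, by simpa using h, survivors_univ_of_lt hU (by simpa using h)⟩

lemma threshold_nonneg (d T τ : ℕ) (w : ℝ) : 0 ≤ threshold d T τ w := by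
  unfold threshold; positivity

/-- The active sets `S` when the deepest active bins are those of layer `i`. -/
structure IsProper {d : ℕ} (g : ℕ → ℕ) (i : ℕ) (S : ActiveSets d) : Prop where
  le : ∀ C ∈ S.bins, C.1 ≤ i
  mem_own_layer : ∀ C ∈ S.bins, C ∈ layer d g C.1
  arms_top : ∀ C ∈ S.bins, C.1 = i → S.arms C = Finset.univ
  arms_of_lt : ∀ C ∈ S.bins, C.1 < i → (S.arms C).card = 1
  unique : ∀ x ∈ unitCube d, ∀ C ∈ S.bins, ∀ D ∈ S.bins, x ∈ cell g C → x ∈ cell g D → C = D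

lemma IsProper.lookup_eq {d : ℕ} {g : ℕ → ℕ} {i : ℕ} {S : ActiveSets d} (hS : IsProper g i S)
    {x : Cov d} (hx : x ∈ unitCube d) {C : Node d} (hC : C ∈ S.bins) (hxC : x ∈ cell g C) :
    lookup g S.bins x = C := by
  have h : ∃ C ∈ S.bins, x ∈ cell g C := ⟨C, hC, hxC⟩
  rw [lookup, dif_pos h]
  exact hS.unique x hx _ h.choose_spec.1 _ hC h.choose_spec.2 hxC

lemma mem_grow {d : ℕ} {S : ActiveSets d} {surv : Node d → Finset Arm} {s : ℕ} {D : Node d} :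
    D ∈ (S.grow surv s).bins ↔
      ∃ C ∈ S.bins, (1 < (surv C).card ∧ D ∈ child C s) ∨ (¬ 1 < (surv C).card ∧ D = C) := by
  classical
  simp only [ActiveSets.grow, Finset.mem_biUnion]
  refine exists_congr fun C => and_congr_right fun _ => ?_
  split_ifs with h <;> simp [h]

/-- What the elimination step of a batch may do to the arms of the active bins. -/
structure IsElimination {d : ℕ} (S : ActiveSets d) (surv : Node d → Finset Arm) : Prop where
  of_card_one : ∀ C ∈ S.bins, (S.arms C).card = 1 → surv C = S.arms C
  of_univ : ∀ C ∈ S.bins, S.arms C = Finset.univ → surv C = Finset.univ ∨ (surv C).card = 1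

/-- Only bins of the deepest layer have both arms, so only they can be split; every other bin is
settled and keeps its single arm. -/
lemma IsElimination.card_eq {d : ℕ} {S : ActiveSets d} {surv : Node d → Finset Arm}
    {g : ℕ → ℕ} {i : ℕ} (hS : IsProper g i S) (h : IsElimination S surv) {C : Node d}
    (hC : C ∈ S.bins) : (1 < (surv C).card ∧ surv C = Finset.univ ∧ C.1 = i) ∨
      (¬ 1 < (surv C).card ∧ (surv C).card = 1) := by
  rcases (hS.le C hC).lt_or_eq with hlt | heq
  · have h1 := hS.arms_of_lt C hC hlt
    have h2 := h.of_card_one C hC h1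
    right; rw [h2]; omega
  · rcases h.of_univ C hC (hS.arms_top C hC heq) with h1 | h1
    · left; rw [h1]; simp [heq]
    · right; omega

/-- `ActiveSets.grow` tells children from old bins by membership in the old collection. This is
harmless because a child is deeper than all old bins. -/
lemma grow_arms_child {d : ℕ} {S : ActiveSets d} {surv : Node d → Finset Arm}
    {g : ℕ → ℕ} {i : ℕ} (hS : IsProper g i S) {C D : Node d} (hC : C.1 = i)
    (hD : D ∈ child C (g i)) : (S.grow surv (g i)).arms D = surv C := by
  have hD1 : D ∉ S.bins := fun h => by
    have := hS.le D h
    have := (mem_child.1 hD).1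
    omega
  simp [ActiveSets.grow, hD1, parent_of_mem_child hD]

lemma grow_arms_self {d : ℕ} {S : ActiveSets d} {surv : Node d → Finset Arm} {s : ℕ} {C : Node d}
    (hC : C ∈ S.bins) : (S.grow surv s).arms C = surv C := by
  simp [ActiveSets.grow, hC]

/-- Every new bin sits inside the old bin that it comes from. Two new bins with a common point
therefore have the same origin, and are either two children of it, which are disjoint unless equal,
or both the origin itself. -/
lemma IsProper.grow {d : ℕ} {S : ActiveSets d} {surv : Node d → Finset Arm}
    {g : ℕ → ℕ} {i : ℕ} (hS : IsProper g i S) (hg : 0 < g i) (h : IsElimination S surv) :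
    IsProper g (i + 1) (S.grow surv (g i)) := by
  have key : ∀ D ∈ (S.grow surv (g i)).bins, ∃ C ∈ S.bins,
      cell g D ⊆ cell g C ∧ D ∈ layer d g D.1 ∧
      ((surv C = Finset.univ ∧ C.1 = i ∧ D ∈ child C (g i)) ∨
        ((surv C).card = 1 ∧ D = C)) := by
    intro D hD
    obtain ⟨C, hC, h1⟩ := mem_grow.1 hD
    have hCl := hS.mem_own_layer C hC
    refine ⟨C, hC, ?_⟩
    rcases h.card_eq hS hC with ⟨h2, h3, h4⟩ | ⟨h2, h3⟩
    · simp only [h2, true_and, not_true_eq_false, false_and, or_false] at h1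
      rw [h4] at hCl
      refine ⟨cell_child_subset hg hCl h1, ?_, Or.inl ⟨h3, h4, h1⟩⟩
      have := child_mem_layer hCl h1
      rwa [(mem_layer.1 this).1]
    · simp only [h2, false_and, not_false_eq_true, true_and, false_or] at h1
      subst h1
      exact ⟨subset_rfl, hCl, Or.inr ⟨h3, rfl⟩⟩
  refine ⟨?_, ?_, ?_, ?_, ?_⟩
  · intro D hD
    obtain ⟨C, hC, -, -, ⟨-, h2, h3⟩ | ⟨-, rfl⟩⟩ := key D hD
    · rw [(mem_child.1 h3).1, h2]
    · have := hS.le D hC; omega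
  · intro D hD
    obtain ⟨C, hC, -, h1, -⟩ := key D hD
    exact h1
  · intro D hD hDi
    obtain ⟨C, hC, -, -, ⟨h1, h2, h3⟩ | ⟨-, rfl⟩⟩ := key D hD
    · rw [grow_arms_child hS h2 h3, h1]
    · have := hS.le D hC; omega
  · intro D hD hDi
    obtain ⟨C, hC, -, -, ⟨h1, h2, h3⟩ | ⟨h1, rfl⟩⟩ := key D hD
    · have := (mem_child.1 h3).1; omega
    · rw [grow_arms_self hC, h1]
  · intro x hx D hD D' hD' hxD hxD'
    obtain ⟨C, hC, hs, -, h1⟩ := key D hD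
    obtain ⟨C', hC', hs', -, h1'⟩ := key D' hD'
    have e := hS.unique x hx C hC C' hC' (hs hxD) (hs' hxD')
    subst e
    rcases h1 with ⟨h2, h3, h4⟩ | ⟨h2, rfl⟩
    · rcases h1' with ⟨-, -, h4'⟩ | ⟨h2', -⟩
      · have hl := hS.mem_own_layer C hC
        rw [h3] at hl
        exact layer_unique (child_mem_layer hl h4) (child_mem_layer hl h4') hxD hxD'
      · rw [h2] at h2'; simp at h2'
    · rcases h1' with ⟨h2', -, -⟩ | ⟨-, rfl⟩
      · rw [h2'] at h2; simp at h2
      · rfl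

lemma isElimination_survivors {d : ℕ} (S : ActiveSets d) (Y : Node d → Arm → ℝ) {U : Node d → ℝ}
    (hU : ∀ C, 0 ≤ U C) : IsElimination S (fun C => survivors (S.arms C) (Y C) (U C)) where
  of_card_one C _ h := survivors_of_card_one h _ _
  of_univ C _ h := by
    simp only [h]
    rcases survivors_univ_cases (Y C) (hU C) with h1 | ⟨k, -, h1⟩
    · exact Or.inl h1.2
    · right; rw [h1]; simp

/-- The layer is one ahead of the number of finished batches, as the algorithm starts in layer `1`
and not at the root. -/
lemma isProper_activeAfter {d : ℕ} (A : Inputs) (c : Choices d) (z : ℕ → Cov d × (Arm → ℝ))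
    {i : ℕ} (hg : ∀ l ≤ i, 0 < A.g l) : IsProper A.g (i + 1) (activeAfter A c z i) := by
  induction i with
  | zero =>
    have h0 : ∀ C ∈ layer d A.g 1, C.1 = 1 := fun C hC => (mem_layer.1 hC).1
    refine ⟨fun C hC => (h0 C hC).le, fun C hC => ?_, fun C hC _ => rfl, fun C hC h => ?_, ?_⟩
    · rw [h0 C hC]; exact hC
    · have := h0 C hC; omega
    · intro x _ C hC D hD; exact layer_unique hC hD
  | succ i ih =>
    exact (ih fun l hl => hg l (by omega)).grow (hg _ le_rfl)
      (isElimination_survivors _ _ fun C => threshold_nonneg _ _ _ _)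

/-! ### Round-robin means and their noise -/

open scoped Classical in
/-- The times in `(a, b]` at which the covariate falls into the bin `C`. -/
noncomputable def visitTimes {d : ℕ} (g : ℕ → ℕ) (x : ℕ → Cov d) (a b : ℕ) (C : Node d) : Finset ℕ :=
  (Finset.Ioc a b).filter fun s => x s ∈ cell g C

lemma mem_visitTimes {d : ℕ} {g : ℕ → ℕ} {x : ℕ → Cov d} {a b : ℕ} {C : Node d} {s : ℕ} :
    s ∈ visitTimes g x a b C ↔ s ∈ Finset.Ioc a b ∧ x s ∈ cell g C := by
  simp [visitTimes]

/-- The arm pulled at time `s` by a round-robin over the times `V` that starts with `k₀`. -/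
def altArm (V : Finset ℕ) (k₀ : Arm) (s : ℕ) : Arm :=
  if Even ((V.filter (· < s)).card) then k₀ else !k₀

/-- The counter of the algorithm is the rank of `s` among the visits, so the parity used by the
round-robin is a function of the visit times alone. -/
lemma visits_pred {d : ℕ} {g : ℕ → ℕ} {x : ℕ → Cov d} {a b : ℕ} {C : Node d} {s : ℕ}
    (hs : s ∈ Finset.Ioc a b) :
    visits g x a (s - 1) C = ((visitTimes g x a b C).filter (· < s)).card := by
  classical
  rw [visits, visitTimes, Finset.filter_filter]
  congr 1
  ext r
  simp only [Finset.mem_Ioc, Finset.mem_filter] at hs ⊢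
  constructor
  · rintro ⟨h1, h2⟩; refine ⟨⟨h1.1, by omega⟩, h2, by omega⟩
  · rintro ⟨h1, h2, h3⟩; exact ⟨⟨h1.1, by omega⟩, h2⟩

/-- The times at which arm `k` is pulled by the round-robin. -/
def armTimes (V : Finset ℕ) (k₀ k : Arm) : Finset ℕ := V.filter fun s => altArm V k₀ s = k

/-- The mean of `r` over the times at which arm `k` is pulled by the round-robin. -/
noncomputable def altMean (V : Finset ℕ) (k₀ : Arm) (r : ℕ → ℝ) (k : Arm) : ℝ :=
  (∑ s ∈ armTimes V k₀ k, r s) / ((armTimes V k₀ k).card : ℝ)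

/-- The weights with which `altMean V k₀ r k₀ - altMean V k₀ r (!k₀)` depends on `r`. -/
noncomputable def altCoef (V : Finset ℕ) (k₀ : Arm) (s : ℕ) : ℝ :=
  if altArm V k₀ s = k₀ then ((armTimes V k₀ k₀).card : ℝ)⁻¹
  else -((armTimes V k₀ (!k₀)).card : ℝ)⁻¹

lemma armTimes_not (V : Finset ℕ) (k₀ : Arm) :
    armTimes V k₀ (!k₀) = V.filter fun s => ¬ altArm V k₀ s = k₀ := by
  unfold armTimes
  congr 1
  ext s
  cases k₀ <;> simp

/-- Once the visit times are fixed, the difference of the means is a linear form in the rewards with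
deterministic weights; this is the form to which the sub-Gaussian estimate applies. -/
lemma sum_altCoef_mul (V : Finset ℕ) (k₀ : Arm) (r : ℕ → ℝ) :
    ∑ s ∈ V, altCoef V k₀ s * r s = altMean V k₀ r k₀ - altMean V k₀ r (!k₀) := by
  rw [← Finset.sum_filter_add_sum_filter_not V (fun s => altArm V k₀ s = k₀)]
  have h1 : ∑ s ∈ V.filter (fun s => altArm V k₀ s = k₀), altCoef V k₀ s * r s
      = altMean V k₀ r k₀ := by
    rw [altMean, Finset.sum_div]
    refine Finset.sum_congr rfl fun s hs => ?_
    rw [altCoef, if_pos (Finset.mem_filter.1 hs).2, div_eq_inv_mul]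
  have h2 : ∑ s ∈ V.filter (fun s => ¬ altArm V k₀ s = k₀), altCoef V k₀ s * r s
      = - altMean V k₀ r (!k₀) := by
    rw [altMean, Finset.sum_div, ← Finset.sum_neg_distrib, ← armTimes_not]
    refine Finset.sum_congr rfl fun s hs => ?_
    rw [armTimes_not] at hs
    rw [altCoef, if_neg (Finset.mem_filter.1 hs).2, div_eq_inv_mul, neg_mul]
  rw [h1, h2, sub_eq_add_neg]

/-- Adding a new maximum leaves the ranks of the other elements unchanged and has itself rank
`V.card`. -/
lemma card_even_rank (V : Finset ℕ) :
    (V.filter fun s => Even ((V.filter (· < s)).card)).card = (V.card + 1) / 2 := by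
  induction V using Finset.induction_on_max with
  | empty => simp
  | insert a V hmax ih =>
    have ha : a ∉ V := fun h => lt_irrefl _ (hmax a h)
    have e1 : ∀ s ∈ V, (insert a V).filter (· < s) = V.filter (· < s) := by
      intro s hs
      rw [Finset.filter_insert, if_neg (by have := hmax s hs; omega)]
    have e2 : (insert a V).filter (· < a) = V := by
      rw [Finset.filter_insert, if_neg (by omega), Finset.filter_true_of_mem hmax]
    rw [Finset.filter_insert, e2, Finset.filter_congr (q := fun s => Even ((V.filter (· < s)).card))
      (fun s hs => by rw [e1 s hs]), Finset.card_insert_of_notMem ha]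
    split_ifs with h
    · rw [Finset.card_insert_of_notMem (by simp [ha]), ih]
      obtain ⟨r, hr⟩ := h; omega
    · rw [ih]
      rw [Nat.not_even_iff_odd] at h
      obtain ⟨r, hr⟩ := h; omega

lemma card_armTimes_self (V : Finset ℕ) (k₀ : Arm) :
    (armTimes V k₀ k₀).card = (V.card + 1) / 2 := by
  rw [← card_even_rank, armTimes]
  congr 1
  refine Finset.filter_congr fun s _ => ?_
  unfold altArm
  split_ifs with h <;> simp [h]

lemma card_armTimes_not (V : Finset ℕ) (k₀ : Arm) :
    (armTimes V k₀ (!k₀)).card = V.card / 2 := by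
  have h := Finset.card_filter_add_card_filter_not (s := V) (fun s => altArm V k₀ s = k₀)
  rw [← armTimes_not] at h
  have h2 := card_armTimes_self V k₀
  rw [armTimes] at h2
  omega

lemma card_armTimes_pos {V : Finset ℕ} (hV : 2 ≤ V.card) (k₀ k : Arm) :
    0 < (armTimes V k₀ k).card := by
  have h1 := card_armTimes_self V k₀
  have h2 := card_armTimes_not V k₀
  by_cases h : k = k₀
  · rw [h]; omega
  · have : k = !k₀ := by cases k <;> cases k₀ <;> simp_all
    rw [this]; omega

/-- The linear form evaluated at its own weights is `1/n₁ + 1/n₂`, where `n₁` and `n₂` count the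
pulls of the two arms. Each count is at least `⌊V.card / 2⌋ ≥ V.card / 4` because there are at least
two visits. -/
lemma sum_altCoef_sq_le {V : Finset ℕ} (hV : 2 ≤ V.card) (k₀ : Arm) :
    ∑ s ∈ V, altCoef V k₀ s ^ 2 ≤ 8 / V.card := by
  have h := sum_altCoef_mul V k₀ (altCoef V k₀)
  have e1 : altMean V k₀ (altCoef V k₀) k₀ = ((armTimes V k₀ k₀).card : ℝ)⁻¹ := by
    have hp : (0 : ℝ) < (armTimes V k₀ k₀).card := by exact_mod_cast card_armTimes_pos hV k₀ k₀
    rw [altMean, Finset.sum_congr rfl (g := fun _ => ((armTimes V k₀ k₀).card : ℝ)⁻¹), Finset.sum_const,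
      nsmul_eq_mul]
    · field_simp
    · intro s hs; rw [altCoef, if_pos (Finset.mem_filter.1 hs).2]
  have e2 : altMean V k₀ (altCoef V k₀) (!k₀) = -((armTimes V k₀ (!k₀)).card : ℝ)⁻¹ := by
    have hp : (0 : ℝ) < (armTimes V k₀ (!k₀)).card := by
      exact_mod_cast card_armTimes_pos hV k₀ (!k₀)
    rw [altMean, Finset.sum_congr rfl (g := fun _ => -((armTimes V k₀ (!k₀)).card : ℝ)⁻¹),
      Finset.sum_const, nsmul_eq_mul]
    · field_simp
    · intro s hs
      rw [armTimes_not] at hs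
      rw [altCoef, if_neg (Finset.mem_filter.1 hs).2]
  have hm : (0 : ℝ) < V.card := by positivity
  have b1 : ((armTimes V k₀ k₀).card : ℝ)⁻¹ ≤ 4 / V.card := by
    rw [card_armTimes_self, inv_le_comm₀ (by have : 0 < (V.card + 1) / 2 := by omega
                                             exact_mod_cast this) (by positivity), inv_div,
      div_le_iff₀ (by norm_num)]
    have : V.card ≤ (V.card + 1) / 2 * 4 := by omega
    exact_mod_cast this
  have b2 : ((armTimes V k₀ (!k₀)).card : ℝ)⁻¹ ≤ 4 / V.card := by
    rw [card_armTimes_not, inv_le_comm₀ (by have : 0 < V.card / 2 := by omega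
                                            exact_mod_cast this) (by positivity), inv_div,
      div_le_iff₀ (by norm_num)]
    have : V.card ≤ V.card / 2 * 4 := by omega
    exact_mod_cast this
  calc ∑ s ∈ V, altCoef V k₀ s ^ 2 = ∑ s ∈ V, altCoef V k₀ s * altCoef V k₀ s :=
        Finset.sum_congr rfl fun s _ => sq _
    _ ≤ 4 / V.card + 4 / V.card := by rw [h, e1, e2]; linarith
    _ = _ := by ring

/-- The noise of the difference of the mean rewards of the two arms. -/
noncomputable def noise {d : ℕ} (f : Arm → Cov d → ℝ) (z : ℕ → Cov d × (Arm → ℝ)) (V : Finset ℕ)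
    (k₀ : Arm) : ℝ :=
  ∑ s ∈ V, altCoef V k₀ s * ((z s).2 (altArm V k₀ s) - f (altArm V k₀ s) (z s).1)

/-- The event that the statistics of batch `(a, b]` in the bin `C` are not reliable: the number of
visits lies outside `[lo, hi]`, or the noise of the mean rewards exceeds half the threshold. -/
def Bad {d : ℕ} (g : ℕ → ℕ) (T : ℕ) (f : Arm → Cov d → ℝ) (lo hi : ℝ) (a b : ℕ) (C : Node d)
    (z : ℕ → Cov d × (Arm → ℝ)) : Prop :=
  ((visitTimes g (fun s => (z s).1) a b C).card : ℝ) < lo ∨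
  hi < ((visitTimes g (fun s => (z s).1) a b C).card : ℝ) ∨
  ∃ k₀, threshold d T (visitTimes g (fun s => (z s).1) a b C).card (width g C.1) / 2 <
    |noise f z (visitTimes g (fun s => (z s).1) a b C) k₀|

lemma altMean_sub (V : Finset ℕ) (k₀ : Arm) (r r' : ℕ → ℝ) (k : Arm) :
    altMean V k₀ (fun s => r s - r' s) k = altMean V k₀ r k - altMean V k₀ r' k := by
  simp only [altMean, Finset.sum_sub_distrib, sub_div]

lemma abs_altMean_sub_le {V : Finset ℕ} (hV : 2 ≤ V.card) (k₀ k : Arm) {r : ℕ → ℝ} {y ε : ℝ}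
    (h : ∀ s ∈ V, altArm V k₀ s = k → |r s - y| ≤ ε) : |altMean V k₀ r k - y| ≤ ε := by
  have hp : (0 : ℝ) < (armTimes V k₀ k).card := by exact_mod_cast card_armTimes_pos hV k₀ k
  have e : altMean V k₀ r k - y
      = (∑ s ∈ armTimes V k₀ k, (r s - y)) / ((armTimes V k₀ k).card : ℝ) := by
    rw [altMean, Finset.sum_sub_distrib, Finset.sum_const, nsmul_eq_mul]
    field_simp
  rw [e, abs_div, abs_of_pos hp, div_le_iff₀ hp]
  calc |∑ s ∈ armTimes V k₀ k, (r s - y)| ≤ ∑ s ∈ armTimes V k₀ k, |r s - y| :=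
        Finset.abs_sum_le_sum_abs _ _
    _ ≤ ∑ _s ∈ armTimes V k₀ k, ε := Finset.sum_le_sum fun s hs =>
        h s (Finset.mem_filter.1 hs).1 (Finset.mem_filter.1 hs).2
    _ = _ := by rw [Finset.sum_const, nsmul_eq_mul, mul_comm]

/-! ### Bias of the means through the smoothness of the rewards -/

section Smooth

variable {d : ℕ} {p : ClassParams} {f : Arm → Cov d → ℝ} {g : ℕ → ℕ}

/-- The smoothness condition on the mean rewards. -/
def IsSmooth (p : ClassParams) (f : Arm → Cov d → ℝ) : Prop :=
  ∀ k : Arm, ∀ x ∈ unitCube d, ∀ y ∈ unitCube d, |f k x - f k y| ≤ p.L * ‖x - y‖ ^ p.β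

/-- The diameter of a cube is `√d` times its width; this is where the factor `d^{β/2}` of `c₀` comes
from. -/
lemma abs_sub_le_of_mem_cell (hp : p.Valid) (hf : IsSmooth p f) {i : ℕ}
    {C : Node d} (hC : C ∈ layer d g i) (hN : 0 < nBins g i) {x y : Cov d}
    (hx : x ∈ cell g C) (hy : y ∈ cell g C) (k : Arm) :
    |f k x - f k y| ≤ p.L * (d : ℝ) ^ (p.β / 2) * width g i ^ p.β := by
  have hC1 := (mem_layer.1 hC).1
  have hsub := cell_subset_unitCube hC
  have hw : 0 ≤ width g i := by unfold width; positivity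
  refine (hf k x (hsub hx) y (hsub hy)).trans ?_
  rw [mul_assoc]
  refine mul_le_mul_of_nonneg_left ?_ hp.L_pos.le
  have h1 := norm_sub_le_of_mem_cell (by rw [hC1]; exact hN) hx hy
  rw [hC1] at h1
  calc ‖x - y‖ ^ p.β ≤ (√d * width g i) ^ p.β :=
        Real.rpow_le_rpow (norm_nonneg _) h1 hp.β_pos.le
    _ = _ := by
      rw [Real.mul_rpow (Real.sqrt_nonneg _) hw, Real.sqrt_eq_rpow, ← Real.rpow_mul (by positivity)]
      congr 2; ring

/-- On reliable statistics, the difference of the mean rewards is close to the gap on the bin. -/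
lemma abs_altMean_diff_sub_gap_le (hp : p.Valid) (hf : IsSmooth p f) {i : ℕ}
    {C : Node d} (hC : C ∈ layer d g i) (hN : 0 < nBins g i) {z : ℕ → Cov d × (Arm → ℝ)}
    {T a b : ℕ} {lo hi : ℝ} (hlo : 2 ≤ lo) (hgood : ¬ Bad g T f lo hi a b C z)
    {x : Cov d} (hx : x ∈ cell g C) (k₀ : Arm) {V : Finset ℕ}
    (hV : V = visitTimes g (fun s => (z s).1) a b C)
    {r : ℕ → ℝ} (hr : r = fun s => (z s).2 (altArm V k₀ s)) (k : Arm) :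
    |(altMean V k₀ r k - altMean V k₀ r (!k)) - (f k x - f (!k) x)| ≤
      threshold d T V.card (width g i) / 2 +
        2 * p.L * (d : ℝ) ^ (p.β / 2) * width g i ^ p.β := by
  rw [Bad, ← hV, (mem_layer.1 hC).1] at hgood
  push Not at hgood
  obtain ⟨h1, -, h3⟩ := hgood
  have hV2 : 2 ≤ V.card := by exact_mod_cast hlo.trans h1
  have key : ∀ k, |altMean V k₀ (fun s => f (altArm V k₀ s) (z s).1) k - f k x| ≤
      p.L * (d : ℝ) ^ (p.β / 2) * width g i ^ p.β := by
    intro k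
    refine abs_altMean_sub_le hV2 k₀ k fun s hs hk => ?_
    rw [hk]
    rw [hV] at hs
    exact abs_sub_le_of_mem_cell hp hf hC hN (mem_visitTimes.1 hs).2 hx k
  have hn := h3 k₀
  rw [noise, sum_altCoef_mul, altMean_sub, altMean_sub, ← hr] at hn
  have ha := key k₀
  have hb := key (!k₀)
  -- The noise contributes half a threshold, and each of the two means a bias of `L d^{β/2} w^β`.
  -- The case of the other arm is the same inequality with the sign reversed.
  have main : |(altMean V k₀ r k₀ - altMean V k₀ r (!k₀)) - (f k₀ x - f (!k₀) x)| ≤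
      threshold d T V.card (width g i) / 2 +
        2 * p.L * (d : ℝ) ^ (p.β / 2) * width g i ^ p.β := by
    rw [abs_le] at hn ha hb ⊢
    constructor <;> linarith [hn.1, hn.2, ha.1, ha.2, hb.1, hb.2]
  by_cases h : k = k₀
  · rw [h]; exact main
  · have : k = !k₀ := by cases k <;> cases k₀ <;> simp_all
    rw [this, Bool.not_not]
    rw [← abs_neg] at main
    convert main using 2
    ring

end Smooth

/-! ### One batch of the algorithm, and its state along a fixed covariate -/

section Step

variable {d : ℕ} (A : Inputs) (c : Choices d) (z : ℕ → Cov d × (Arm → ℝ))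

/-- The arms of the bin `C` that survive batch `i + 1`. -/
noncomputable def survAfter (i : ℕ) (C : Node d) : Finset Arm :=
  let S := activeAfter A c z i
  let x : ℕ → Cov d := fun s => (z s).1
  let act : ℕ → Arm := fun s => exploreRule A.g S x (A.t i) (c.first (i + 1)) s (x s)
  let rew : ℕ → ℝ := fun s => (z s).2 (act s)
  survivors (S.arms C) (meanReward A.g x act rew (A.t i) (A.t (i + 1)) C)
    (threshold d A.T (visits A.g x (A.t i) (A.t (i + 1)) C) (width A.g C.1))

lemma activeAfter_succ (i : ℕ) :
    activeAfter A c z (i + 1) = (activeAfter A c z i).grow (survAfter A c z i) (A.g (i + 1)) := rfl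

lemma isElimination_survAfter (i : ℕ) :
    IsElimination (activeAfter A c z i) (survAfter A c z i) :=
  isElimination_survivors _ _ fun _ => threshold_nonneg _ _ _ _

variable {A c z}

/-- With both arms active, `pick` returns the proposed arm, so the rule is a pure alternation over
the visits. The statistics of an active bin thus coincide with those used in `Bad`, which do not
refer to the algorithm. -/
lemma exploreRule_eq_altArm {g : ℕ → ℕ} {i : ℕ} {S : ActiveSets d} (hS : IsProper g i S)
    {C : Node d} (hC : C ∈ S.bins) (hu : S.arms C = Finset.univ) {x : ℕ → Cov d} {a b : ℕ}
    (first : Node d → Arm) {s : ℕ} (hs : s ∈ visitTimes g x a b C) :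
    exploreRule g S x a first s (x s) = altArm (visitTimes g x a b C) (first C) s := by
  obtain ⟨h1, h2⟩ := mem_visitTimes.1 hs
  have hx : x s ∈ unitCube d := cell_subset_unitCube (hS.mem_own_layer C hC) h2
  simp only [exploreRule, hS.lookup_eq hx hC h2, hu, pick, Finset.mem_univ, if_true,
    visits_pred h1, altArm]

lemma meanReward_eq_altMean {g : ℕ → ℕ} {i : ℕ} {S : ActiveSets d} (hS : IsProper g i S)
    {C : Node d} (hC : C ∈ S.bins) (hu : S.arms C = Finset.univ) {x : ℕ → Cov d} {a b : ℕ}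
    (first : Node d → Arm) (y : ℕ → Arm → ℝ) :
    meanReward g x (fun s => exploreRule g S x a first s (x s))
      (fun s => y s (exploreRule g S x a first s (x s))) a b C =
    altMean (visitTimes g x a b C) (first C)
      (fun s => y s (altArm (visitTimes g x a b C) (first C) s)) := by
  classical
  ext k
  have e : (Finset.Ioc a b).filter
      (fun s => x s ∈ cell g C ∧ exploreRule g S x a first s (x s) = k) =
      armTimes (visitTimes g x a b C) (first C) k := by
    rw [← Finset.filter_filter]
    exact Finset.filter_congr fun s hs => by rw [exploreRule_eq_altArm hS hC hu (b := b) first hs]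
  unfold meanReward altMean
  rw [← e]
  congr 1
  refine Finset.sum_congr (by congr) fun s hs => ?_
  beta_reduce
  rw [exploreRule_eq_altArm hS hC hu (b := b) first]
  rw [mem_visitTimes]
  simp only [Finset.mem_filter] at hs
  exact ⟨hs.1, hs.2.1⟩

/-- On reliable statistics, an eliminated arm is worse on the whole bin, and without an elimination
the gap is small. -/
lemma survAfter_of_good {p : ClassParams} (hp : p.Valid) {f : Arm → Cov d → ℝ}
    (hf : IsSmooth p f) {i : ℕ} (hg : ∀ l ≤ i, 0 < A.g l) {C : Node d}
    (hC : C ∈ (activeAfter A c z i).bins) (hCi : C.1 = i + 1) {lo hi r : ℝ} (hlo : 2 ≤ lo)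
    (hU1 : ∀ m : ℕ, lo ≤ m → m ≤ hi →
      2 * c0 d p * width A.g (i + 1) ^ p.β ≤ threshold d A.T m (width A.g (i + 1)))
    (hU2 : ∀ m : ℕ, lo ≤ m → m ≤ hi →
      2 * threshold d A.T m (width A.g (i + 1)) ≤ r)
    (hgood : ¬ Bad A.g A.T f lo hi (A.t i) (A.t (i + 1)) C z) {x : Cov d} (hx : x ∈ cell A.g C) :
    (survAfter A c z i C = Finset.univ ∧
      |f true x - f false x| ≤ r) ∨
    ∃ k, survAfter A c z i C = {k} ∧ f (!k) x ≤ f k x := by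
  have hS := isProper_activeAfter A c z hg
  have hu := hS.arms_top C hC hCi
  have hl := hS.mem_own_layer C hC
  rw [hCi] at hl
  have hN : 0 < nBins A.g (i + 1) := Finset.prod_pos fun l hl => hg l (by simp at hl; omega)
  have hw : 0 < width A.g (i + 1) := by unfold width; positivity
  have hwb : 0 < width A.g (i + 1) ^ p.β := Real.rpow_pos_of_pos hw _
  have hm : visits A.g (fun s => (z s).1) (A.t i) (A.t (i + 1)) C =
    (visitTimes A.g (fun s => (z s).1) (A.t i) (A.t (i + 1)) C).card := rfl
  have key := fun k => abs_altMean_diff_sub_gap_le hp hf hl hN hlo hgood hx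
    (c.first (i + 1) C) rfl rfl k
  have hgood' := hgood
  rw [Bad] at hgood'
  push Not at hgood'
  have hU1' := hU1 _ hgood'.1 hgood'.2.1
  have hU2' := hU2 _ hgood'.1 hgood'.2.1
  have hsurv : survAfter A c z i C = survivors Finset.univ
      (altMean (visitTimes A.g (fun s => (z s).1) (A.t i) (A.t (i + 1)) C) (c.first (i + 1) C)
        (fun s => (z s).2 (altArm (visitTimes A.g (fun s => (z s).1) (A.t i) (A.t (i + 1)) C)
          (c.first (i + 1) C) s)))
      (threshold d A.T (visitTimes A.g (fun s => (z s).1) (A.t i) (A.t (i + 1)) C).card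
        (width A.g (i + 1))) := by
    simp only [survAfter]
    rw [meanReward_eq_altMean hS hC hu (x := fun s => (z s).1) (c.first (i + 1))
      (fun s => (z s).2), hu, hm, hCi]
  rw [hsurv]
  set V := visitTimes A.g (fun s => (z s).1) (A.t i) (A.t (i + 1)) C
  set Y := altMean V (c.first (i + 1) C)
    (fun s => (z s).2 (altArm V (c.first (i + 1) C) s))
  set U := threshold d A.T V.card (width A.g (i + 1))
  -- The summand `1` in `c₀` leaves a margin `w^β`. Noise plus bias is then below `U`: an observed
  -- difference above `U` forces a positive gap on the whole bin, and one of at most `U` forces a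
  -- gap of at most `2 U`.
  have hU : 2 * p.L * (d : ℝ) ^ (p.β / 2) * width A.g (i + 1) ^ p.β + width A.g (i + 1) ^ p.β
      ≤ U / 2 := by
    unfold c0 at hU1'; linarith
  rcases survivors_univ_cases Y (threshold_nonneg d A.T V.card (width A.g (i + 1))) with
    ⟨h1, h2⟩ | ⟨k, h1, h2⟩
  · left
    refine ⟨h2, ?_⟩
    have h3 := key true
    simp only [Bool.not_true] at h3
    rw [abs_le] at h1 h3 ⊢
    constructor <;> linarith [h1.1, h1.2, h3.1, h3.2]
  · right
    refine ⟨k, h2, ?_⟩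
    have h3 := key k
    rw [abs_le] at h3
    linarith [h3.1, h3.2]

/-- The state of the algorithm at `x` after `i` batches: the bin of `x` has both arms and a small gap
at `x`, or a single best arm, or the statistics of an earlier bin around `x` were not reliable. -/
def PathStatus (A : Inputs) (c : Choices d) (z : ℕ → Cov d × (Arm → ℝ)) (f : Arm → Cov d → ℝ)
    (lo hi rad : ℕ → ℝ) (i : ℕ) (x : Cov d) : Prop :=
  ∃ C ∈ (activeAfter A c z i).bins, x ∈ cell A.g C ∧
    ((C.1 = i + 1 ∧ |f true x - f false x| ≤ rad (i + 1)) ∨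
      (∃ k, (activeAfter A c z i).arms C = {k} ∧ f (!k) x ≤ f k x) ∨
      ∃ j, 1 ≤ j ∧ j ≤ i ∧ |f true x - f false x| ≤ rad j ∧ ∃ D ∈ layer d A.g j, x ∈ cell A.g D ∧
        Bad A.g A.T f (lo j) (hi j) (A.t (j - 1)) (A.t j) D z)

lemma exists_bin_succ {i : ℕ} (hg : ∀ l ≤ i + 1, 0 < A.g l) {C : Node d}
    (hC : C ∈ (activeAfter A c z i).bins) {x : Cov d} (hx : x ∈ cell A.g C) :
    ∃ D ∈ (activeAfter A c z (i + 1)).bins, x ∈ cell A.g D ∧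
      (activeAfter A c z (i + 1)).arms D = survAfter A c z i C ∧
      (survAfter A c z i C = Finset.univ → D.1 = i + 2) := by
  have hS := isProper_activeAfter A c z fun l (hl : l ≤ i) => hg l (by omega)
  have hl := hS.mem_own_layer C hC
  rw [activeAfter_succ]
  rcases (isElimination_survAfter A c z i).card_eq hS hC with ⟨h1, h2, h3⟩ | ⟨h1, h2⟩
  · rw [h3] at hl
    obtain ⟨D, hD, hxD⟩ := exists_child (hg (i + 1) le_rfl) (cell_subset_unitCube hl hx) hl hx
    exact ⟨D, mem_grow.2 ⟨C, hC, Or.inl ⟨h1, hD⟩⟩, hxD, grow_arms_child hS h3 hD,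
      fun _ => by rw [(mem_child.1 hD).1, h3]⟩
  · refine ⟨C, mem_grow.2 ⟨C, hC, Or.inr ⟨h1, rfl⟩⟩, hx, grow_arms_self hC, fun h => ?_⟩
    rw [h] at h2
    simp at h2

/-- The induction follows the bin of `x` from batch to batch. The first unreliable batch moves the
state to the third alternative, which persists. The gap bound valid when that batch began is
recorded there, so that a failure later costs a small gap and not a constant. -/
lemma pathStatus {p : ClassParams} (hp : p.Valid) {f : Arm → Cov d → ℝ}
    (hf : IsSmooth p f) {i : ℕ} (hg : ∀ l ≤ i, 0 < A.g l) {lo hi rad : ℕ → ℝ}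
    (hlo : ∀ j, 1 ≤ j → j ≤ i → 2 ≤ lo j)
    (hU1 : ∀ j, 1 ≤ j → j ≤ i → ∀ m : ℕ, lo j ≤ m → m ≤ hi j →
      2 * c0 d p * width A.g j ^ p.β ≤ threshold d A.T m (width A.g j))
    (hU2 : ∀ j, 1 ≤ j → j ≤ i → ∀ m : ℕ, lo j ≤ m → m ≤ hi j →
      2 * threshold d A.T m (width A.g j) ≤ rad (j + 1))
    {x : Cov d} (hx : x ∈ unitCube d) (h1 : |f true x - f false x| ≤ rad 1) :
    PathStatus A c z f lo hi rad i x := by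
  induction i with
  | zero =>
    have hN : 0 < nBins A.g 1 := Finset.prod_pos fun l hl => hg l (by simp at hl; omega)
    obtain ⟨C, hC, hxC⟩ := exists_mem_layer hN hx
    exact ⟨C, hC, hxC, Or.inl ⟨(mem_layer.1 hC).1, h1⟩⟩
  | succ i ih =>
    obtain ⟨C, hC, hxC, h⟩ := ih (fun l hl => hg l (by omega)) (fun j h hj => hlo j h (by omega))
      (fun j h hj => hU1 j h (by omega)) (fun j h hj => hU2 j h (by omega))
    obtain ⟨D, hD, hxD, hDarms, hD1⟩ := exists_bin_succ hg hC hxC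
    have hS := isProper_activeAfter A c z fun l (hl : l ≤ i) => hg l (by omega)
    refine ⟨D, hD, hxD, ?_⟩
    rw [hDarms]
    rcases h with ⟨hCi, hgap⟩ | ⟨k, hk, hbest⟩ | ⟨j, hj1, hj, h2⟩
    · by_cases hgood : Bad A.g A.T f (lo (i + 1)) (hi (i + 1)) (A.t i) (A.t (i + 1)) C z
      · have hl := hS.mem_own_layer C hC
        rw [hCi] at hl
        exact Or.inr (Or.inr ⟨i + 1, by omega, le_rfl, hgap, C, hl, hxC, hgood⟩)
      · rcases survAfter_of_good hp hf (fun l hl => hg l (by omega)) hC hCi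
          (hlo (i + 1) (by omega) le_rfl) (hU1 (i + 1) (by omega) le_rfl)
          (hU2 (i + 1) (by omega) le_rfl) hgood hxC with ⟨h2, h3⟩ | h2
        · exact Or.inl ⟨hD1 h2, h3⟩
        · exact Or.inr (Or.inl h2)
    · refine Or.inr (Or.inl ⟨k, ?_, hbest⟩)
      rw [(isElimination_survAfter A c z i).of_card_one C hC (by rw [hk]; simp), hk]
    · exact Or.inr (Or.inr ⟨j, hj1, by omega, h2⟩)

/-- The gap between the two arms at `x`, if it is at most `r`. -/
noncomputable def smallGap (f : Arm → Cov d → ℝ) (r : ℝ) (x : Cov d) : ℝ :=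
  if |f true x - f false x| ≤ r then |f true x - f false x| else 0

lemma smallGap_nonneg (f : Arm → Cov d → ℝ) (r : ℝ) (x : Cov d) : 0 ≤ smallGap f r x := by
  unfold smallGap; split_ifs <;> simp

lemma max_sub_le_abs_gap (f : Arm → Cov d → ℝ) (x : Cov d) (k : Arm) :
    max (f true x) (f false x) - f k x ≤ |f true x - f false x| := by
  cases k <;> rcases le_total (f true x) (f false x) with h | h <;>
    simp [h, abs_of_nonneg, abs_of_nonpos]

lemma max_sub_nonneg (f : Arm → Cov d → ℝ) (x : Cov d) (k : Arm) :
    0 ≤ max (f true x) (f false x) - f k x := by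
  cases k <;> simp

/-- A single active arm leaves nothing to choose, neither for the round-robin nor in the last batch.
-/
lemma basedb_of_singleton {i t : ℕ} (ht : batchOf A t = i + 1) (hg : ∀ l ≤ i, 0 < A.g l)
    {C : Node d} (hC : C ∈ (activeAfter A c z i).bins) {k : Arm}
    (hk : (activeAfter A c z i).arms C = {k}) {x : Cov d} (hx : x ∈ unitCube d)
    (hxC : x ∈ cell A.g C) : basedb A c z t x = k := by
  have hS := isProper_activeAfter A c z hg
  have hpick : ∀ k', pick {k} k' = k := by
    intro k'; cases k <;> cases k' <;> simp [pick]
  simp only [basedb, ht, Nat.add_sub_cancel, exploreRule, hS.lookup_eq hx hC hxC, hk, hpick,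
    ite_self]

open scoped Classical in
/-- The regret of one decision is bounded by small gaps. -/
lemma regret_le_smallGap {i t : ℕ} (ht : batchOf A t = i + 1) (hg : ∀ l ≤ i, 0 < A.g l)
    {f : Arm → Cov d → ℝ} {lo hi rad : ℕ → ℝ} {x : Cov d} (hx : x ∈ unitCube d)
    (h : PathStatus A c z f lo hi rad i x) :
    max (f true x) (f false x) - f (basedb A c z t x) x ≤ smallGap f (rad (i + 1)) x +
      ∑ j ∈ Finset.Icc 1 i, ∑ D ∈ layer d A.g j,
        if x ∈ cell A.g D ∧ Bad A.g A.T f (lo j) (hi j) (A.t (j - 1)) (A.t j) D z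
        then smallGap f (rad j) x else 0 := by
  have hterm : ∀ j D, 0 ≤ (if x ∈ cell A.g D ∧
      Bad A.g A.T f (lo j) (hi j) (A.t (j - 1)) (A.t j) D z then smallGap f (rad j) x else 0) := by
    intro j D; split_ifs
    · exact smallGap_nonneg _ _ _
    · exact le_rfl
  have hsum := Finset.sum_nonneg fun j (_ : j ∈ Finset.Icc 1 i) =>
    Finset.sum_nonneg fun D (_ : D ∈ layer d A.g j) => hterm j D
  obtain ⟨C, hC, hxC, ⟨-, h1⟩ | ⟨k, hk, hbest⟩ | ⟨j, hj1, hj, h1, D, hD, hxD, hbad⟩⟩ := h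
  · have := max_sub_le_abs_gap f x (basedb A c z t x)
    rw [smallGap, if_pos h1]
    linarith
  · rw [basedb_of_singleton ht hg hC hk hx hxC]
    have : max (f true x) (f false x) = f k x := by
      cases k <;> simp at hbest <;> simp [hbest]
    have h0 := smallGap_nonneg f (rad (i + 1)) x
    linarith
  · have h2 := max_sub_le_abs_gap f x (basedb A c z t x)
    have h0 := smallGap_nonneg f (rad (i + 1)) x
    have h3 : |f true x - f false x| ≤ ∑ j ∈ Finset.Icc 1 i, ∑ D ∈ layer d A.g j,
        if x ∈ cell A.g D ∧ Bad A.g A.T f (lo j) (hi j) (A.t (j - 1)) (A.t j) D z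
        then smallGap f (rad j) x else 0 := by
      refine le_trans ?_ (Finset.single_le_sum (fun j _ => Finset.sum_nonneg fun D _ => hterm j D)
        (Finset.mem_Icc.2 ⟨hj1, hj⟩))
      refine le_trans ?_ (Finset.single_le_sum (fun D _ => hterm j D) hD)
      rw [if_pos ⟨hxD, hbad⟩, smallGap, if_pos h1]
    linarith

end Step

/-! ### Measurability of the algorithm -/

section Measurability

variable {d : ℕ} {Ω : Type*} [MeasurableSpace Ω] {g : ℕ → ℕ}

lemma measurableSet_cell (g : ℕ → ℕ) (C : Node d) : MeasurableSet (cell g C) := by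
  have : cell g C = ⋂ j, {x : Cov d | (C.2 j : ℝ) * width g C.1 ≤ x j ∧
    (x j < ((C.2 j : ℝ) + 1) * width g C.1 ∨ (C.2 j + 1 = nBins g C.1 ∧ x j = 1))} := by
    ext x; simp [cell]
  rw [this]
  refine MeasurableSet.iInter fun j => ?_
  have hj : Measurable fun x : Cov d => x j := by fun_prop
  refine MeasurableSet.inter (measurableSet_le measurable_const hj)
    ((measurableSet_lt hj measurable_const).union (MeasurableSet.inter (MeasurableSet.const _)
      (measurableSet_eq_fun hj measurable_const)))

lemma measurableSet_unitCube : MeasurableSet (unitCube d) := by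
  have : unitCube d = ⋂ j, {x : Cov d | 0 ≤ x j ∧ x j ≤ 1} := by ext x; simp [unitCube]
  rw [this]
  refine MeasurableSet.iInter fun j => ?_
  have hj : Measurable fun x : Cov d => x j := by fun_prop
  exact (measurableSet_le measurable_const hj).inter (measurableSet_le hj measurable_const)

lemma measurable_mem_cell {x : Ω → Cov d} (hx : Measurable x) (C : Node d) :
    Measurable fun ω => x ω ∈ cell g C :=
  measurableSet_setOfPred.1 (hx (measurableSet_cell g C))

/-- A random finite set of a countable type is measurable if membership of every point is. -/
lemma measurable_comp_finset {ι β : Type*} [Countable ι] [MeasurableSpace β] {W : Ω → Finset ι}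
    (hW : ∀ C, Measurable fun ω => C ∈ W ω) (F : Finset ι → β) : Measurable fun ω => F (W ω) := by
  intro s _
  -- There are countably many finite sets, so the preimage is a countable union over the possible
  -- values of `W`, and `F` may be arbitrary.
  have : (fun ω => F (W ω)) ⁻¹' s = ⋃ W₀ ∈ {W₀ | F W₀ ∈ s}, ⋂ C, {ω | C ∈ W ω ↔ C ∈ W₀} := by
    ext ω
    simp only [Set.mem_preimage, Set.mem_iUnion, Set.mem_iInter, Set.mem_ofPred_eq, exists_prop]
    constructor
    · intro h; exact ⟨W ω, h, fun C => Iff.rfl⟩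
    · rintro ⟨W₀, h, h1⟩
      have : W ω = W₀ := Finset.ext h1
      rwa [this]
  rw [this]
  exact MeasurableSet.biUnion (Set.to_countable _) fun W₀ _ => MeasurableSet.iInter fun C =>
    measurableSet_setOfPred.2 ((hW C).iff measurable_const)

/-- The membership events of random active sets are measurable. -/
structure MeasurableActive (S : Ω → ActiveSets d) : Prop where
  bins : ∀ C, Measurable fun ω => C ∈ (S ω).bins
  arms : ∀ C k, Measurable fun ω => k ∈ (S ω).arms C

/-- `lookup` makes an arbitrary choice, but the choice depends only on the finite set of active bins
that contain the covariate. It is therefore a function of a random finite set. -/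
lemma measurable_lookup {B : Ω → Finset (Node d)} (hB : ∀ C, Measurable fun ω => C ∈ B ω)
    {x : Ω → Cov d} (hx : Measurable x) : Measurable fun ω => lookup g (B ω) (x ω) := by
  classical
  let F : Finset (Node d) → Node d := fun W =>
    if h : ∃ C, C ∈ W then h.choose else (0, fun _ => 0)
  have h1 : ∀ ω, lookup g (B ω) (x ω) = F ((B ω).filter fun C => x ω ∈ cell g C) := by
    intro ω
    have e : (fun C => C ∈ B ω ∧ x ω ∈ cell g C) =
        fun C => C ∈ (B ω).filter fun C => x ω ∈ cell g C := by
      ext C; simp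
    simp only [lookup, F]
    by_cases h : ∃ C ∈ B ω, x ω ∈ cell g C
    · have h' : ∃ C, C ∈ (B ω).filter fun C => x ω ∈ cell g C := by rw [← e]; exact h
      rw [dif_pos h, dif_pos h']
      congr 1
    · have h' : ¬ ∃ C, C ∈ (B ω).filter fun C => x ω ∈ cell g C := by rw [← e]; exact h
      rw [dif_neg h, dif_neg h']
  simp only [h1]
  refine measurable_comp_finset (fun C => ?_) F
  simp only [Finset.mem_filter]
  exact (hB C).and (measurable_mem_cell hx C)

lemma measurable_arms_comp {S : Ω → ActiveSets d} (hS : MeasurableActive S) {L : Ω → Node d}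
    (hL : Measurable L) (k : Arm) : Measurable fun ω => k ∈ (S ω).arms (L ω) := by
  have : (fun ω => k ∈ (S ω).arms (L ω)) = fun ω => ∃ C, L ω = C ∧ k ∈ (S ω).arms C := by
    ext ω; simp
  rw [this]
  exact Measurable.exists fun C => (measurableSet_setOfPred.1 (hL (measurableSet_singleton C))).and
    (hS.arms C k)

lemma measurable_pick {I : Ω → Finset Arm} (hI : ∀ k, Measurable fun ω => k ∈ I ω)
    {k : Ω → Arm} (hk : Measurable k) : Measurable fun ω => pick (I ω) (k ω) := by
  unfold pick
  have h1 : Measurable fun ω => k ω ∈ I ω := by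
    have : (fun ω => k ω ∈ I ω) = fun ω => ∃ k', k ω = k' ∧ k' ∈ I ω := by ext ω; simp
    rw [this]
    exact Measurable.exists fun k' =>
      (measurableSet_setOfPred.1 (hk (measurableSet_singleton k'))).and (hI k')
  exact Measurable.ite (measurableSet_setOfPred.2 h1) hk ((measurable_of_countable fun b : Bool => !b).comp hk)

lemma measurable_visits {x : ℕ → Ω → Cov d} {a b : ℕ} (hx : ∀ s ∈ Finset.Ioc a b, Measurable (x s))
    (C : Node d) : Measurable fun ω => visits g (fun s => x s ω) a b C := by
  classical
  simp only [visits, Finset.card_filter]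
  exact Finset.measurable_fun_sum _ fun s hs => Measurable.ite (hx s hs (measurableSet_cell g C))
    measurable_const measurable_const

lemma measurable_exploreRule {S : Ω → ActiveSets d} (hS : MeasurableActive S)
    {x : ℕ → Ω → Cov d} {a t : ℕ} (hx : ∀ s ∈ Finset.Ioc a (t - 1), Measurable (x s))
    {first : Ω → Node d → Arm} (hfirst : ∀ C, Measurable fun ω => first ω C)
    {y : Ω → Cov d} (hy : Measurable y) :
    Measurable fun ω => exploreRule g (S ω) (fun s => x s ω) a (first ω) t (y ω) := by
  have hL : Measurable fun ω => lookup g (S ω).bins (y ω) := measurable_lookup hS.bins hy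
  simp only [exploreRule]
  refine measurable_pick (measurable_arms_comp hS hL) ?_
  have h1 : Measurable fun ω => first ω (lookup g (S ω).bins (y ω)) := by
    refine measurable_to_countable' fun k => ?_
    have : (fun ω => first ω (lookup g (S ω).bins (y ω))) ⁻¹' {k} =
        {ω | ∃ C, lookup g (S ω).bins (y ω) = C ∧ first ω C = k} := by ext ω; simp
    rw [this]
    exact measurableSet_setOfPred.2 (Measurable.exists fun C =>
      (measurableSet_setOfPred.1 (hL (measurableSet_singleton C))).and
      (measurableSet_setOfPred.1 (hfirst C (measurableSet_singleton k))))
  refine Measurable.ite ?_ h1 ((measurable_of_countable fun b : Bool => !b).comp h1)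
  have : {ω | Even (visits g (fun s => x s ω) a (t - 1) (lookup g (S ω).bins (y ω)))} =
      {ω | ∃ C, lookup g (S ω).bins (y ω) = C ∧ Even (visits g (fun s => x s ω) a (t - 1) C)} := by
    ext ω; simp
  rw [this]
  refine measurableSet_setOfPred.2 (Measurable.exists fun C =>
      (measurableSet_setOfPred.1 (hL (measurableSet_singleton C))).and ?_)
  exact (measurable_of_countable fun n : ℕ => Even n).comp (measurable_visits hx C)

lemma measurable_meanReward {x : ℕ → Ω → Cov d} {act : ℕ → Ω → Arm} {r : ℕ → Ω → ℝ} {a b : ℕ}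
    (hx : ∀ s ∈ Finset.Ioc a b, Measurable (x s)) (hact : ∀ s ∈ Finset.Ioc a b, Measurable (act s))
    (hr : ∀ s ∈ Finset.Ioc a b, Measurable (r s)) (C : Node d) (k : Arm) :
    Measurable fun ω => meanReward g (fun s => x s ω) (fun s => act s ω) (fun s => r s ω) a b C k := by
  classical
  simp only [meanReward, Finset.sum_filter, Finset.card_filter]
  have h : ∀ s ∈ Finset.Ioc a b, MeasurableSet {ω | x s ω ∈ cell g C ∧ act s ω = k} :=
    fun s hs => (hx s hs (measurableSet_cell g C)).inter (hact s hs (measurableSet_singleton k))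
  refine Measurable.div (Finset.measurable_fun_sum _ fun s hs =>
    Measurable.ite (h s hs) (hr s hs) measurable_const) ?_
  refine (measurable_of_countable fun n : ℕ => (n : ℝ)).comp (Finset.measurable_fun_sum _
    fun s hs => Measurable.ite (h s hs) measurable_const measurable_const)

lemma measurable_reward {z : Ω → Cov d × (Arm → ℝ)} (hz : Measurable z) {k : Ω → Arm}
    (hk : Measurable k) : Measurable fun ω => (z ω).2 (k ω) := by
  have : (fun ω => (z ω).2 (k ω)) =
      fun ω => if k ω = true then (z ω).2 true else (z ω).2 false := by
    ext ω; cases k ω <;> simp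
  rw [this]
  exact Measurable.ite (hk (measurableSet_singleton true))
    ((measurable_pi_apply _).comp hz.snd) ((measurable_pi_apply _).comp hz.snd)

/-- This turns the case distinction in `survivors` into a condition on memberships, which are the
events known to be measurable. -/
lemma card_arms_eq_one_iff (I : Finset Arm) : I.card = 1 ↔ (true ∈ I ↔ ¬ false ∈ I) := by
  revert I; decide

lemma measurable_mem_survivors {I : Ω → Finset Arm} (hI : ∀ k, Measurable fun ω => k ∈ I ω)
    {Y : Ω → Arm → ℝ} (hY : ∀ k, Measurable fun ω => Y ω k) {U : Ω → ℝ} (hU : Measurable U)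
    (k : Arm) : Measurable fun ω => k ∈ survivors (I ω) (Y ω) (U ω) := by
  classical
  have : (fun ω => k ∈ survivors (I ω) (Y ω) (U ω)) = fun ω =>
      ((true ∈ I ω ↔ ¬ false ∈ I ω) ∧ k ∈ I ω) ∨ (¬ (true ∈ I ω ↔ ¬ false ∈ I ω) ∧
        (k ∈ I ω ∧ ¬ ∃ k', k' ∈ I ω ∧ U ω < Y ω k' - Y ω k)) := by
    ext ω
    simp only [survivors, card_arms_eq_one_iff]
    split_ifs with h
    · simp [h]
    · simp only [h, false_and, not_false_eq_true, true_and, false_or, Finset.mem_filter, gt_iff_lt]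
  rw [this]
  have h1 : Measurable fun ω => (true ∈ I ω ↔ ¬ false ∈ I ω) := (hI true).iff (hI false).not
  refine (h1.and (hI k)).or (h1.not.and ((hI k).and (Measurable.not (Measurable.exists fun k' =>
    (hI k').and (measurableSet_setOfPred.1 (measurableSet_lt hU ((hY k').sub (hY k))))))))

lemma measurable_one_lt_card {I : Ω → Finset Arm} (hI : ∀ k, Measurable fun ω => k ∈ I ω) :
    Measurable fun ω => 1 < (I ω).card := by
  have : (fun ω => 1 < (I ω).card) = fun ω => true ∈ I ω ∧ false ∈ I ω := by
    ext ω; generalize I ω = J; revert J; decide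
  rw [this]
  exact (hI true).and (hI false)

lemma MeasurableActive.grow {S : Ω → ActiveSets d} (hS : MeasurableActive S)
    {surv : Ω → Node d → Finset Arm} (hsurv : ∀ C k, Measurable fun ω => k ∈ surv ω C) (s : ℕ) :
    MeasurableActive fun ω => (S ω).grow (surv ω) s where
  bins D := by
    simp only [mem_grow]
    have h1 := fun C => measurable_one_lt_card (hsurv C)
    exact Measurable.exists fun C => (hS.bins C).and
      (((h1 C).and measurable_const).or ((h1 C).not.and measurable_const))
  arms C k := by
    have : (fun ω => k ∈ ((S ω).grow (surv ω) s).arms C) = fun ω =>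
        (C ∈ (S ω).bins ∧ k ∈ surv ω C) ∨ (¬ C ∈ (S ω).bins ∧ k ∈ surv ω (parent C s)) := by
      ext ω
      simp only [ActiveSets.grow]
      split_ifs with h <;> simp [h]
    rw [this]
    exact ((hS.bins C).and (hsurv C k)).or ((hS.bins C).not.and (hsurv _ k))

variable {A : Inputs} {c : Ω → Choices d} {Z : ℕ → Ω → Cov d × (Arm → ℝ)}

/-- Only the observations of the finished batches are assumed measurable, because nothing is known
about `Z s` outside the horizon. -/
lemma measurableActive_activeAfter (hc : ∀ i C, Measurable fun ω => (c ω).first i C) {i : ℕ}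
    (hZ : ∀ j < i, ∀ s ∈ Finset.Ioc (A.t j) (A.t (j + 1)), Measurable (Z s)) :
    MeasurableActive fun ω => activeAfter A (c ω) (fun s => Z s ω) i := by
  induction i with
  | zero => exact ⟨fun C => measurable_const (a := C ∈ layer d A.g 1),
      fun C k => measurable_const (a := k ∈ Finset.univ)⟩
  | succ i ih =>
    have hS := ih fun j hj => hZ j (by omega)
    have hZi := hZ i (by omega)
    have hx : ∀ s ∈ Finset.Ioc (A.t i) (A.t (i + 1)), Measurable fun ω => (Z s ω).1 :=
      fun s hs => (hZi s hs).fst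
    simp only [activeAfter_succ]
    refine hS.grow (fun C k => ?_) _
    simp only [survAfter]
    have hact : ∀ s ∈ Finset.Ioc (A.t i) (A.t (i + 1)), Measurable fun ω =>
        exploreRule A.g (activeAfter A (c ω) (fun s => Z s ω) i) (fun s => (Z s ω).1) (A.t i)
          ((c ω).first (i + 1)) s (Z s ω).1 := fun s hs =>
      measurable_exploreRule (x := fun s ω => (Z s ω).1) hS (fun r hr => hx r (by
        simp only [Finset.mem_Ioc] at hr hs ⊢; omega)) (hc (i + 1)) (hx s hs)
    refine measurable_mem_survivors (hS.arms C) (fun k => ?_) ?_ k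
    · exact measurable_meanReward (x := fun s ω => (Z s ω).1) hx hact
        (fun s hs => measurable_reward (hZi s hs) (hact s hs)) C k
    · exact (measurable_of_countable fun n : ℕ => threshold d A.T n (width A.g C.1)).comp
        (measurable_visits (x := fun s ω => (Z s ω).1) hx C)

lemma measurable_basedb (hc : ∀ i C, Measurable fun ω => (c ω).first i C)
    (hc' : ∀ t, Measurable fun ω => (c ω).final t) {t : ℕ} (ht : t ∈ Finset.Icc 1 A.T)
    (hZ : ∀ s ∈ Finset.Icc 1 A.T, Measurable (Z s))
    (hbatch : ∀ j < batchOf A t - 1, A.t (j + 1) ≤ A.T) :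
    Measurable fun ω => basedb A (c ω) (fun s => Z s ω) t (Z t ω).1 := by
  have hS : MeasurableActive fun ω =>
      activeAfter A (c ω) (fun s => Z s ω) (batchOf A t - 1) :=
    measurableActive_activeAfter hc fun j hj s hs => hZ s (by
      have := hbatch j hj
      simp only [Finset.mem_Ioc, Finset.mem_Icc] at hs ⊢; omega)
  have hx : Measurable fun ω => (Z t ω).1 := (hZ t ht).fst
  simp only [basedb]
  split_ifs with h
  · exact measurable_exploreRule (x := fun s ω => (Z s ω).1) hS
      (fun r hr => (hZ r (by simp only [Finset.mem_Ioc, Finset.mem_Icc] at hr ht ⊢; omega)).fst)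
      (hc _) hx
  · exact measurable_pick (measurable_arms_comp hS (measurable_lookup hS.bins hx)) (hc' t)

end Measurability

/-! ### Moment generating functions of single observations -/

/-- Hoeffding's lemma for a Bernoulli variable. -/
lemma bernoulli_mgf_le {q : ℝ} (h0 : 0 ≤ q) (h1 : q ≤ 1) (θ : ℝ) :
    (1 - q) * Real.exp (θ * (0 - q)) + q * Real.exp (θ * (1 - q)) ≤ Real.exp (θ ^ 2 / 8) := by
  -- The Bernoulli law with mean `q`. Hoeffding's lemma on `[0,1]` has variance proxy `1/4`, hence
  -- the exponent `θ² / 8`.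
  let ν : Measure ℝ := ENNReal.ofReal (1 - q) • Measure.dirac 0 + ENNReal.ofReal q • Measure.dirac 1
  have hint : ∀ F : ℝ → ℝ, ∫ y, F y ∂ν = (1 - q) * F 0 + q * F 1 := by
    intro F
    have i1 : Integrable F (ENNReal.ofReal (1 - q) • Measure.dirac (0 : ℝ)) :=
      (integrable_dirac (by simp)).smul_measure ENNReal.ofReal_ne_top
    have i2 : Integrable F (ENNReal.ofReal q • Measure.dirac (1 : ℝ)) :=
      (integrable_dirac (by simp)).smul_measure ENNReal.ofReal_ne_top
    rw [integral_add_measure i1 i2, integral_smul_measure, integral_smul_measure, integral_dirac,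
      integral_dirac, ENNReal.toReal_ofReal (by linarith), ENNReal.toReal_ofReal h0]
    simp
  have hν : IsProbabilityMeasure ν := ⟨by
    simp only [ν, Measure.add_apply, Measure.smul_apply, measure_univ, smul_eq_mul, mul_one]
    rw [← ENNReal.ofReal_add (by linarith) h0]; simp⟩
  have hmem : ∀ᵐ y ∂ν, y ∈ Set.Icc (0 : ℝ) 1 := by
    rw [ae_iff]
    have hm : MeasurableSet {y : ℝ | ¬ y ∈ Set.Icc (0 : ℝ) 1} := measurableSet_Icc.compl
    simp only [ν, Measure.add_apply, Measure.smul_apply, Measure.dirac_apply' _ hm]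
    simp
  have h := (hasSubgaussianMGF_of_mem_Icc (X := id) (μ := ν) aemeasurable_id hmem).mgf_le θ
  have hmean : ∫ y, id y ∂ν = q := by rw [hint]; simp
  rw [mgf, hmean, hint] at h
  simp only [id] at h
  refine h.trans (le_of_eq ?_)
  congr 1
  simp
  ring

section Instance

variable {d : ℕ} {p : ClassParams} {μ : Measure (Cov d × (Arm → ℝ))} {f : Arm → Cov d → ℝ}

lemma integrable_reward (h : IsInstance p μ f) (k : Arm) : Integrable (fun z => z.2 k) μ := by
  have := h.isProb
  refine Integrable.of_mem_Icc 0 1 (by fun_prop) ?_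
  filter_upwards [h.reward_mem k] with z hz using hz

lemma comap_fst_le : MeasurableSpace.comap (Prod.fst : Cov d × (Arm → ℝ) → Cov d) inferInstance ≤
    (inferInstance : MeasurableSpace (Cov d × (Arm → ℝ))) := measurable_fst.comap_le

lemma mean_mem (h : IsInstance p μ f) (k : Arm) : ∀ᵐ z ∂μ, 0 ≤ f k z.1 ∧ f k z.1 ≤ 1 := by
  have := h.isProb
  have hi := integrable_reward h k
  have h1 : ∀ᵐ z ∂μ, (0 : ℝ) ≤
      (μ[fun z => z.2 k | MeasurableSpace.comap Prod.fst inferInstance]) z := by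
    refine condExp_nonneg ?_
    filter_upwards [h.reward_mem k] with z hz using hz.1
  have h2 : ∀ᵐ z ∂μ, (μ[fun z => z.2 k | MeasurableSpace.comap Prod.fst inferInstance]) z ≤ 1 := by
    have := condExp_mono (m := MeasurableSpace.comap Prod.fst inferInstance) hi
      (integrable_const (1 : ℝ)) (by filter_upwards [h.reward_mem k] with z hz using hz.2)
    rw [condExp_const comap_fst_le] at this
    exact this
  filter_upwards [h1, h2, h.mean_reward k] with z a1 a2 a3
  rw [← a3]; exact ⟨a1, a2⟩

/-- This is the pull-out property of the conditional expectation: a bounded function of the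
covariate does not distinguish a reward from its conditional mean. -/
lemma integral_mul_reward (h : IsInstance p μ f) (k : Arm) {φ : Cov d → ℝ}
    (hφ : Measurable φ) {B : ℝ} (hB : ∀ᵐ z ∂μ, |φ z.1| ≤ B) :
    ∫ z, φ z.1 * z.2 k ∂μ = ∫ z, φ z.1 * f k z.1 ∂μ := by
  have := h.isProb
  have hi := integrable_reward h k
  have hsm : StronglyMeasurable[MeasurableSpace.comap Prod.fst inferInstance]
      (fun z : Cov d × (Arm → ℝ) => φ z.1) :=
    (hφ.comp (comap_measurable Prod.fst)).stronglyMeasurable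
  have hint : Integrable ((fun z : Cov d × (Arm → ℝ) => φ z.1) * fun z => z.2 k) μ := by
    refine hi.bdd_mul (c := B) (hφ.comp measurable_fst).aestronglyMeasurable ?_
    filter_upwards [hB] with z hz using by simpa using hz
  have h1 := condExp_mul_of_stronglyMeasurable_left hsm hint hi
  calc ∫ z, φ z.1 * z.2 k ∂μ = ∫ z, (μ[(fun z : Cov d × (Arm → ℝ) => φ z.1) * fun z => z.2 k |
        MeasurableSpace.comap Prod.fst inferInstance]) z ∂μ := by
        rw [integral_condExp comap_fst_le]; rfl
    _ = ∫ z, φ z.1 * f k z.1 ∂μ := by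
        refine integral_congr_ae ?_
        filter_upwards [h1, h.mean_reward k] with z a1 a2
        rw [a1, Pi.mul_apply, a2]

open scoped Classical in
/-- Conditionally on the covariate, the noise of a reward is sub-Gaussian. -/
lemma mgf_noise_le (h : IsInstance p μ f) (hf : ∀ k, Measurable (f k)) (k : Arm)
    {S : Set (Cov d)} (hS : MeasurableSet S) (θ : ℝ) :
    ∫ z, (if z.1 ∈ S then Real.exp (θ * (z.2 k - f k z.1)) else 0) ∂μ ≤
      Real.exp (θ ^ 2 / 8) * ∫ z, (if z.1 ∈ S then 1 else 0) ∂μ := by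
  have := h.isProb
  have hmem := mean_mem h k
  -- By convexity, the exponential of a reward `y ∈ [0,1]` lies below the chord between its values
  -- at `0` and `1`. `φ₀` and `φ₁` are these values on `S`. The chord is affine in `y`, so `y` may
  -- be replaced by its conditional mean, which leaves the Bernoulli case.
  let φ₀ : Cov d → ℝ := fun x => if x ∈ S then Real.exp (θ * (0 - f k x)) else 0
  let φ₁ : Cov d → ℝ := fun x => if x ∈ S then Real.exp (θ * (1 - f k x)) else 0
  have hφ₀ : Measurable φ₀ := Measurable.ite hS
    ((measurable_const.mul (measurable_const.sub (hf k))).exp) measurable_const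
  have hφ₁ : Measurable φ₁ := Measurable.ite hS
    ((measurable_const.mul (measurable_const.sub (hf k))).exp) measurable_const
  have bexp : ∀ u : ℝ, |u| ≤ 1 → Real.exp (θ * u) ≤ Real.exp |θ| := by
    intro u hu
    refine Real.exp_le_exp.2 ?_
    calc θ * u ≤ |θ * u| := le_abs_self _
      _ = |θ| * |u| := abs_mul _ _
      _ ≤ |θ| * 1 := by gcongr
      _ = |θ| := mul_one _
  have bound : ∀ (c : Prop) [Decidable c] (u : ℝ), |u| ≤ 1 →
      |if c then Real.exp (θ * u) else 0| ≤ Real.exp |θ| := by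
    intro c _ u hu
    split_ifs
    · rw [abs_of_pos (Real.exp_pos _)]; exact bexp u hu
    · simp [Real.exp_nonneg]
  have hb₀ : ∀ᵐ z ∂μ, |φ₀ z.1| ≤ Real.exp |θ| := by
    filter_upwards [hmem] with z hz
    exact bound _ _ (by rw [abs_le]; constructor <;> linarith [hz.1, hz.2])
  have hb₁ : ∀ᵐ z ∂μ, |φ₁ z.1| ≤ Real.exp |θ| := by
    filter_upwards [hmem] with z hz
    exact bound _ _ (by rw [abs_le]; constructor <;> linarith [hz.1, hz.2])
  have hi := integrable_reward h k
  have m₀ : AEStronglyMeasurable (fun z : Cov d × (Arm → ℝ) => φ₀ z.1) μ :=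
    (hφ₀.comp measurable_fst).aestronglyMeasurable
  have m₁ : AEStronglyMeasurable (fun z : Cov d × (Arm → ℝ) => φ₁ z.1) μ :=
    (hφ₁.comp measurable_fst).aestronglyMeasurable
  have i₀ : Integrable (fun z : Cov d × (Arm → ℝ) => φ₀ z.1) μ :=
    Integrable.of_bound m₀ _ hb₀
  have i₁ : Integrable (fun z : Cov d × (Arm → ℝ) => φ₁ z.1) μ :=
    Integrable.of_bound m₁ _ hb₁
  have j₀ : Integrable (fun z : Cov d × (Arm → ℝ) => φ₀ z.1 * z.2 k) μ :=
    hi.bdd_mul m₀ hb₀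
  have j₁ : Integrable (fun z : Cov d × (Arm → ℝ) => φ₁ z.1 * z.2 k) μ :=
    hi.bdd_mul m₁ hb₁
  have hfi : Integrable (fun z : Cov d × (Arm → ℝ) => f k z.1) μ :=
    Integrable.of_bound ((hf k).comp measurable_fst).aestronglyMeasurable 1 (by
      filter_upwards [hmem] with z hz
      rw [Real.norm_eq_abs, abs_le]; constructor <;> linarith [hz.1, hz.2])
  have k₀ : Integrable (fun z : Cov d × (Arm → ℝ) => φ₀ z.1 * f k z.1) μ :=
    hfi.bdd_mul m₀ hb₀
  have k₁ : Integrable (fun z : Cov d × (Arm → ℝ) => φ₁ z.1 * f k z.1) μ :=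
    hfi.bdd_mul m₁ hb₁
  have hS' : MeasurableSet {z : Cov d × (Arm → ℝ) | z.1 ∈ S} := measurable_fst hS
  have l₁ : Integrable (fun z : Cov d × (Arm → ℝ) => if z.1 ∈ S then (1 : ℝ) else 0) μ :=
    Integrable.of_bound (Measurable.ite hS' measurable_const
      measurable_const).aestronglyMeasurable 1 (by
      filter_upwards with z; split_ifs <;> simp)
  calc ∫ z, (if z.1 ∈ S then Real.exp (θ * (z.2 k - f k z.1)) else 0) ∂μ
      ≤ ∫ z, ((φ₀ z.1 - φ₀ z.1 * z.2 k) + φ₁ z.1 * z.2 k) ∂μ := by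
        refine integral_mono_ae ?_ ((i₀.sub j₀).add j₁) ?_
        · refine Integrable.of_bound (Measurable.ite hS' ?_
            measurable_const).aestronglyMeasurable (Real.exp |θ|) ?_
          · exact (measurable_const.mul (((measurable_pi_apply k).comp measurable_snd).sub
              ((hf k).comp measurable_fst))).exp
          · filter_upwards [hmem, h.reward_mem k] with z hz hz'
            exact bound _ _ (by rw [abs_le]; constructor <;> linarith [hz.1, hz.2, hz'.1, hz'.2])
        · filter_upwards [h.reward_mem k] with z hz
          simp only [φ₀, φ₁]
          split_ifs
          · have hc := (convexOn_exp).2 (Set.mem_univ (θ * (0 - f k z.1)))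
              (Set.mem_univ (θ * (1 - f k z.1))) (sub_nonneg.2 hz.2) hz.1 (by ring)
            simp only [smul_eq_mul] at hc
            calc Real.exp (θ * (z.2 k - f k z.1)) = Real.exp
                  ((1 - z.2 k) * (θ * (0 - f k z.1)) + z.2 k * (θ * (1 - f k z.1))) := by
                  congr 1; ring
              _ ≤ _ := hc
              _ = _ := by ring
          · simp
    _ = ∫ z, ((φ₀ z.1 - φ₀ z.1 * f k z.1) + φ₁ z.1 * f k z.1) ∂μ := by
        rw [integral_add (f := fun z => φ₀ z.1 - φ₀ z.1 * z.2 k) (i₀.sub j₀) j₁,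
          integral_add (f := fun z => φ₀ z.1 - φ₀ z.1 * f k z.1) (i₀.sub k₀) k₁, integral_sub i₀ j₀,
          integral_sub i₀ k₀, integral_mul_reward h k hφ₀ hb₀, integral_mul_reward h k hφ₁ hb₁]
    _ ≤ ∫ z, Real.exp (θ ^ 2 / 8) * (if z.1 ∈ S then 1 else 0) ∂μ := by
        refine integral_mono_ae ((i₀.sub k₀).add k₁) (l₁.const_mul _) ?_
        filter_upwards [hmem] with z hz
        simp only [φ₀, φ₁]
        split_ifs
        · have := bernoulli_mgf_le hz.1 hz.2 θ
          linarith
        · simp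
    _ = _ := integral_const_mul _ _

/-- The probability that a covariate falls into the bin `C`. -/
noncomputable def cellProb (μ : Measure (Cov d × (Arm → ℝ))) (g : ℕ → ℕ) (C : Node d) : ℝ :=
  (μ.map Prod.fst).real (cell g C)

/-- The cell lies between the half-open and the closed box with the same corners, which have equal
volume; hence the faces added at the upper end do not matter. -/
lemma volume_cell {g : ℕ → ℕ} {i : ℕ} {C : Node d} (hC : C ∈ layer d g i) (hN : 0 < nBins g i) :
    volume (cell g C) = ENNReal.ofReal (width g i ^ d) := by
  have hC1 := (mem_layer.1 hC).1
  have hN' : (0 : ℝ) < nBins g i := by exact_mod_cast hN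
  have hw : 0 ≤ width g i := by unfold width; positivity
  let lo : Fin d → ℝ := fun j => (C.2 j : ℝ) * width g i
  let hi : Fin d → ℝ := fun j => ((C.2 j : ℝ) + 1) * width g i
  have hdiff : ∀ j, hi j - lo j = width g i := fun j => by simp only [hi, lo]; ring
  have hIco : volume ((@WithLp.ofLp 2 (Fin d → ℝ)) ⁻¹' Set.pi Set.univ fun j => Set.Ico (lo j) (hi j))
      = ENNReal.ofReal (width g i ^ d) := by
    rw [(PiLp.volume_preserving_ofLp (Fin d)).measure_preimage
      (MeasurableSet.univ_pi fun j => measurableSet_Ico).nullMeasurableSet, Real.volume_pi_Ico]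
    simp only [hdiff, Finset.prod_const, Finset.card_univ, Fintype.card_fin]
    rw [ENNReal.ofReal_pow hw]
  have hIcc : volume ((@WithLp.ofLp 2 (Fin d → ℝ)) ⁻¹' Set.Icc lo hi)
      = ENNReal.ofReal (width g i ^ d) := by
    rw [(PiLp.volume_preserving_ofLp (Fin d)).measure_preimage
      measurableSet_Icc.nullMeasurableSet, Real.volume_Icc_pi]
    simp only [hdiff, Finset.prod_const, Finset.card_univ, Fintype.card_fin]
    rw [ENNReal.ofReal_pow hw]
  refine le_antisymm ?_ ?_
  · rw [← hIcc]
    refine measure_mono fun x hx => ?_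
    refine ⟨fun j => ?_, fun j => ?_⟩
    · have := (hx j).1; rwa [hC1] at this
    · show x j ≤ hi j
      rcases (hx j).2 with h | ⟨h, h'⟩
      · rw [hC1] at h; exact h.le
      · rw [h']
        rw [hC1] at h
        have e : ((C.2 j : ℝ) + 1) = nBins g i := by exact_mod_cast h
        simp only [hi, e, width]
        rw [mul_inv_cancel₀ hN'.ne']
  · rw [← hIco]
    refine measure_mono fun x hx j => ?_
    have := hx j (Set.mem_univ j)
    rw [hC1]
    exact ⟨this.1, Or.inl this.2⟩

lemma cellProb_bounds (h : IsInstance p μ f) (hp : p.Valid) {g : ℕ → ℕ} {i : ℕ} {C : Node d}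
    (hC : C ∈ layer d g i) (hN : 0 < nBins g i) :
    p.cLow * width g i ^ d ≤ cellProb μ g C ∧ cellProb μ g C ≤ p.cUp * width g i ^ d := by
  have hw : 0 ≤ width g i := by unfold width; positivity
  obtain ⟨ρ, hρm, hρ, hmap⟩ := h.density
  have hcm := measurableSet_cell g C
  have hsub := cell_subset_unitCube hC
  have e : (μ.map Prod.fst) (cell g C) = ∫⁻ x in cell g C, ENNReal.ofReal (ρ x) := by
    rw [hmap, withDensity_apply _ hcm, Measure.restrict_restrict hcm,
      Set.inter_eq_left.2 hsub]
  have hup : (μ.map Prod.fst) (cell g C) ≤ ENNReal.ofReal (p.cUp * width g i ^ d) := by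
    rw [e, ENNReal.ofReal_mul hp.cUp_pos.le, ← volume_cell hC hN, ← setLIntegral_const]
    exact setLIntegral_mono measurable_const fun x hx => ENNReal.ofReal_le_ofReal (hρ x (hsub hx)).2
  have hlow : ENNReal.ofReal (p.cLow * width g i ^ d) ≤ (μ.map Prod.fst) (cell g C) := by
    rw [e, ENNReal.ofReal_mul hp.cLow_pos.le, ← volume_cell hC hN, ← setLIntegral_const]
    exact setLIntegral_mono hρm.ennreal_ofReal fun x hx =>
      ENNReal.ofReal_le_ofReal (hρ x (hsub hx)).1
  have hfin : (μ.map Prod.fst) (cell g C) ≠ ⊤ := ne_top_of_le_ne_top ENNReal.ofReal_ne_top hup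
  refine ⟨?_, ?_⟩
  · exact (ENNReal.ofReal_le_iff_le_toReal hfin).1 hlow
  · exact ENNReal.toReal_le_of_le_ofReal
      (mul_nonneg hp.cUp_pos.le (pow_nonneg hw _)) hup

open scoped Classical in
lemma integral_ite_mem_cell (g : ℕ → ℕ) (C : Node d) :
    ∫ z, (if z.1 ∈ cell g C then 1 else 0) ∂μ = cellProb μ g C := by
  have hS' : MeasurableSet {z : Cov d × (Arm → ℝ) | z.1 ∈ cell g C} :=
    measurable_fst (measurableSet_cell g C)
  have : (fun z : Cov d × (Arm → ℝ) => if z.1 ∈ cell g C then (1 : ℝ) else 0) =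
      Set.indicator {z | z.1 ∈ cell g C} 1 := by
    ext z; simp [Set.indicator_apply]
  rw [this, integral_indicator_one hS', cellProb, measureReal_def, measureReal_def,
    Measure.map_apply measurable_fst (measurableSet_cell g C)]
  rfl

end Instance

/-! ### Concentration of the statistics of a bin -/

section Sample

variable {d : ℕ} {p : ClassParams} {μ : Measure (Cov d × (Arm → ℝ))} {f : Arm → Cov d → ℝ}
  {Ω : Type*} [MeasurableSpace Ω] {P : Measure Ω} {T : ℕ} {Z : ℕ → Ω → Cov d × (Arm → ℝ)}

lemma ae_sample (hZ : IsIIDSample P T μ Z) {t : ℕ} (ht : t ∈ Set.Icc 1 T)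
    {q : Cov d × (Arm → ℝ) → Prop} (h : ∀ᵐ z ∂μ, q z) : ∀ᵐ ω ∂P, q (Z t ω) := by
  rw [← hZ.law t ht] at h
  exact ae_of_ae_map (hZ.measurable t ht).aemeasurable h

lemma integral_sample (hZ : IsIIDSample P T μ Z) {t : ℕ} (ht : t ∈ Set.Icc 1 T)
    {F : Cov d × (Arm → ℝ) → ℝ} (hF : Measurable F) :
    ∫ ω, F (Z t ω) ∂P = ∫ z, F z ∂μ := by
  rw [← hZ.law t ht, integral_map (hZ.measurable t ht).aemeasurable hF.aestronglyMeasurable]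

lemma mem_Icc_of_mem_Ioc {a b T s : ℕ} (hb : b ≤ T) (hs : s ∈ Finset.Ioc a b) :
    s ∈ Set.Icc 1 T := by
  simp only [Finset.mem_Ioc, Set.mem_Icc] at hs ⊢; omega

lemma integral_prod_sample [IsProbabilityMeasure P] (hZ : IsIIDSample P T μ Z) {a b : ℕ}
    (hb : b ≤ T) {F : ℕ → Cov d × (Arm → ℝ) → ℝ} (hF : ∀ s, Measurable (F s)) :
    ∫ ω, ∏ s ∈ Finset.Ioc a b, F s (Z s ω) ∂P = ∏ s ∈ Finset.Ioc a b, ∫ z, F s z ∂μ := by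
  classical
  -- Independence is available for the family of all times of the horizon, so the factors outside
  -- `(a, b]` are set to `1`.
  let F' : ℕ → Cov d × (Arm → ℝ) → ℝ := fun s => if s ∈ Finset.Ioc a b then F s else fun _ => 1
  have hF' : ∀ s, Measurable (F' s) := by
    intro s; simp only [F']; split_ifs
    · exact hF s
    · exact measurable_const
  have hsub : Finset.Ioc a b ⊆ Finset.Icc 1 T := fun s hs => by
    simp only [Finset.mem_Ioc, Finset.mem_Icc] at hs ⊢; omega
  have e : ∀ G : ℕ → ℝ, ∏ s : Set.Icc 1 T, (if (s : ℕ) ∈ Finset.Ioc a b then G s else 1) =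
      ∏ s ∈ Finset.Ioc a b, G s := by
    intro G
    rw [← Finset.prod_subtype (Finset.Icc 1 T) (p := fun s => s ∈ Set.Icc 1 T) (by simp)
      (fun s => if s ∈ Finset.Ioc a b then G s else 1), Finset.prod_ite_mem,
      Finset.inter_eq_right.2 hsub]
  have h := hZ.indep.integral_fun_prod_comp (f := fun s : Set.Icc 1 T => F' s)
    (fun s => (hZ.measurable s s.2).aemeasurable) (fun s => (hF' s).aestronglyMeasurable)
  have h1 : ∀ ω, ∏ s : Set.Icc 1 T, F' s (Z s ω) = ∏ s ∈ Finset.Ioc a b, F s (Z s ω) := by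
    intro ω
    rw [← e]
    refine Finset.prod_congr rfl fun s _ => ?_
    simp only [F']; split_ifs <;> rfl
  have h2 : ∏ s : Set.Icc 1 T, ∫ ω, F' s (Z s ω) ∂P = ∏ s ∈ Finset.Ioc a b, ∫ z, F s z ∂μ := by
    rw [← e]
    refine Finset.prod_congr rfl fun s _ => ?_
    rw [integral_sample hZ s.2 (hF' s)]
    have := hZ.law s s.2
    have : IsProbabilityMeasure μ := by
      rw [← this]; exact Measure.isProbabilityMeasure_map (hZ.measurable s s.2).aemeasurable
    simp only [F']; split_ifs <;> simp
  simp only [h1] at h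
  rw [h, h2]

lemma integrable_prod_sample [IsProbabilityMeasure P] (hZ : IsIIDSample P T μ Z) {a b : ℕ}
    (hb : b ≤ T) {F : ℕ → Cov d × (Arm → ℝ) → ℝ} (hF : ∀ s, Measurable (F s)) {B : ℝ}
    (hB : ∀ s, ∀ᵐ z ∂μ, |F s z| ≤ B) :
    Integrable (fun ω => ∏ s ∈ Finset.Ioc a b, F s (Z s ω)) P := by
  refine Integrable.of_bound (C := ∏ _s ∈ Finset.Ioc a b, B) ?_ ?_
  · exact (Finset.measurable_fun_prod _ fun s hs => (hF s).comp
      (hZ.measurable s (mem_Icc_of_mem_Ioc hb hs))).aestronglyMeasurable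
  · have : ∀ᵐ ω ∂P, ∀ s ∈ Finset.Ioc a b, |F s (Z s ω)| ≤ B :=
      (Finset.eventually_all _).2 fun s hs => ae_sample hZ (mem_Icc_of_mem_Ioc hb hs) (hB s)
    filter_upwards [this] with ω h
    rw [Real.norm_eq_abs, Finset.abs_prod]
    exact Finset.prod_le_prod (fun s _ => abs_nonneg _) h

/-- Markov's inequality in the form used for all the exponential bounds below. -/
lemma measureReal_le_integral [IsFiniteMeasure P] {E : Set Ω} (hE : MeasurableSet E) {H : Ω → ℝ}
    (hH : Integrable H P) (h0 : ∀ ω, 0 ≤ H ω) (h1 : ∀ ω ∈ E, 1 ≤ H ω) :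
    P.real E ≤ ∫ ω, H ω ∂P := by
  rw [← integral_indicator_one hE]
  refine integral_mono ((integrable_const (1 : ℝ)).indicator hE) hH fun ω => ?_
  by_cases h : ω ∈ E
  · simp [h, h1 ω h]
  · simp [h, h0 ω]

lemma IsIIDSample.measurable_of_mem_Ioc (hZ : IsIIDSample P T μ Z) {a b : ℕ} (hb : b ≤ T) :
    ∀ s ∈ Finset.Ioc a b, Measurable (Z s) :=
  fun s hs => hZ.measurable s (mem_Icc_of_mem_Ioc hb hs)

lemma measurableSet_visitTimes_eq {a b : ℕ} (hZ : ∀ s ∈ Finset.Ioc a b, Measurable (Z s))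
    (g : ℕ → ℕ) (C : Node d) (V : Finset ℕ) :
    MeasurableSet {ω | visitTimes g (fun s => (Z s ω).1) a b C = V} := by
  have h : ∀ s, Measurable fun ω => s ∈ visitTimes g (fun s => (Z s ω).1) a b C := by
    intro s
    simp only [mem_visitTimes]
    by_cases hs : s ∈ Finset.Ioc a b
    · exact measurable_const.and (measurable_mem_cell (hZ s hs).fst C)
    · simp only [hs, false_and]; exact measurable_const
  exact measurableSet_setOfPred.2 (measurable_comp_finset h fun W => W = V)

lemma measurable_noise {a b : ℕ} (hZ : ∀ s ∈ Finset.Ioc a b, Measurable (Z s))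
    (hf : ∀ k, Measurable (f k)) {V : Finset ℕ} (hV : V ⊆ Finset.Ioc a b) (k₀ : Arm) :
    Measurable fun ω => noise f (fun s => Z s ω) V k₀ := by
  unfold noise
  refine Finset.measurable_fun_sum _ fun s hs => measurable_const.mul ?_
  have hm := hZ s (hV hs)
  exact ((measurable_pi_apply _).comp hm.snd).sub ((hf _).comp hm.fst)

lemma visitTimes_subset {g : ℕ → ℕ} {x : ℕ → Cov d} {a b : ℕ} {C : Node d} :
    visitTimes g x a b C ⊆ Finset.Ioc a b := fun _ hs => (mem_visitTimes.1 hs).1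

open scoped Classical in
-- The indicator of a prescribed set of visits is a product with one factor per time. Weights
-- carried by the visits can then be integrated time by time, without conditioning on the visit
-- times.
lemma prod_ite_visitTimes {g : ℕ → ℕ} {x : ℕ → Cov d} {a b : ℕ} {C : Node d} {V : Finset ℕ}
    (hV : V ⊆ Finset.Ioc a b) (G : ℕ → ℝ) :
    ∏ s ∈ Finset.Ioc a b, (if s ∈ V then (if x s ∈ cell g C then G s else 0)
      else (if x s ∈ cell g C then 0 else 1)) =
    if visitTimes g x a b C = V then ∏ s ∈ V, G s else 0 := by
  split_ifs with h
  · calc _ = ∏ s ∈ Finset.Ioc a b, (if s ∈ V then G s else 1) := by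
          refine Finset.prod_congr rfl fun s hs => ?_
          have : x s ∈ cell g C ↔ s ∈ V := by rw [← h, mem_visitTimes]; simp [hs]
          simp only [this]
          split_ifs <;> rfl
      _ = _ := by rw [Finset.prod_ite_mem, Finset.inter_eq_right.2 hV]
  · have : ∃ s ∈ Finset.Ioc a b, ¬ (x s ∈ cell g C ↔ s ∈ V) := by
      by_contra! hcon
      apply h
      ext s
      rw [mem_visitTimes]
      constructor
      · rintro ⟨h1, h2⟩; exact (hcon s h1).1 h2
      · intro h1; exact ⟨hV h1, (hcon s (hV h1)).2 h1⟩
    obtain ⟨s, hs, hne⟩ := this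
    refine Finset.prod_eq_zero hs ?_
    by_cases h1 : s ∈ V <;> by_cases h2 : x s ∈ cell g C <;> simp_all

/-- On the event that `V` is the set of the visits to `C`, the noise is sub-Gaussian. -/
lemma measureReal_noise_slice_le [IsProbabilityMeasure P] (hZ : IsIIDSample P T μ Z)
    (h : IsInstance p μ f) (hf : ∀ k, Measurable (f k)) {a b : ℕ} (hb : b ≤ T) (g : ℕ → ℕ)
    (C : Node d) {V : Finset ℕ} (hV : V ⊆ Finset.Ioc a b) (k₀ : Arm) (ς u θ : ℝ)
    (hς : ς ^ 2 = 1) (hθ : 0 ≤ θ) :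
    P.real {ω | visitTimes g (fun s => (Z s ω).1) a b C = V ∧
        u < ς * noise f (fun s => Z s ω) V k₀} ≤
      Real.exp (-θ * u + θ ^ 2 / 8 * ∑ s ∈ V, altCoef V k₀ s ^ 2) *
        P.real {ω | visitTimes g (fun s => (Z s ω).1) a b C = V} := by
  classical
  have hμ := h.isProb
  have hcell : MeasurableSet {z : Cov d × (Arm → ℝ) | z.1 ∈ cell g C} :=
    measurable_fst (measurableSet_cell g C)
  let W : ℕ → Cov d × (Arm → ℝ) → ℝ := fun s z =>
    Real.exp (θ * ς * altCoef V k₀ s * (z.2 (altArm V k₀ s) - f (altArm V k₀ s) z.1))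
  have hW : ∀ s, Measurable (W s) := fun s =>
    (measurable_const.mul (((measurable_pi_apply _).comp measurable_snd).sub
      ((hf _).comp measurable_fst))).exp
  -- `F` carries both the exponential weight of one observation and the condition that the visit
  -- pattern agrees with `V`, while `F₁` carries only the latter. A factorwise comparison of their
  -- integrals replaces conditioning on the visit times.
  let F : ℕ → Cov d × (Arm → ℝ) → ℝ := fun s z => if s ∈ V then
    (if z.1 ∈ cell g C then W s z else 0) else (if z.1 ∈ cell g C then 0 else 1)
  let F₁ : ℕ → Cov d × (Arm → ℝ) → ℝ := fun s z => if s ∈ V then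
    (if z.1 ∈ cell g C then 1 else 0) else (if z.1 ∈ cell g C then 0 else 1)
  have hF : ∀ s, Measurable (F s) := by
    intro s; simp only [F]; split_ifs
    · exact Measurable.ite hcell (hW s) measurable_const
    · exact Measurable.ite hcell measurable_const measurable_const
  have hF₁ : ∀ s, Measurable (F₁ s) := by
    intro s; simp only [F₁]; split_ifs
    · exact Measurable.ite hcell measurable_const measurable_const
    · exact Measurable.ite hcell measurable_const measurable_const
  have hF0 : ∀ s z, 0 ≤ F s z := by
    intro s z; simp only [F, W]; split_ifs <;> positivity
  obtain ⟨B, hB⟩ : ∃ B : ℝ, ∀ s ∈ V, |θ * ς * altCoef V k₀ s| ≤ B :=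
    ⟨∑ s ∈ V, |θ * ς * altCoef V k₀ s|, fun s hs => Finset.single_le_sum
      (f := fun s => |θ * ς * altCoef V k₀ s|) (fun _ _ => abs_nonneg _) hs⟩
  have hFB : ∀ s, ∀ᵐ z ∂μ, |F s z| ≤ max 1 (Real.exp B) := by
    intro s
    filter_upwards [h.reward_mem (altArm V k₀ s), mean_mem h (altArm V k₀ s)] with z h1 h2
    simp only [F]
    split_ifs with h3 h4 h4
    · rw [abs_of_pos (Real.exp_pos _)]
      refine le_max_of_le_right (Real.exp_le_exp.2 ?_)
      refine (le_abs_self _).trans ?_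
      rw [abs_mul]
      have h5 : |z.2 (altArm V k₀ s) - f (altArm V k₀ s) z.1| ≤ 1 := by
        rw [abs_le]; constructor <;> linarith [h1.1, h1.2, h2.1, h2.2]
      calc _ ≤ B * 1 := mul_le_mul (hB s h3) h5 (abs_nonneg _) ((abs_nonneg _).trans (hB s h3))
        _ = B := mul_one _
    · simp
    · simp
    · simp
  have hprodF : ∀ ω, ∏ s ∈ Finset.Ioc a b, F s (Z s ω) =
      if visitTimes g (fun s => (Z s ω).1) a b C = V then
        Real.exp (θ * ς * noise f (fun s => Z s ω) V k₀) else 0 := by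
    intro ω
    have := prod_ite_visitTimes (g := g) (x := fun s => (Z s ω).1) (C := C) hV
      (fun s => W s (Z s ω))
    refine this.trans ?_
    congr 1
    simp only [W]
    rw [← Real.exp_sum, noise, Finset.mul_sum]
    congr 1
    exact Finset.sum_congr rfl fun s _ => by ring
  have hprodF₁ : ∀ ω, ∏ s ∈ Finset.Ioc a b, F₁ s (Z s ω) =
      Set.indicator {ω | visitTimes g (fun s => (Z s ω).1) a b C = V} 1 ω := by
    intro ω
    have := prod_ite_visitTimes (g := g) (x := fun s => (Z s ω).1) (C := C) hV (fun s => 1)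
    refine this.trans ?_
    simp [Set.indicator_apply]
  have hFF₁ : ∀ s, ∫ z, F s z ∂μ ≤
      (if s ∈ V then Real.exp (θ ^ 2 / 8 * altCoef V k₀ s ^ 2) else 1) * ∫ z, F₁ s z ∂μ := by
    intro s
    simp only [F, F₁]
    split_ifs with hs
    · have := mgf_noise_le h hf (altArm V k₀ s) (measurableSet_cell g C) (θ * ς * altCoef V k₀ s)
      refine this.trans (le_of_eq ?_)
      congr 2
      rw [mul_pow, mul_pow, hς]; ring
    · rw [one_mul]
  have hE : MeasurableSet {ω | visitTimes g (fun s => (Z s ω).1) a b C = V ∧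
      u < ς * noise f (fun s => Z s ω) V k₀} :=
    (measurableSet_visitTimes_eq (hZ.measurable_of_mem_Ioc hb) g C V).inter
      (measurableSet_lt measurable_const (measurable_const.mul (measurable_noise (hZ.measurable_of_mem_Ioc hb) hf hV k₀)))
  calc P.real {ω | visitTimes g (fun s => (Z s ω).1) a b C = V ∧
        u < ς * noise f (fun s => Z s ω) V k₀}
      ≤ ∫ ω, Real.exp (-θ * u) * ∏ s ∈ Finset.Ioc a b, F s (Z s ω) ∂P := by
        refine measureReal_le_integral hE
          ((integrable_prod_sample hZ hb hF hFB).const_mul _) (fun ω => ?_) ?_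
        · exact mul_nonneg (Real.exp_nonneg _) (Finset.prod_nonneg fun s _ => hF0 s _)
        · rintro ω ⟨h1, h2⟩
          rw [hprodF, if_pos h1, ← Real.exp_add]
          refine Real.one_le_exp ?_
          have := mul_le_mul_of_nonneg_left h2.le hθ
          linarith
    _ = Real.exp (-θ * u) * ∏ s ∈ Finset.Ioc a b, ∫ z, F s z ∂μ := by
        rw [integral_const_mul, integral_prod_sample hZ hb hF]
    _ ≤ Real.exp (-θ * u) * ∏ s ∈ Finset.Ioc a b,
          ((if s ∈ V then Real.exp (θ ^ 2 / 8 * altCoef V k₀ s ^ 2) else 1) * ∫ z, F₁ s z ∂μ) := by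
        refine mul_le_mul_of_nonneg_left ?_ (Real.exp_nonneg _)
        exact Finset.prod_le_prod (fun s _ => integral_nonneg (hF0 s)) fun s _ => hFF₁ s
    _ = Real.exp (-θ * u) * (Real.exp (θ ^ 2 / 8 * ∑ s ∈ V, altCoef V k₀ s ^ 2) *
          P.real {ω | visitTimes g (fun s => (Z s ω).1) a b C = V}) := by
        rw [Finset.prod_mul_distrib, Finset.prod_ite_mem, Finset.inter_eq_right.2 hV,
          ← Real.exp_sum, ← Finset.mul_sum, ← integral_prod_sample hZ hb hF₁]
        simp only [hprodF₁]
        rw [integral_indicator_one (measurableSet_visitTimes_eq (hZ.measurable_of_mem_Ioc hb) g C V)]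
    _ = _ := by rw [Real.exp_add]; ring

lemma measureReal_noise_slice_le_exp [IsProbabilityMeasure P] (hZ : IsIIDSample P T μ Z)
    (h : IsInstance p μ f) (hf : ∀ k, Measurable (f k)) {a b : ℕ} (hb : b ≤ T) (g : ℕ → ℕ)
    (C : Node d) {V : Finset ℕ} (hV : V ⊆ Finset.Ioc a b) (hV2 : 2 ≤ V.card) (k₀ : Arm) {w : ℝ}
    (hΛ : 0 ≤ Real.log (2 * T * w ^ d)) (ς : ℝ) (hς : ς ^ 2 = 1) :
    P.real {ω | visitTimes g (fun s => (Z s ω).1) a b C = V ∧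
        threshold d T V.card w / 2 < ς * noise f (fun s => Z s ω) V k₀} ≤
      Real.exp (-Real.log (2 * T * w ^ d)) *
        P.real {ω | visitTimes g (fun s => (Z s ω).1) a b C = V} := by
  have hm : (0 : ℝ) < V.card := by positivity
  set u := threshold d T V.card w / 2 with hu
  set Λ := Real.log (2 * T * w ^ d) with hLdef
  have hu2 : u ^ 2 = 4 * (Λ / V.card) := by
    rw [hu, threshold, ← hLdef, div_pow, mul_pow, Real.sq_sqrt (by positivity)]; ring
  have hu0 : 0 ≤ u := div_nonneg (threshold_nonneg _ _ _ _) (by norm_num)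
  -- With `m` visits the exponent is at most `-θ u + θ² / m`. Its minimum is at `θ = u m / 2` and
  -- equals `-u² m / 4`, which is `-Λ` since `u² = 4 Λ / m`.
  refine (measureReal_noise_slice_le hZ h hf hb g C hV k₀ ς u (u * V.card / 2) hς
    (by positivity)).trans ?_
  refine mul_le_mul_of_nonneg_right (Real.exp_le_exp.2 ?_) measureReal_nonneg
  have h1 := sum_altCoef_sq_le hV2 k₀
  calc -(u * V.card / 2) * u + (u * V.card / 2) ^ 2 / 8 * ∑ s ∈ V, altCoef V k₀ s ^ 2
      ≤ -(u * V.card / 2) * u + (u * V.card / 2) ^ 2 / 8 * (8 / V.card) := by gcongr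
    _ = - (u ^ 2 * V.card / 4) := by field_simp; ring
    _ = -Λ := by rw [hu2]; field_simp

/-- The noise in a bin exceeds half the threshold with small probability. -/
lemma measureReal_noise_le [IsProbabilityMeasure P] (hZ : IsIIDSample P T μ Z)
    (h : IsInstance p μ f) (hf : ∀ k, Measurable (f k)) {a b : ℕ} (hb : b ≤ T) (g : ℕ → ℕ)
    (C : Node d) (k₀ : Arm) {w : ℝ} (hΛ : 0 ≤ Real.log (2 * T * w ^ d)) (ς : ℝ) (hς : ς ^ 2 = 1) :
    P.real {ω | 2 ≤ (visitTimes g (fun s => (Z s ω).1) a b C).card ∧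
        threshold d T (visitTimes g (fun s => (Z s ω).1) a b C).card w / 2 <
          ς * noise f (fun s => Z s ω) (visitTimes g (fun s => (Z s ω).1) a b C) k₀} ≤
      Real.exp (-Real.log (2 * T * w ^ d)) := by
  let vs : Ω → Finset ℕ := fun ω => visitTimes g (fun s => (Z s ω).1) a b C
  let E : Finset ℕ → Set Ω := fun V => {ω | vs ω = V ∧
        threshold d T V.card w / 2 < ς * noise f (fun s => Z s ω) V k₀}
  let I : Finset (Finset ℕ) := (Finset.Ioc a b).powerset.filter fun V => 2 ≤ V.card
  have hsub : {ω | 2 ≤ (vs ω).card ∧ threshold d T (vs ω).card w / 2 <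
      ς * noise f (fun s => Z s ω) (vs ω) k₀} ⊆ ⋃ V ∈ I, E V := by
    rintro ω ⟨h1, h2⟩
    simp only [Set.mem_iUnion, exists_prop]
    exact ⟨vs ω, Finset.mem_filter.2 ⟨Finset.mem_powerset.2 visitTimes_subset, h1⟩, rfl, h2⟩
  calc _ ≤ P.real (⋃ V ∈ I, E V) := measureReal_mono hsub (measure_ne_top _ _)
    _ ≤ ∑ V ∈ I, P.real (E V) := measureReal_biUnion_finset_le _ _
    _ ≤ ∑ V ∈ I, Real.exp (-Real.log (2 * T * w ^ d)) * P.real {ω | vs ω = V} := by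
        refine Finset.sum_le_sum fun V hV => ?_
        rw [Finset.mem_filter, Finset.mem_powerset] at hV
        exact measureReal_noise_slice_le_exp hZ h hf hb g C hV.1 hV.2 k₀ hΛ ς hς
    -- The same factor bounds every slice and the slices are disjoint, so summing over all possible
    -- sets of visits costs nothing.
    _ = Real.exp (-Real.log (2 * T * w ^ d)) * P.real (⋃ V ∈ I, {ω | vs ω = V}) := by
        rw [← Finset.mul_sum, measureReal_biUnion_finset]
        · intro V _ V' _ hne
          exact Set.disjoint_left.2 fun ω h1 h2 => hne (h1.symm.trans h2)
        · exact fun V _ => measurableSet_visitTimes_eq (hZ.measurable_of_mem_Ioc hb) g C V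
    _ ≤ _ := mul_le_of_le_one_right (Real.exp_nonneg _) measureReal_le_one

open scoped Classical in
/-- The moment generating function of the number of visits. -/
lemma integral_pow_visits_le [IsProbabilityMeasure P] (hZ : IsIIDSample P T μ Z)
    [IsProbabilityMeasure μ] {a b : ℕ} (hb : b ≤ T) (g : ℕ → ℕ) (C : Node d) {r : ℝ} (hr : 0 < r) :
    Integrable (fun ω => r ^ (visitTimes g (fun s => (Z s ω).1) a b C).card) P ∧
    ∫ ω, r ^ (visitTimes g (fun s => (Z s ω).1) a b C).card ∂P ≤
      Real.exp ((r - 1) * (cellProb μ g C * (b - a : ℕ))) := by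
  have hcell : MeasurableSet {z : Cov d × (Arm → ℝ) | z.1 ∈ cell g C} :=
    measurable_fst (measurableSet_cell g C)
  let F : Cov d × (Arm → ℝ) → ℝ := fun z => if z.1 ∈ cell g C then r else 1
  have hF : Measurable F := Measurable.ite hcell measurable_const measurable_const
  have e : ∀ ω, r ^ (visitTimes g (fun s => (Z s ω).1) a b C).card =
      ∏ s ∈ Finset.Ioc a b, F (Z s ω) := by
    intro ω
    rw [visitTimes, ← Finset.prod_const, Finset.prod_filter]
  have hB : ∀ s : ℕ, ∀ᵐ z ∂μ, |F z| ≤ max r 1 := by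
    intro s
    filter_upwards with z
    simp only [F]
    split_ifs
    · rw [abs_of_pos hr]; exact le_max_left _ _
    · simp
  simp only [e]
  refine ⟨integrable_prod_sample hZ hb (fun _ => hF) hB, ?_⟩
  rw [integral_prod_sample hZ hb (fun _ => hF), Finset.prod_const, Nat.card_Ioc]
  have hint : ∫ z, F z ∂μ = 1 + (r - 1) * cellProb μ g C := by
    have e2 : ∀ z, F z = 1 + (r - 1) * (if z.1 ∈ cell g C then 1 else 0) := by
      intro z; simp only [F]; split_ifs <;> ring
    have hi : Integrable (fun z : Cov d × (Arm → ℝ) => if z.1 ∈ cell g C then (1 : ℝ) else 0) μ :=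
      Integrable.of_bound (Measurable.ite hcell measurable_const
        measurable_const).aestronglyMeasurable 1 (by filter_upwards with z; split_ifs <;> simp)
    simp only [e2]
    rw [integral_add (integrable_const _) (hi.const_mul _), integral_const_mul,
      integral_ite_mem_cell]
    simp
  have h0 : 0 ≤ ∫ z, F z ∂μ := integral_nonneg fun z => by
    simp only [F]; split_ifs <;> positivity
  calc (∫ z, F z ∂μ) ^ (b - a) ≤ (Real.exp ((r - 1) * cellProb μ g C)) ^ (b - a) := by
        refine pow_le_pow_left₀ h0 ?_ _
        rw [hint, add_comm]
        exact Real.add_one_le_exp _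
    _ = _ := by rw [← Real.exp_nat_mul]; congr 1; ring

lemma measurable_card_visitTimes (hZ : IsIIDSample P T μ Z) {a b : ℕ} (hb : b ≤ T) (g : ℕ → ℕ)
    (C : Node d) : Measurable fun ω => (visitTimes g (fun s => (Z s ω).1) a b C).card :=
  measurable_visits (x := fun s ω => (Z s ω).1)
    (fun s hs => (hZ.measurable s (mem_Icc_of_mem_Ioc hb hs)).fst) C

/-- Chernoff's bound with base `2`: the mean number of visits is at most `hi / 2`, hence `2^{-hi}
e^{hi/2}`. -/
lemma measureReal_visits_gt_le [IsProbabilityMeasure P] (hZ : IsIIDSample P T μ Z)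
    [IsProbabilityMeasure μ] {a b : ℕ} (hb : b ≤ T) (g : ℕ → ℕ) (C : Node d) {hi : ℝ}
    (hhi : 2 * (cellProb μ g C * (b - a : ℕ)) ≤ hi) :
    P.real {ω | hi < (visitTimes g (fun s => (Z s ω).1) a b C).card} ≤
      Real.exp (-(hi * (Real.log 2 - 1 / 2))) := by
  obtain ⟨h1, h2⟩ := integral_pow_visits_le (P := P) hZ hb g C (r := 2) (by norm_num)
  have hm : MeasurableSet {ω | hi < (visitTimes g (fun s => (Z s ω).1) a b C).card} :=
    measurableSet_lt measurable_const
      ((measurable_of_countable fun n : ℕ => (n : ℝ)).comp (measurable_card_visitTimes hZ hb g C))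
  calc _ ≤ ∫ ω, Real.exp (-(hi * Real.log 2)) *
        2 ^ (visitTimes g (fun s => (Z s ω).1) a b C).card ∂P := by
        refine measureReal_le_integral hm (h1.const_mul _) (fun ω => by positivity) fun ω hω => ?_
        rw [← Real.rpow_natCast, Real.rpow_def_of_pos (by norm_num), ← Real.exp_add]
        refine Real.one_le_exp ?_
        have := mul_le_mul_of_nonneg_right (le_of_lt hω) (Real.log_nonneg (by norm_num : (1:ℝ) ≤ 2))
        linarith
    _ ≤ Real.exp (-(hi * Real.log 2)) * Real.exp ((2 - 1) * (cellProb μ g C * (b - a : ℕ))) := by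
        rw [integral_const_mul]
        exact mul_le_mul_of_nonneg_left h2 (Real.exp_nonneg _)
    _ ≤ _ := by
        rw [← Real.exp_add]
        refine Real.exp_le_exp.2 ?_
        linarith

/-- Chernoff's bound with base `1/2`: for mean number of visits `ν ≥ 4 lo` it gives `2^{lo}
e^{-ν/2}`, and `log 2 ≤ 1` leaves `e^{-ν/4}`. -/
lemma measureReal_visits_lt_le [IsProbabilityMeasure P] (hZ : IsIIDSample P T μ Z)
    [IsProbabilityMeasure μ] {a b : ℕ} (hb : b ≤ T) (g : ℕ → ℕ) (C : Node d) {lo : ℝ}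
    (hlo : 4 * lo ≤ cellProb μ g C * (b - a : ℕ)) :
    P.real {ω | ((visitTimes g (fun s => (Z s ω).1) a b C).card : ℝ) < lo} ≤
      Real.exp (-(cellProb μ g C * (b - a : ℕ) / 4)) := by
  obtain ⟨h1, h2⟩ := integral_pow_visits_le (P := P) hZ hb g C (r := 1 / 2) (by norm_num)
  have hm : MeasurableSet {ω | ((visitTimes g (fun s => (Z s ω).1) a b C).card : ℝ) < lo} :=
    measurableSet_lt ((measurable_of_countable fun n : ℕ => (n : ℝ)).comp
      (measurable_card_visitTimes hZ hb g C)) measurable_const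
  have hq : 0 ≤ cellProb μ g C * (b - a : ℕ) := mul_nonneg measureReal_nonneg (by positivity)
  calc _ ≤ ∫ ω, Real.exp (lo * Real.log 2) *
        (1 / 2) ^ (visitTimes g (fun s => (Z s ω).1) a b C).card ∂P := by
        refine measureReal_le_integral hm (h1.const_mul _) (fun ω => by positivity) fun ω hω => ?_
        rw [← Real.rpow_natCast, Real.rpow_def_of_pos (by norm_num), ← Real.exp_add, one_div,
          Real.log_inv]
        refine Real.one_le_exp ?_
        have := mul_le_mul_of_nonneg_right (le_of_lt hω) (Real.log_nonneg (by norm_num : (1:ℝ) ≤ 2))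
        linarith
    _ ≤ Real.exp (lo * Real.log 2) * Real.exp ((1 / 2 - 1) * (cellProb μ g C * (b - a : ℕ))) := by
        rw [integral_const_mul]
        exact mul_le_mul_of_nonneg_left h2 (Real.exp_nonneg _)
    _ ≤ _ := by
        rw [← Real.exp_add]
        refine Real.exp_le_exp.2 ?_
        have l1 := Real.log_two_lt_d9
        have l2 := Real.log_two_gt_d9
        nlinarith [mul_le_mul_of_nonneg_right hlo (by linarith : (0:ℝ) ≤ Real.log 2),
          mul_le_mul_of_nonneg_left l1.le hq]

/-- The statistics of a bin are unreliable with small probability. -/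
lemma measureReal_bad_le [IsProbabilityMeasure P] (hZ : IsIIDSample P T μ Z)
    (h : IsInstance p μ f) (hf : ∀ k, Measurable (f k)) {a b : ℕ} (hb : b ≤ T) {g : ℕ → ℕ}
    {i : ℕ} {C : Node d} (hC : C ∈ layer d g i) {lo hi : ℝ} (hlo2 : 2 ≤ lo)
    (hlo : 4 * lo ≤ cellProb μ g C * (b - a : ℕ)) (hhi : 2 * (cellProb μ g C * (b - a : ℕ)) ≤ hi)
    (hT : 1 < T * width g i ^ d)
    (hy : 4 * Real.log (T * width g i ^ d) ≤ cellProb μ g C * (b - a : ℕ)) :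
    P.real {ω | Bad g T f lo hi a b C fun s => Z s ω} ≤ 4 / (T * width g i ^ d) := by
  have hμ := h.isProb
  have hC1 := (mem_layer.1 hC).1
  let vs : Ω → Finset ℕ := fun ω => visitTimes g (fun s => (Z s ω).1) a b C
  let N : Arm → ℝ → Set Ω := fun k₀ ς => {ω | 2 ≤ (vs ω).card ∧
    threshold d T (vs ω).card (width g i) / 2 < ς * noise f (fun s => Z s ω) (vs ω) k₀}
  let E₁ : Set Ω := {ω | ((vs ω).card : ℝ) < lo}
  let E₂ : Set Ω := {ω | hi < ((vs ω).card : ℝ)}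
  have hy0 : 0 < Real.log (T * width g i ^ d) := Real.log_pos hT
  have hsub : {ω | Bad g T f lo hi a b C fun s => Z s ω} ⊆
      E₁ ∪ E₂ ∪ (N true 1 ∪ N true (-1)) ∪ (N false 1 ∪ N false (-1)) := by
    intro ω hω
    by_cases h1 : ω ∈ E₁
    · simp [h1]
    · have h2 : 2 ≤ (vs ω).card := by
        have : lo ≤ (vs ω).card := not_lt.1 h1
        exact_mod_cast hlo2.trans this
      rcases hω with h3 | h3 | ⟨k₀, h3⟩
      · exact absurd h3 h1
      · exact Or.inl (Or.inl (Or.inr h3))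
      · rw [hC1, lt_abs] at h3
        have h4 : ω ∈ N k₀ 1 ∨ ω ∈ N k₀ (-1) := by
          rcases h3 with h3 | h3
          · exact Or.inl ⟨h2, by rw [one_mul]; exact h3⟩
          · exact Or.inr ⟨h2, by rw [neg_one_mul]; exact h3⟩
        cases k₀
        · exact Or.inr h4
        · exact Or.inl (Or.inr h4)
  have hpos : 0 < (T : ℝ) * width g i ^ d := by linarith
  have hinv : ∀ y, Real.log (T * width g i ^ d) ≤ y → Real.exp (-y) ≤ 1 / (T * width g i ^ d) := by
    intro y hy
    calc Real.exp (-y) ≤ Real.exp (-Real.log (T * width g i ^ d)) :=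
          Real.exp_le_exp.2 (neg_le_neg hy)
      _ = _ := by rw [Real.exp_neg, Real.exp_log hpos, one_div]
  have b1 : P.real E₁ ≤ 1 / (T * width g i ^ d) :=
    (measureReal_visits_lt_le hZ hb g C hlo).trans (hinv _ (by linarith))
  have b2 : P.real E₂ ≤ 1 / (T * width g i ^ d) := by
    refine (measureReal_visits_gt_le hZ hb g C hhi).trans (hinv _ ?_)
    -- The upper limit is at least `8 log (T w^d)`, and `8 (log 2 - 1/2) > 1`.
    have l2 := Real.log_two_gt_d9
    nlinarith
  have hΛ : 0 ≤ Real.log (2 * T * width g i ^ d) := Real.log_nonneg (by linarith)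
  have bN : ∀ k₀ ς, ς ^ 2 = 1 → P.real (N k₀ ς) ≤ (1 / 2) / (T * width g i ^ d) := by
    intro k₀ ς hς
    refine (measureReal_noise_le hZ h hf hb g C k₀ hΛ ς hς).trans (le_of_eq ?_)
    rw [Real.exp_neg, Real.exp_log (by linarith)]
    field_simp
  -- Two deviations of the number of visits at `1 / (T w^d)` each, and four noise events, for two
  -- starting arms and two signs, at half of that.
  calc _ ≤ P.real (E₁ ∪ E₂ ∪ (N true 1 ∪ N true (-1)) ∪ (N false 1 ∪ N false (-1))) :=
        measureReal_mono hsub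
    _ ≤ ((P.real E₁ + P.real E₂) + (P.real (N true 1) + P.real (N true (-1)))) +
        (P.real (N false 1) + P.real (N false (-1))) := by
        refine (measureReal_union_le _ _).trans (add_le_add ((measureReal_union_le _ _).trans
          (add_le_add (measureReal_union_le _ _) (measureReal_union_le _ _)))
          (measureReal_union_le _ _))
    _ ≤ ((1 / (T * width g i ^ d) + 1 / (T * width g i ^ d)) +
        ((1 / 2) / (T * width g i ^ d) + (1 / 2) / (T * width g i ^ d))) +
        ((1 / 2) / (T * width g i ^ d) + (1 / 2) / (T * width g i ^ d)) := by
        gcongr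
        all_goals exact bN _ _ (by norm_num)
    _ = _ := by ring

lemma measurableSet_bad {a b : ℕ} (hZ : ∀ s ∈ Finset.Ioc a b, Measurable (Z s))
    (hf : ∀ k, Measurable (f k)) (g : ℕ → ℕ) (lo hi : ℝ) (C : Node d) :
    MeasurableSet {ω | Bad g T f lo hi a b C fun s => Z s ω} := by
  have e : {ω | Bad g T f lo hi a b C fun s => Z s ω} = ⋃ V ∈ (Finset.Ioc a b).powerset,
      ({ω | visitTimes g (fun s => (Z s ω).1) a b C = V} ∩
        {ω | (V.card : ℝ) < lo ∨ hi < (V.card : ℝ) ∨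
          ∃ k₀, threshold d T V.card (width g C.1) / 2 < |noise f (fun s => Z s ω) V k₀|}) := by
    ext ω
    simp only [Set.mem_iUnion, exists_prop, Finset.mem_powerset]
    constructor
    · intro h; exact ⟨_, visitTimes_subset, rfl, h⟩
    · rintro ⟨V, -, h1, h2⟩
      have h1' : visitTimes g (fun s => (Z s ω).1) a b C = V := h1
      show Bad g T f lo hi a b C fun s => Z s ω
      unfold Bad
      rw [h1']
      exact h2
  rw [e]
  refine Finset.measurableSet_biUnion _ fun V hV => ?_
  refine (measurableSet_visitTimes_eq hZ g C V).inter (measurableSet_setOfPred.2 ?_)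
  refine measurable_const.or (measurable_const.or (Measurable.exists fun k₀ => ?_))
  exact measurableSet_setOfPred.1 (measurableSet_lt measurable_const
    ((measurable_noise hZ hf (Finset.mem_powerset.1 hV) k₀).abs))

/-- The reliability of a batch is read off from the observations of that batch alone; its
independence of later times rests on this. -/
lemma bad_congr {g : ℕ → ℕ} {lo hi : ℝ} {a b : ℕ} {C : Node d} {z z' : ℕ → Cov d × (Arm → ℝ)}
    (h : ∀ s ∈ Finset.Ioc a b, z s = z' s) :
    Bad g T f lo hi a b C z ↔ Bad g T f lo hi a b C z' := by
  have hV : visitTimes g (fun s => (z s).1) a b C = visitTimes g (fun s => (z' s).1) a b C := by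
    ext s
    simp only [mem_visitTimes]
    exact and_congr_right fun hs => by rw [h s hs]
  have hn : ∀ k₀, noise f z (visitTimes g (fun s => (z' s).1) a b C) k₀ =
      noise f z' (visitTimes g (fun s => (z' s).1) a b C) k₀ := by
    intro k₀
    unfold noise
    exact Finset.sum_congr rfl fun s hs => by rw [h s (visitTimes_subset hs)]
  unfold Bad
  rw [hV]
  simp only [hn]

/-- The statistics of a batch are independent of the later observations. -/
lemma integral_bad_mul (hZ : IsIIDSample P T μ Z) (hf : ∀ k, Measurable (f k)) {g : ℕ → ℕ}
    {lo hi : ℝ} {a b t : ℕ} (hbt : b < t) (ht : t ≤ T) (C : Node d)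
    {φ : Cov d × (Arm → ℝ) → ℝ} (hφ : Measurable φ) :
    ∫ ω, Set.indicator {ω | Bad g T f lo hi a b C fun s => Z s ω} 1 ω * φ (Z t ω) ∂P =
      P.real {ω | Bad g T f lo hi a b C fun s => Z s ω} * ∫ z, φ z ∂μ := by
  classical
  have hb : b ≤ T := by omega
  have htI : t ∈ Set.Icc 1 T := ⟨by omega, ht⟩
  let S : Finset (Set.Icc 1 T) := Finset.univ.filter fun s => (s : ℕ) ∈ Finset.Ioc a b
  have hdisj : Disjoint S {⟨t, htI⟩} := by
    rw [Finset.disjoint_singleton_right]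
    simp only [S, Finset.mem_filter, Finset.mem_univ, true_and, Finset.mem_Ioc]
    omega
  have hind := hZ.indep.indepFun_finset S {⟨t, htI⟩} hdisj fun s => hZ.measurable s s.2
  -- The vector of the observations of the batch is padded with dummy values, which `Bad` does not
  -- see. The event thus becomes a function of a block that is independent of `Z t`.
  let ext : ℕ → (S → Cov d × (Arm → ℝ)) → Cov d × (Arm → ℝ) := fun s r =>
    if h : s ∈ Finset.Ioc a b then
      r ⟨⟨s, mem_Icc_of_mem_Ioc hb h⟩, Finset.mem_filter.2 ⟨Finset.mem_univ _, h⟩⟩ else (0, 0)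
  have hext : ∀ s ∈ Finset.Ioc a b, Measurable (ext s) := by
    intro s hs
    simp only [ext, dif_pos hs]
    exact measurable_pi_apply _
  have hbad := measurableSet_bad (T := T) hext hf g lo hi C
  let φ₁ : (S → Cov d × (Arm → ℝ)) → ℝ :=
    Set.indicator {r | Bad g T f lo hi a b C fun s => ext s r} 1
  have hφ₁ : Measurable φ₁ := measurable_one.indicator hbad
  let φ₂ : (({⟨t, htI⟩} : Finset (Set.Icc 1 T)) → Cov d × (Arm → ℝ)) → ℝ := fun r =>
    φ (r ⟨⟨t, htI⟩, Finset.mem_singleton_self _⟩)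
  have hφ₂ : Measurable φ₂ := hφ.comp (measurable_pi_apply _)
  have h2 := hind.comp hφ₁ hφ₂
  have e1 : ∀ ω, φ₁ (fun i : S => Z i ω) =
      Set.indicator {ω | Bad g T f lo hi a b C fun s => Z s ω} 1 ω := by
    intro ω
    have : (Bad g T f lo hi a b C fun s => ext s fun i : S => Z i ω) ↔
        Bad g T f lo hi a b C fun s => Z s ω :=
      bad_congr fun s hs => by simp only [ext, dif_pos hs]
    simp only [φ₁, Set.indicator_apply, Set.mem_ofPred_eq, this, Pi.one_apply]
  have hmul := h2.integral_fun_mul_eq_mul_integral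
    ((hφ₁.comp (measurable_pi_lambda _ fun i : S => hZ.measurable _ i.1.2)).aestronglyMeasurable)
    ((hφ₂.comp (measurable_pi_lambda _ fun i => hZ.measurable _ i.1.2)).aestronglyMeasurable)
  simp only [Function.comp_def, e1] at hmul
  rw [hmul, integral_indicator_one (measurableSet_bad (hZ.measurable_of_mem_Ioc hb) hf g lo hi C),
    ← integral_sample hZ htI hφ]

end Sample

/-! ### The expected regret in terms of the batch sizes -/

section Regret

variable {d : ℕ} {p : ClassParams} {μ : Measure (Cov d × (Arm → ℝ))} {f : Arm → Cov d → ℝ}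

lemma ae_mem_unitCube (h : IsInstance p μ f) : ∀ᵐ z ∂μ, z.1 ∈ unitCube d := by
  obtain ⟨ρ, -, -, hmap⟩ := h.density
  have h1 : ∀ᵐ x ∂(μ.map Prod.fst), x ∈ unitCube d := by
    rw [hmap]
    exact (withDensity_absolutelyContinuous _ _).ae_le
      (ae_restrict_mem measurableSet_unitCube)
  exact ae_of_ae_map measurable_fst.aemeasurable h1

lemma ae_abs_gap_le_one (h : IsInstance p μ f) :
    ∀ᵐ z ∂μ, |f true z.1 - f false z.1| ≤ 1 := by
  filter_upwards [mean_mem h true, mean_mem h false] with z h1 h2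
  rw [abs_le]; constructor <;> linarith [h1.1, h1.2, h2.1, h2.2]

lemma measurable_abs_gap (hf : ∀ k, Measurable (f k)) :
    Measurable fun x => |f true x - f false x| := ((hf true).sub (hf false)).abs

lemma measurable_smallGap (hf : ∀ k, Measurable (f k)) (r : ℝ) : Measurable (smallGap f r) :=
  Measurable.ite (measurableSet_le (measurable_abs_gap hf) measurable_const)
    (measurable_abs_gap hf) measurable_const

lemma smallGap_le_abs_gap (f : Arm → Cov d → ℝ) (r : ℝ) (x : Cov d) :
    smallGap f r x ≤ |f true x - f false x| := by
  unfold smallGap; split_ifs <;> simp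

lemma integrable_smallGap (h : IsInstance p μ f) (hf : ∀ k, Measurable (f k)) (r : ℝ) :
    Integrable (fun z => smallGap f r z.1) μ := by
  have := h.isProb
  refine Integrable.of_bound ((measurable_smallGap hf r).comp measurable_fst).aestronglyMeasurable 1 ?_
  filter_upwards [ae_abs_gap_le_one h] with z hz
  rw [Real.norm_eq_abs, abs_of_nonneg (smallGap_nonneg _ _ _)]
  exact (smallGap_le_abs_gap _ _ _).trans hz

lemma integral_smallGap_le_one (h : IsInstance p μ f) (hf : ∀ k, Measurable (f k)) (r : ℝ) :
    ∫ z, smallGap f r z.1 ∂μ ≤ 1 := by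
  have := h.isProb
  calc ∫ z, smallGap f r z.1 ∂μ ≤ ∫ _z, (1 : ℝ) ∂μ := by
        refine integral_mono_ae (integrable_smallGap h hf r) (integrable_const _) ?_
        filter_upwards [ae_abs_gap_le_one h] with z hz
        exact (smallGap_le_abs_gap _ _ _).trans hz
    _ = 1 := by simp

/-- The margin condition bounds the contribution of small gaps. -/
lemma integral_smallGap_le (h : IsInstance p μ f) (hf : ∀ k, Measurable (f k)) {r : ℝ}
    (hr0 : 0 ≤ r) (hr : r ≤ p.δ₀) : ∫ z, smallGap f r z.1 ∂μ ≤ r * (p.D₀ * r ^ p.α) := by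
  have := h.isProb
  -- A vanishing gap contributes nothing, so it suffices that the margin condition controls the
  -- positive gaps.
  let S : Set (Cov d) := {x | 0 < |f true x - f false x| ∧ |f true x - f false x| ≤ r}
  have hS : MeasurableSet S := (measurableSet_lt measurable_const (measurable_abs_gap hf)).inter
    (measurableSet_le (measurable_abs_gap hf) measurable_const)
  have hle : ∀ x, smallGap f r x ≤ r * S.indicator 1 x := by
    intro x
    by_cases hx : x ∈ S
    · rw [Set.indicator_of_mem hx, smallGap, if_pos hx.2]; simpa using hx.2
    · rw [Set.indicator_of_notMem hx, mul_zero, smallGap]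
      split_ifs with h1
      · by_contra! h2; exact hx ⟨h2, h1⟩
      · exact le_rfl
  have hmapP : IsProbabilityMeasure (μ.map Prod.fst) :=
    Measure.isProbabilityMeasure_map measurable_fst.aemeasurable
  calc ∫ z, smallGap f r z.1 ∂μ = ∫ x, smallGap f r x ∂(μ.map Prod.fst) :=
        (integral_map measurable_fst.aemeasurable
          (measurable_smallGap hf r).aestronglyMeasurable).symm
    _ ≤ ∫ x, r * S.indicator 1 x ∂(μ.map Prod.fst) := by
        refine integral_mono ?_ (((integrable_const (1 : ℝ)).indicator hS).const_mul r) hle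
        exact (integrable_map_measure (measurable_smallGap hf r).aestronglyMeasurable
          measurable_fst.aemeasurable).2 (integrable_smallGap h hf r)
    _ = r * (μ.map Prod.fst).real S := by rw [integral_const_mul, integral_indicator_one hS]
    _ ≤ _ := mul_le_mul_of_nonneg_left (h.margin r hr0 hr) hr0

variable {Ω : Type*} [MeasurableSpace Ω] {P : Measure Ω} {A : Inputs}
  {Z : ℕ → Ω → Cov d × (Arm → ℝ)} {c : Ω → Choices d}

/-- The regret of the decision at time `t`. -/
noncomputable def stepRegret (A : Inputs) (f : Arm → Cov d → ℝ) (c : Choices d)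
    (z : ℕ → Cov d × (Arm → ℝ)) (t : ℕ) : ℝ :=
  max (f true (z t).1) (f false (z t).1) - f (basedb A c z t (z t).1) (z t).1

lemma grid_mono (hlt : ∀ i < A.M, A.t i < A.t (i + 1)) {i j : ℕ} (hij : i ≤ j) (hj : j ≤ A.M) :
    A.t i ≤ A.t j := by
  induction j, hij using Nat.le_induction with
  | base => exact le_rfl
  | succ j _ ih => exact (ih (by omega)).trans (hlt j (by omega)).le

lemma batchOf_eq (hlt : ∀ i < A.M, A.t i < A.t (i + 1)) {i t : ℕ} (hi : i < A.M)
    (ht : t ∈ Finset.Ioc (A.t i) (A.t (i + 1))) : batchOf A t = i + 1 := by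
  rw [Finset.mem_Ioc] at ht
  have : (Finset.range A.M).filter (fun l => A.t l < t) = Finset.range (i + 1) := by
    ext l
    simp only [Finset.mem_filter, Finset.mem_range]
    constructor
    · rintro ⟨h1, h2⟩
      by_contra! h3
      have := grid_mono hlt h3 h1.le
      omega
    · intro h
      have := grid_mono hlt (show l ≤ i by omega) hi.le
      omega
  rw [batchOf, this, Finset.card_range]

lemma exists_batch (h0 : A.t 0 = 0) (hT : A.t A.M = A.T) {t : ℕ} (ht : t ∈ Finset.Icc 1 A.T) :
    ∃ i < A.M, t ∈ Finset.Ioc (A.t i) (A.t (i + 1)) := by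
  rw [Finset.mem_Icc] at ht
  have hex : ∃ i, t ≤ A.t i := ⟨A.M, by omega⟩
  classical
  have hm := Nat.find_spec hex
  have hle : Nat.find hex ≤ A.M := Nat.find_min' hex (by omega)
  have hpos : Nat.find hex ≠ 0 := fun h => by rw [h] at hm; omega
  obtain ⟨i, hi⟩ := Nat.exists_eq_succ_of_ne_zero hpos
  refine ⟨i, by omega, ?_⟩
  have := Nat.find_min hex (show i < Nat.find hex by omega)
  rw [Finset.mem_Ioc]
  rw [hi] at hm
  exact ⟨by omega, hm⟩

lemma sum_Ioc_grid (hlt : ∀ i < A.M, A.t i < A.t (i + 1)) (F : ℕ → ℝ) {n : ℕ} (hn : n ≤ A.M) :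
    ∑ s ∈ Finset.Ioc (A.t 0) (A.t n), F s =
      ∑ i ∈ Finset.range n, ∑ s ∈ Finset.Ioc (A.t i) (A.t (i + 1)), F s := by
  induction n with
  | zero => simp
  | succ n ih =>
    rw [Finset.sum_range_succ, ← ih (by omega), Finset.sum_Ioc_consecutive _
      (grid_mono hlt (Nat.zero_le n) (by omega)) (hlt n (by omega)).le]

lemma sum_Icc_grid (h0 : A.t 0 = 0) (hT : A.t A.M = A.T) (hlt : ∀ i < A.M, A.t i < A.t (i + 1))
    (F : ℕ → ℝ) : ∑ s ∈ Finset.Icc 1 A.T, F s =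
      ∑ i ∈ Finset.range A.M, ∑ s ∈ Finset.Ioc (A.t i) (A.t (i + 1)), F s := by
  rw [← sum_Ioc_grid hlt F le_rfl, h0, hT]
  rfl

lemma measurable_stepRegret (hf : ∀ k, Measurable (f k)) (hZ : IsIIDSample P A.T μ Z)
    (hc : ∀ i C, Measurable fun ω => (c ω).first i C)
    (hc' : ∀ t, Measurable fun ω => (c ω).final t)
    (h0 : A.t 0 = 0) (hT : A.t A.M = A.T) (hlt : ∀ i < A.M, A.t i < A.t (i + 1)) {t : ℕ}
    (ht : t ∈ Finset.Icc 1 A.T) :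
    Measurable fun ω => stepRegret A f (c ω) (fun s => Z s ω) t := by
  have hZm : ∀ s ∈ Finset.Icc 1 A.T, Measurable (Z s) := fun s hs =>
    hZ.measurable s (by simpa using hs)
  have hx : Measurable fun ω => (Z t ω).1 := (hZm t ht).fst
  obtain ⟨i, hi, hti⟩ := exists_batch h0 hT ht
  have hπ := measurable_basedb hc hc' ht hZm fun j hj => by
    rw [batchOf_eq hlt hi hti] at hj
    rw [← hT]
    exact grid_mono hlt (by omega) le_rfl
  unfold stepRegret
  refine (((hf true).comp hx).max ((hf false).comp hx)).sub ?_
  have : (fun ω => f (basedb A (c ω) (fun s => Z s ω) t (Z t ω).1) (Z t ω).1) =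
      fun ω => if basedb A (c ω) (fun s => Z s ω) t (Z t ω).1 = true then f true (Z t ω).1
        else f false (Z t ω).1 := by
    ext ω; cases basedb A (c ω) (fun s => Z s ω) t (Z t ω).1 <;> simp
  rw [this]
  exact Measurable.ite (hπ (measurableSet_singleton true)) ((hf true).comp hx) ((hf false).comp hx)

lemma stepRegret_nonneg (A : Inputs) (f : Arm → Cov d → ℝ) (c : Choices d)
    (z : ℕ → Cov d × (Arm → ℝ)) (t : ℕ) : 0 ≤ stepRegret A f c z t := max_sub_nonneg _ _ _

lemma ae_stepRegret_le_one (h : IsInstance p μ f) (hZ : IsIIDSample P A.T μ Z) {t : ℕ}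
    (ht : t ∈ Finset.Icc 1 A.T) : ∀ᵐ ω ∂P, stepRegret A f (c ω) (fun s => Z s ω) t ≤ 1 := by
  filter_upwards [ae_sample hZ (by simpa using ht) (ae_abs_gap_le_one h)] with ω hω
  exact (max_sub_le_abs_gap _ _ _).trans hω

lemma integrable_stepRegret [IsProbabilityMeasure P] (h : IsInstance p μ f)
    (hf : ∀ k, Measurable (f k)) (hZ : IsIIDSample P A.T μ Z)
    (hc : ∀ i C, Measurable fun ω => (c ω).first i C)
    (hc' : ∀ t, Measurable fun ω => (c ω).final t)
    (h0 : A.t 0 = 0) (hT : A.t A.M = A.T) (hlt : ∀ i < A.M, A.t i < A.t (i + 1)) {t : ℕ}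
    (ht : t ∈ Finset.Icc 1 A.T) :
    Integrable (fun ω => stepRegret A f (c ω) (fun s => Z s ω) t) P := by
  refine Integrable.of_bound
    (measurable_stepRegret hf hZ hc hc' h0 hT hlt ht).aestronglyMeasurable 1 ?_
  filter_upwards [ae_stepRegret_le_one h hZ ht] with ω hω
  rwa [Real.norm_eq_abs, abs_of_nonneg (stepRegret_nonneg _ _ _ _ _)]

open scoped Classical in
lemma sum_layer_ite_le {g : ℕ → ℕ} {i : ℕ} {x : Cov d} {y : ℝ} (hy : 0 ≤ y) :
    ∑ D ∈ layer d g i, (if x ∈ cell g D then y else 0) ≤ y := by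
  by_cases h : ∃ D ∈ layer d g i, x ∈ cell g D
  · obtain ⟨D, hD, hx⟩ := h
    rw [Finset.sum_eq_single_of_mem D hD, if_pos hx]
    intro D' hD' hne
    rw [if_neg fun hx' => hne (layer_unique hD' hD hx' hx)]
  · push Not at h
    rw [Finset.sum_eq_zero fun D hD => if_neg (h D hD)]
    exact hy

open scoped Classical in
/-- The expected regret of one decision. -/
lemma integral_stepRegret_le [IsProbabilityMeasure P] (hp : p.Valid) (h : IsInstance p μ f)
    (hf : ∀ k, Measurable (f k)) (hZ : IsIIDSample P A.T μ Z)
    (hc : ∀ i C, Measurable fun ω => (c ω).first i C)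
    (hc' : ∀ t, Measurable fun ω => (c ω).final t)
    (h0 : A.t 0 = 0) (hT : A.t A.M = A.T) (hlt : ∀ i < A.M, A.t i < A.t (i + 1))
    (hg : ∀ i < A.M, 0 < A.g i) {lo hi rad ε H : ℕ → ℝ}
    (hlo : ∀ j, 1 ≤ j → j < A.M → 2 ≤ lo j)
    (hU1 : ∀ j, 1 ≤ j → j < A.M → ∀ m : ℕ, lo j ≤ m → m ≤ hi j →
      2 * c0 d p * width A.g j ^ p.β ≤ threshold d A.T m (width A.g j))
    (hU2 : ∀ j, 1 ≤ j → j < A.M → ∀ m : ℕ, lo j ≤ m → m ≤ hi j →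
      2 * threshold d A.T m (width A.g j) ≤ rad (j + 1))
    (hrad : rad 1 = 1)
    (hbad : ∀ j, 1 ≤ j → j < A.M → ∀ C ∈ layer d A.g j,
      P.real {ω | Bad A.g A.T f (lo j) (hi j) (A.t (j - 1)) (A.t j) C fun s => Z s ω} ≤ ε j)
    (hH : ∀ j, 1 ≤ j → j ≤ A.M → ∫ z, smallGap f (rad j) z.1 ∂μ ≤ H j)
    (hε : ∀ j, 0 ≤ ε j)
    {i t : ℕ} (hiM : i < A.M) (ht : t ∈ Finset.Ioc (A.t i) (A.t (i + 1))) :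
    ∫ ω, stepRegret A f (c ω) (fun s => Z s ω) t ∂P ≤
      H (i + 1) + ∑ j ∈ Finset.Icc 1 i, ε j * H j := by
  have hti : A.t (i + 1) ≤ A.T := by rw [← hT]; exact grid_mono hlt hiM le_rfl
  have htT : t ∈ Finset.Icc 1 A.T := by
    simp only [Finset.mem_Ioc, Finset.mem_Icc] at ht ⊢; omega
  have htS : t ∈ Set.Icc 1 A.T := by simpa using htT
  have hbatch := batchOf_eq hlt hiM ht
  let φ : ℕ → Node d → Cov d × (Arm → ℝ) → ℝ := fun j D z =>
    if z.1 ∈ cell A.g D then smallGap f (rad j) z.1 else 0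
  have hφ : ∀ j D, Measurable (φ j D) := fun j D =>
    Measurable.ite (measurable_fst (measurableSet_cell A.g D))
      ((measurable_smallGap hf _).comp measurable_fst) measurable_const
  have hφ0 : ∀ j D z, 0 ≤ φ j D z := by
    intro j D z; simp only [φ]; split_ifs
    · exact smallGap_nonneg _ _ _
    · exact le_rfl
  have hφi : ∀ j D, Integrable (φ j D) μ := fun j D => by
    refine (integrable_smallGap h hf (rad j)).mono (hφ j D).aestronglyMeasurable ?_
    filter_upwards with z
    simp only [φ]
    split_ifs
    · exact le_rfl
    · simp
  have hφZ : ∀ j D, Integrable (fun ω => φ j D (Z t ω)) P := fun j D => by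
    have := hφi j D
    rw [← hZ.law t htS] at this
    exact this.comp_measurable (hZ.measurable t htS)
  have hbm : ∀ j, 1 ≤ j → j ≤ i → ∀ D, MeasurableSet
      {ω | Bad A.g A.T f (lo j) (hi j) (A.t (j - 1)) (A.t j) D fun s => Z s ω} := by
    intro j _ hji D
    refine measurableSet_bad (hZ.measurable_of_mem_Ioc ?_) hf A.g _ _ D
    rw [← hT]; exact grid_mono hlt (by omega) le_rfl
  -- The failure in `D` is multiplied by the contribution of `X_t` inside `D`; the first factor
  -- concerns batch `j` and the second a later time, so they are independent.
  let ψ : ℕ → Node d → Ω → ℝ := fun j D ω =>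
    Set.indicator {ω | Bad A.g A.T f (lo j) (hi j) (A.t (j - 1)) (A.t j) D fun s => Z s ω} 1 ω *
      φ j D (Z t ω)
  have hψi : ∀ j ∈ Finset.Icc 1 i, ∀ D, Integrable (ψ j D) P := by
    intro j hj D
    rw [Finset.mem_Icc] at hj
    refine (hφZ j D).bdd_mul (c := 1) (measurable_one.indicator
      (hbm j hj.1 hj.2 D)).aestronglyMeasurable ?_
    filter_upwards with ω
    refine (norm_indicator_le_norm_self _ _).trans ?_
    simp
  have hsg : Integrable (fun ω => smallGap f (rad (i + 1)) (Z t ω).1) P := by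
    have := integrable_smallGap h hf (rad (i + 1))
    rw [← hZ.law t htS] at this
    exact this.comp_measurable (hZ.measurable t htS)
  have hpt : ∀ᵐ ω ∂P, stepRegret A f (c ω) (fun s => Z s ω) t ≤
      smallGap f (rad (i + 1)) (Z t ω).1 +
        ∑ j ∈ Finset.Icc 1 i, ∑ D ∈ layer d A.g j, ψ j D ω := by
    filter_upwards [ae_sample hZ htS (ae_mem_unitCube h),
      ae_sample hZ htS (ae_abs_gap_le_one h)] with ω h1 h2
    have hps := pathStatus (A := A) (c := c ω) (z := fun s => Z s ω) hp h.smooth (i := i)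
      (fun l hl => hg l (by omega)) (fun j hj hji => hlo j hj (by omega))
      (fun j hj hji => hU1 j hj (by omega)) (fun j hj hji => hU2 j hj (by omega)) h1
      (by rw [hrad]; exact h2)
    refine (regret_le_smallGap hbatch (fun l hl => hg l (by omega)) h1 hps).trans (le_of_eq ?_)
    congr 1
    refine Finset.sum_congr rfl fun j _ => Finset.sum_congr rfl fun D _ => ?_
    simp only [ψ, φ, Set.indicator_apply, Set.mem_ofPred_eq, Pi.one_apply]
    by_cases a1 : (Z t ω).1 ∈ cell A.g D <;>
      by_cases a2 : Bad A.g A.T f (lo j) (hi j) (A.t (j - 1)) (A.t j) D (fun s => Z s ω) <;>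
      simp [a1, a2]
  calc ∫ ω, stepRegret A f (c ω) (fun s => Z s ω) t ∂P
      ≤ ∫ ω, (smallGap f (rad (i + 1)) (Z t ω).1 +
        ∑ j ∈ Finset.Icc 1 i, ∑ D ∈ layer d A.g j, ψ j D ω) ∂P :=
        integral_mono_ae (integrable_stepRegret h hf hZ hc hc' h0 hT hlt htT)
          (hsg.add (integrable_finsetSum _ fun j hj => integrable_finsetSum _ fun D _ =>
            hψi j hj D)) hpt
    _ = ∫ z, smallGap f (rad (i + 1)) z.1 ∂μ +
        ∑ j ∈ Finset.Icc 1 i, ∑ D ∈ layer d A.g j, ∫ ω, ψ j D ω ∂P := by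
        rw [integral_add hsg (integrable_finsetSum _ fun j hj => integrable_finsetSum _
          fun D _ => hψi j hj D), integral_finsetSum _ fun j hj => integrable_finsetSum _
          fun D _ => hψi j hj D, integral_sample (F := fun z => smallGap f (rad (i + 1)) z.1) hZ htS
          ((measurable_smallGap hf _).comp measurable_fst)]
        congr 1
        exact Finset.sum_congr rfl fun j hj => integral_finsetSum _ fun D _ => hψi j hj D
    _ ≤ _ := by
        refine add_le_add (hH (i + 1) (by omega) (by omega)) (Finset.sum_le_sum fun j hj => ?_)
        rw [Finset.mem_Icc] at hj
        have htj : A.t j < t := by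
          have := grid_mono hlt hj.2 hiM.le
          rw [Finset.mem_Ioc] at ht; omega
        -- The failure probability is bounded uniformly over the layer and `X_t` lies in at most one
        -- of its bins. The sum over the bins therefore collapses and their number does not enter.
        calc ∑ D ∈ layer d A.g j, ∫ ω, ψ j D ω ∂P
            ≤ ∑ D ∈ layer d A.g j, ε j * ∫ z, φ j D z ∂μ := by
              refine Finset.sum_le_sum fun D hD => ?_
              simp only [ψ]
              rw [integral_bad_mul hZ hf htj htS.2 D (hφ j D)]
              exact mul_le_mul_of_nonneg_right (hbad j hj.1 (by omega) D hD)
                (integral_nonneg (hφ0 j D))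
          _ = ε j * ∫ z, ∑ D ∈ layer d A.g j, φ j D z ∂μ := by
              rw [← Finset.mul_sum, integral_finsetSum _ fun D _ => hφi j D]
          _ ≤ ε j * ∫ z, smallGap f (rad j) z.1 ∂μ := by
              refine mul_le_mul_of_nonneg_left ?_ (hε j)
              exact integral_mono (integrable_finsetSum _ fun D _ => hφi j D)
                (integrable_smallGap h hf _) fun z => sum_layer_ite_le (smallGap_nonneg _ _ _)
          _ ≤ _ := mul_le_mul_of_nonneg_left (hH j hj.1 (by omega)) (hε j)

end Regret

/-! ### The regret as a sum over batches, and mean rewards without a measurability assumption -/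

section RegretBound

variable {d : ℕ} {p : ClassParams} {μ : Measure (Cov d × (Arm → ℝ))} {f : Arm → Cov d → ℝ}
  {Ω : Type*} [MeasurableSpace Ω] {P : Measure Ω} {A : Inputs}
  {Z : ℕ → Ω → Cov d × (Arm → ℝ)} {c : Ω → Choices d}

/-- The constant of the radius within which the gap is small after a batch. -/
noncomputable def radConst (p : ClassParams) (l : ℝ) : ℝ := 32 / √(p.cLow * l)

/-- A bound for the gap at the active bins with two arms in batch `j`. -/
noncomputable def radius (p : ClassParams) (l : ℝ) (g : ℕ → ℕ) (j : ℕ) : ℝ :=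
  if j ≤ 1 then 1 else radConst p l * width g (j - 1) ^ p.β

/-- A bound for the expected regret of one decision in batch `j`. -/
noncomputable def stepBound (p : ClassParams) (l : ℝ) (g : ℕ → ℕ) (j : ℕ) : ℝ :=
  if j ≤ 1 then 1 else radius p l g j * (p.D₀ * radius p l g j ^ p.α)

/-- The grid and the split factors are such that the statistics of the batches are reliable. -/
structure IsReliable (d : ℕ) (p : ClassParams) (l : ℝ) (A : Inputs) : Prop where
  t_zero : A.t 0 = 0
  t_last : A.t A.M = A.T
  t_lt : ∀ i < A.M, A.t i < A.t (i + 1)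
  g_pos : ∀ i < A.M, 0 < A.g i
  log_ge : ∀ j, 1 ≤ j → j < A.M → 2 ≤ Real.log (A.T * width A.g j ^ d)
  visits_ge : ∀ j, 1 ≤ j → j < A.M → 4 * Real.log (A.T * width A.g j ^ d) ≤
    p.cLow * width A.g j ^ d * (A.t j - A.t (j - 1) : ℕ)
  visits_le : ∀ j, 1 ≤ j → j < A.M → p.cUp * width A.g j ^ d * (A.t j - A.t (j - 1) : ℕ) ≤
    2 * Real.log (2 * A.T * width A.g j ^ d) / (c0 d p * width A.g j ^ p.β) ^ 2
  size_ge : ∀ j, 1 ≤ j → j < A.M → l * Real.log (A.T * width A.g j ^ d) ≤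
    2 * (width A.g j ^ d * (A.t j - A.t (j - 1) : ℕ)) * (width A.g j ^ p.β) ^ 2
  radius_le : ∀ j, 1 ≤ j → j < A.M → radConst p l * width A.g j ^ p.β ≤ p.δ₀

lemma c0_pos (hp : p.Valid) : 0 < c0 d p := by
  have := hp.L_pos
  unfold c0; positivity

lemma IsReliable.nBins_pos {l : ℝ} (hA : IsReliable d p l A) {j : ℕ} (hj : j ≤ A.M) :
    0 < nBins A.g j :=
  Finset.prod_pos fun i hi => hA.g_pos i (by rw [Finset.mem_range] at hi; omega)

lemma IsReliable.width_pos {l : ℝ} (hA : IsReliable d p l A) {j : ℕ} (hj : j ≤ A.M) :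
    0 < width A.g j := by
  have := hA.nBins_pos hj
  unfold width; positivity

/-- The cap `hi` is the number of visits at which the decreasing threshold has come down to `2 y`;
it is used with `y = c₀ w^β`. -/
lemma threshold_ge {T m : ℕ} {w y hi : ℝ} (hy : 0 < y) (hm : 0 < (m : ℝ))
    (hhi : hi = 4 * Real.log (2 * T * w ^ d) / y ^ 2) (hmhi : (m : ℝ) ≤ hi) :
    2 * y ≤ threshold d T m w := by
  unfold threshold
  have h1 : y / 2 ≤ √(Real.log (2 * T * w ^ d) / m) := by
    refine Real.le_sqrt_of_sq_le ?_
    rw [le_div_iff₀ hm]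
    calc (y / 2) ^ 2 * m ≤ (y / 2) ^ 2 * hi := by gcongr
      _ = _ := by rw [hhi]; field_simp; norm_num
  linarith

/-- This fixes the constant of the radius: the hypothesis on `lo` gives `√(log (2 T w^d) / m) ≤ 4 y
/ √a`, and twice the threshold is `8` times this root. -/
lemma threshold_le {T m : ℕ} {w y a lo : ℝ} (hy : 0 < y) (ha : 0 < a)
    (hlo : Real.log (2 * T * w ^ d) ≤ 16 * lo * y ^ 2 / a) (hlo0 : 0 < lo) (hm : lo ≤ m) :
    2 * threshold d T m w ≤ 32 / √a * y := by
  unfold threshold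
  have hm0 : (0 : ℝ) < m := hlo0.trans_le hm
  have h1 : √(Real.log (2 * T * w ^ d) / m) ≤ 4 / √a * y := by
    rw [Real.sqrt_le_left (by positivity), mul_pow, div_pow, Real.sq_sqrt ha.le, div_le_iff₀ hm0]
    calc _ ≤ 16 * lo * y ^ 2 / a := hlo
      _ ≤ 16 * m * y ^ 2 / a := by gcongr
      _ = _ := by ring
  calc _ = 8 * √(Real.log (2 * T * w ^ d) / m) := by ring
    _ ≤ 8 * (4 / √a * y) := by gcongr
    _ = _ := by ring

lemma radius_nonneg {l : ℝ} {g : ℕ → ℕ} {j : ℕ} : 0 ≤ radius p l g j := by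
  unfold radius radConst width
  split_ifs <;> positivity

lemma stepBound_nonneg (hp : p.Valid) {l : ℝ} {g : ℕ → ℕ} {j : ℕ} : 0 ≤ stepBound p l g j := by
  have h1 := radius_nonneg (p := p) (l := l) (g := g) (j := j)
  have h2 := hp.D₀_pos
  unfold stepBound
  split_ifs <;> positivity

/-- The expected regret in terms of the batch sizes. -/
lemma integral_regret_le_of_measurable [IsProbabilityMeasure P] (hp : p.Valid) (h : IsInstance p μ f)
    (hf : ∀ k, Measurable (f k)) (hZ : IsIIDSample P A.T μ Z)
    (hc : ∀ i C, Measurable fun ω => (c ω).first i C)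
    (hc' : ∀ t, Measurable fun ω => (c ω).final t) {l : ℝ} (hl : 0 < l)
    (hA : IsReliable d p l A) :
    ∑ t ∈ Finset.Icc 1 A.T, ∫ ω, stepRegret A f (c ω) (fun s => Z s ω) t ∂P ≤
      (1 + p.cLow) * ∑ i ∈ Finset.range A.M,
        (A.t (i + 1) - A.t i : ℕ) * stepBound p l A.g (i + 1) := by
  have hcL := hp.cLow_pos
  have hc0 : 0 < c0 d p := c0_pos hp
  let B : ℕ → ℝ := fun j => (A.t j - A.t (j - 1) : ℕ)
  let y : ℕ → ℝ := fun j => Real.log (A.T * width A.g j ^ d)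
  -- `lo` is a quarter of a lower bound for the expected number of visits, as the lower Chernoff
  -- bound requires. `hi` is the cap from `threshold_ge`, and the upper bound on the expected visits
  -- makes it at least twice their expectation. `ε` is the failure probability from
  -- `measureReal_bad_le`.
  let lo : ℕ → ℝ := fun j => p.cLow * width A.g j ^ d * B j / 4
  let hi : ℕ → ℝ := fun j =>
    4 * Real.log (2 * A.T * width A.g j ^ d) / (c0 d p * width A.g j ^ p.β) ^ 2
  let ε : ℕ → ℝ := fun j => 4 / (A.T * width A.g j ^ d)
  have hw : ∀ j, j ≤ A.M → 0 < width A.g j := fun j hj => hA.width_pos hj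
  have hwβ : ∀ j, j ≤ A.M → 0 < width A.g j ^ p.β := fun j hj => Real.rpow_pos_of_pos (hw j hj) _
  have hlo2 : ∀ j, 1 ≤ j → j < A.M → 2 ≤ lo j := by
    intro j h1 h2
    have a1 := hA.log_ge j h1 h2
    have a2 := hA.visits_ge j h1 h2
    simp only [lo, B]; linarith
  have hTw : ∀ j, 1 ≤ j → j < A.M → 2 < A.T * width A.g j ^ d := by
    intro j h1 h2
    have hpos : 0 ≤ A.T * width A.g j ^ d := by have := hw j h2.le; positivity
    by_contra! hcon
    have a1 := hA.log_ge j h1 h2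
    have a2 : Real.log (A.T * width A.g j ^ d) ≤ A.T * width A.g j ^ d - 1 := by
      rcases hpos.lt_or_eq with h3 | h3
      · exact Real.log_le_sub_one_of_pos h3
      · rw [← h3] at a1; norm_num at a1
    linarith
  have hΛ : ∀ j, 1 ≤ j → j < A.M → Real.log (2 * A.T * width A.g j ^ d) ≤ 2 * y j := by
    intro j h1 h2
    have a1 := hTw j h1 h2
    rw [mul_assoc, Real.log_mul (by norm_num) (by linarith)]
    have : Real.log 2 ≤ Real.log (A.T * width A.g j ^ d) := Real.log_le_log (by norm_num) a1.le
    simp only [y]; linarith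
  have hU1 : ∀ j, 1 ≤ j → j < A.M → ∀ m : ℕ, lo j ≤ m → m ≤ hi j →
      2 * c0 d p * width A.g j ^ p.β ≤ threshold d A.T m (width A.g j) := by
    intro j h1 h2 m hm1 hm2
    rw [mul_assoc]
    exact threshold_ge (mul_pos hc0 (hwβ j h2.le)) (by linarith [hlo2 j h1 h2]) rfl hm2
  have hU2 : ∀ j, 1 ≤ j → j < A.M → ∀ m : ℕ, lo j ≤ m → m ≤ hi j →
      2 * threshold d A.T m (width A.g j) ≤ radius p l A.g (j + 1) := by
    intro j h1 h2 m hm1 hm2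
    rw [radius, if_neg (by omega), Nat.add_sub_cancel, radConst]
    refine threshold_le (hwβ j h2.le) (mul_pos hcL hl) ?_ (by linarith [hlo2 j h1 h2]) hm1
    have a1 := hA.size_ge j h1 h2
    rw [le_div_iff₀ (mul_pos hcL hl)]
    calc _ ≤ 2 * y j * (p.cLow * l) :=
          mul_le_mul_of_nonneg_right (hΛ j h1 h2) (mul_pos hcL hl).le
      _ = 2 * p.cLow * (l * y j) := by ring
      _ ≤ 2 * p.cLow * (2 * (width A.g j ^ d * B j) * (width A.g j ^ p.β) ^ 2) := by
          gcongr
      _ = _ := by simp only [lo]; ring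
  have hbad : ∀ j, 1 ≤ j → j < A.M → ∀ C ∈ layer d A.g j,
      P.real {ω | Bad A.g A.T f (lo j) (hi j) (A.t (j - 1)) (A.t j) C fun s => Z s ω} ≤ ε j := by
    intro j h1 h2 C hC
    obtain ⟨q1, q2⟩ := cellProb_bounds h hp hC (hA.nBins_pos h2.le)
    have hB : 0 ≤ B j := by simp only [B]; positivity
    have q1' := mul_le_mul_of_nonneg_right q1 hB
    have q2' := mul_le_mul_of_nonneg_right q2 hB
    refine measureReal_bad_le hZ h hf ?_ hC (hlo2 j h1 h2) ?_ ?_ (by linarith [hTw j h1 h2]) ?_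
    · rw [← hA.t_last]; exact grid_mono hA.t_lt h2.le le_rfl
    · refine le_trans (le_of_eq ?_) q1'
      simp only [lo]; ring
    · have := hA.visits_le j h1 h2
      calc _ ≤ 2 * (p.cUp * width A.g j ^ d * B j) := by gcongr
        _ ≤ 2 * (2 * Real.log (2 * A.T * width A.g j ^ d) /
            (c0 d p * width A.g j ^ p.β) ^ 2) := by gcongr
        _ = _ := by simp only [hi]; ring
    · exact (hA.visits_ge j h1 h2).trans q1'
  have hH : ∀ j, 1 ≤ j → j ≤ A.M →
      ∫ z, smallGap f (radius p l A.g j) z.1 ∂μ ≤ stepBound p l A.g j := by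
    intro j h1 h2
    unfold stepBound
    split_ifs with h3
    · exact integral_smallGap_le_one h hf _
    · refine integral_smallGap_le h hf radius_nonneg ?_
      rw [radius, if_neg h3]
      exact hA.radius_le (j - 1) (by omega) (by omega)
  have hε : ∀ j, 0 ≤ ε j := fun j => by simp only [ε, width]; positivity
  have hS0 : ∀ j, 0 ≤ stepBound p l A.g j := fun j => stepBound_nonneg hp
  -- A failure in batch `j` can affect at most all `T` decisions, and `T ε_j = 4 / w_j^d` is no more
  -- than `cLow` times the length of batch `j`. The failures thus cost at most a multiple of the
  -- main term.
  have hεB : ∀ j, 1 ≤ j → j < A.M → A.T * ε j ≤ p.cLow * B j := by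
    intro j h1 h2
    have a0 : 0 < width A.g j ^ d := pow_pos (hw j h2.le) _
    have a1 := hTw j h1 h2
    have a2 := hA.visits_ge j h1 h2
    have a3 := hA.log_ge j h1 h2
    have hT0 : (0 : ℝ) < A.T := by
      by_contra! hcon
      nlinarith
    calc A.T * ε j = 4 / width A.g j ^ d := by simp only [ε]; field_simp
      _ ≤ p.cLow * B j := by
        rw [div_le_iff₀ a0]
        simp only [B]; linarith
  rw [sum_Icc_grid hA.t_zero hA.t_last hA.t_lt]
  have hBi : ∀ i, B (i + 1) = ((A.t (i + 1) - A.t i : ℕ) : ℝ) := fun i => by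
    simp only [B, Nat.add_sub_cancel]
  -- The failure terms of all batches, with which the partial sum for each decision is replaced so
  -- that the horizon factors out.
  let E : ℝ := ∑ j ∈ Finset.Ico 1 A.M, ε j * stepBound p l A.g j
  calc ∑ i ∈ Finset.range A.M, ∑ t ∈ Finset.Ioc (A.t i) (A.t (i + 1)),
        ∫ ω, stepRegret A f (c ω) (fun s => Z s ω) t ∂P
      ≤ ∑ i ∈ Finset.range A.M, B (i + 1) * (stepBound p l A.g (i + 1) + E) := by
        refine Finset.sum_le_sum fun i hi' => ?_
        rw [Finset.mem_range] at hi'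
        calc _ ≤ ∑ _t ∈ Finset.Ioc (A.t i) (A.t (i + 1)), (stepBound p l A.g (i + 1) + E) := by
              refine Finset.sum_le_sum fun t ht => ?_
              refine (integral_stepRegret_le hp h hf hZ hc hc' hA.t_zero hA.t_last hA.t_lt hA.g_pos
                hlo2 hU1 hU2 (if_pos le_rfl) hbad hH hε hi' ht).trans ?_
              refine add_le_add le_rfl (Finset.sum_le_sum_of_subset_of_nonneg ?_ ?_)
              · intro j hj
                rw [Finset.mem_Icc] at hj
                rw [Finset.mem_Ico]; omega
              · intro j _ _; exact mul_nonneg (hε j) (hS0 j)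
          _ = _ := by rw [Finset.sum_const, Nat.card_Ioc, nsmul_eq_mul, hBi]
    _ = ∑ i ∈ Finset.range A.M, B (i + 1) * stepBound p l A.g (i + 1) + A.T * E := by
        simp only [mul_add, Finset.sum_add_distrib]
        congr 1
        rw [← Finset.sum_mul]
        congr 1
        have := sum_Icc_grid hA.t_zero hA.t_last hA.t_lt (fun _ => 1)
        simp only [Finset.sum_const, Nat.card_Icc, Nat.card_Ioc, nsmul_eq_mul, mul_one,
          Nat.add_sub_cancel] at this
        rw [this]
        exact Finset.sum_congr rfl fun i _ => hBi i
    _ ≤ ∑ i ∈ Finset.range A.M, B (i + 1) * stepBound p l A.g (i + 1) +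
          p.cLow * ∑ i ∈ Finset.range A.M, B (i + 1) * stepBound p l A.g (i + 1) := by
        refine add_le_add le_rfl ?_
        calc A.T * E = ∑ j ∈ Finset.Ico 1 A.M, A.T * ε j * stepBound p l A.g j := by
              simp only [E, Finset.mul_sum, mul_assoc]
          _ ≤ ∑ j ∈ Finset.Ico 1 A.M, p.cLow * (B j * stepBound p l A.g j) := by
              refine Finset.sum_le_sum fun j hj => ?_
              rw [Finset.mem_Ico] at hj
              rw [← mul_assoc]
              exact mul_le_mul_of_nonneg_right (hεB j hj.1 hj.2) (hS0 j)
          _ ≤ ∑ j ∈ Finset.Ico 1 (A.M + 1), p.cLow * (B j * stepBound p l A.g j) := by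
              refine Finset.sum_le_sum_of_subset_of_nonneg
                (Finset.Ico_subset_Ico_right (Nat.le_succ _)) fun j _ _ => ?_
              exact mul_nonneg hcL.le (mul_nonneg (by simp only [B]; positivity) (hS0 j))
          _ = _ := by
              rw [Finset.sum_Ico_eq_sum_range, Nat.add_sub_cancel, Finset.mul_sum]
              exact Finset.sum_congr rfl fun i _ => by rw [add_comm 1 i]
    _ = _ := by simp only [hBi]; ring

open scoped Classical in
/-- The mean rewards, set to zero outside of the covariate space. -/
noncomputable def cubeRestrict (f : Arm → Cov d → ℝ) (k : Arm) (x : Cov d) : ℝ :=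
  if x ∈ unitCube d then f k x else 0

/-- Outside the cube the mean rewards are arbitrary and may fail to be measurable. On the cube the
Hölder condition makes them continuous, and almost surely no covariate leaves it, so they may be
replaced by these functions. -/
lemma measurable_cubeRestrict (hp : p.Valid) (hf : IsSmooth p f) (k : Arm) :
    Measurable (cubeRestrict f k) := by
  classical
  have hcont : ContinuousOn (f k) (unitCube d) := by
    intro x hx
    rw [ContinuousWithinAt, tendsto_iff_dist_tendsto_zero]
    have h1 : Filter.Tendsto (fun y : Cov d => p.L * ‖y - x‖ ^ p.β)
        (nhdsWithin x (unitCube d)) (nhds 0) := by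
      have : Continuous fun y : Cov d => p.L * ‖y - x‖ ^ p.β := by
        have h2 : Continuous fun y : Cov d => ‖y - x‖ := by fun_prop
        exact continuous_const.mul (h2.rpow_const fun _ => Or.inr hp.β_pos.le)
      have h3 := (this.tendsto x).mono_left (nhdsWithin_le_nhds (s := unitCube d))
      simpa [Real.zero_rpow hp.β_pos.ne'] using h3
    refine squeeze_zero' (Filter.Eventually.of_forall fun _ => dist_nonneg) ?_ h1
    filter_upwards [self_mem_nhdsWithin] with y hy
    rw [Real.dist_eq]
    exact hf k y hy x hx
  exact hcont.measurable_piecewise continuousOn_const measurableSet_unitCube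

lemma cubeRestrict_of_mem {x : Cov d} (hx : x ∈ unitCube d) (k : Arm) :
    cubeRestrict f k x = f k x := if_pos hx

lemma IsInstance.cubeRestrict (h : IsInstance p μ f) : IsInstance p μ (cubeRestrict f) where
  isProb := h.isProb
  density := h.density
  reward_mem := h.reward_mem
  mean_reward k := by
    filter_upwards [h.mean_reward k, ae_mem_unitCube h] with z h1 h2
    rw [h1, cubeRestrict_of_mem h2]
  smooth k x hx y hy := by
    rw [cubeRestrict_of_mem hx, cubeRestrict_of_mem hy]; exact h.smooth k x hx y hy
  margin δ h0 h1 := by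
    refine le_trans (le_of_eq ?_) (h.margin δ h0 h1)
    refine measureReal_congr ?_
    have hc : ∀ᵐ x ∂(μ.map Prod.fst), x ∈ unitCube d :=
      (ae_map_iff measurable_fst.aemeasurable measurableSet_unitCube).2 (ae_mem_unitCube h)
    filter_upwards [hc] with x hx
    exact propext (by
      show (_ ∧ _) ↔ (_ ∧ _)
      rw [cubeRestrict_of_mem hx, cubeRestrict_of_mem hx])

lemma cumRegret_ae_eq (h : IsInstance p μ f) (hZ : IsIIDSample P A.T μ Z) :
    (fun ω => cumRegret A.T f (fun t => (Z t ω).1) (basedb A (c ω) fun t => Z t ω)) =ᵐ[P]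
      fun ω => ∑ t ∈ Finset.Icc 1 A.T, stepRegret A (cubeRestrict f) (c ω) (fun s => Z s ω) t := by
  have : ∀ᵐ ω ∂P, ∀ t ∈ Finset.Icc 1 A.T, (Z t ω).1 ∈ unitCube d :=
    (Finset.eventually_all _).2 fun t ht =>
      ae_sample hZ (by simpa using ht) (ae_mem_unitCube h)
  filter_upwards [this] with ω hω
  unfold cumRegret stepRegret
  refine Finset.sum_congr rfl fun t ht => ?_
  have := hω t ht
  rw [cubeRestrict_of_mem this, cubeRestrict_of_mem this, cubeRestrict_of_mem this]

/-- The regret is integrable and, trivially, at most the horizon. -/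
lemma integrable_cumRegret [IsProbabilityMeasure P] (hp : p.Valid) (h : IsInstance p μ f)
    (hZ : IsIIDSample P A.T μ Z)
    (hc : ∀ i C, Measurable fun ω => (c ω).first i C)
    (hc' : ∀ t, Measurable fun ω => (c ω).final t)
    (h0 : A.t 0 = 0) (hT : A.t A.M = A.T) (hlt : ∀ i < A.M, A.t i < A.t (i + 1)) :
    Integrable (fun ω =>
      cumRegret A.T f (fun t => (Z t ω).1) (basedb A (c ω) fun t => Z t ω)) P ∧
    ∫ ω, cumRegret A.T f (fun t => (Z t ω).1) (basedb A (c ω) fun t => Z t ω) ∂P ≤ A.T := by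
  have hi : ∀ t ∈ Finset.Icc 1 A.T, Integrable
      (fun ω => stepRegret A (cubeRestrict f) (c ω) (fun s => Z s ω) t) P := fun t ht =>
    integrable_stepRegret h.cubeRestrict (measurable_cubeRestrict hp h.smooth) hZ hc hc' h0 hT hlt ht
  have hae := cumRegret_ae_eq (c := c) h hZ
  refine ⟨(integrable_finsetSum _ hi).congr hae.symm, ?_⟩
  rw [integral_congr_ae hae, integral_finsetSum _ hi]
  calc _ ≤ ∑ _t ∈ Finset.Icc 1 A.T, (1 : ℝ) := by
        refine Finset.sum_le_sum fun t ht => ?_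
        calc _ ≤ ∫ _ω, (1 : ℝ) ∂P := integral_mono_ae (hi t ht) (integrable_const _)
              (ae_stepRegret_le_one h.cubeRestrict hZ ht)
          _ = 1 := by simp
    _ = A.T := by simp

lemma integral_cumRegret_le [IsProbabilityMeasure P] (hp : p.Valid) (h : IsInstance p μ f)
    (hZ : IsIIDSample P A.T μ Z)
    (hc : ∀ i C, Measurable fun ω => (c ω).first i C)
    (hc' : ∀ t, Measurable fun ω => (c ω).final t) {l : ℝ} (hl : 0 < l)
    (hA : IsReliable d p l A) :
    ∫ ω, cumRegret A.T f (fun t => (Z t ω).1) (basedb A (c ω) fun t => Z t ω) ∂P ≤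
      (1 + p.cLow) * ∑ i ∈ Finset.range A.M,
        (A.t (i + 1) - A.t i : ℕ) * stepBound p l A.g (i + 1) := by
  have hm := measurable_cubeRestrict hp h.smooth
  rw [integral_congr_ae (cumRegret_ae_eq (c := c) h hZ), integral_finsetSum _ fun t ht =>
    integrable_stepRegret h.cubeRestrict hm hZ hc hc' hA.t_zero hA.t_last hA.t_lt ht]
  exact integral_regret_le_of_measurable hp h.cubeRestrict hm hZ hc hc' hl hA

end RegretBound

/-! ### The number of bins under the tuning recipe -/

/-- The split factors start with a positive number and are obtained by taking rounded powers,
except for the last one, which is `1`. -/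
structure IsSplit (γ : ℝ) (M : ℕ) (g : ℕ → ℕ) : Prop where
  two_le : 2 ≤ M
  zero_pos : 0 < g 0
  step : ∀ i, 1 ≤ i → i + 2 ≤ M → g i = ⌊(g (i - 1) : ℝ) ^ γ⌋₊
  last : g (M - 1) = 1

/-- The constant that controls the loss from rounding. -/
noncomputable def roundConst (γ : ℝ) : ℝ := 2 / (1 - (2 : ℝ) ^ (-(1 / γ - 1)))

lemma two_rpow_lt_one {γ : ℝ} (h0 : 0 < γ) (h1 : γ < 1) : (2 : ℝ) ^ (-(1 / γ - 1)) < 1 := by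
  refine Real.rpow_lt_one_of_one_lt_of_neg (by norm_num) ?_
  have : 1 < 1 / γ := by rw [lt_div_iff₀ h0]; linarith
  linarith

lemma two_le_roundConst {γ : ℝ} (h0 : 0 < γ) (h1 : γ < 1) : 2 ≤ roundConst γ := by
  have h := two_rpow_lt_one h0 h1
  have h' : 0 < (2 : ℝ) ^ (-(1 / γ - 1)) := by positivity
  rw [roundConst, le_div_iff₀ (by linarith)]
  linarith

/-- The losses from rounding telescope. -/
lemma rpow_le_floor_mul_exp {γ : ℝ} (h0 : 0 < γ) (h1 : γ < 1) {n m : ℕ} (hn : 0 < n)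
    (hm : m = ⌊(n : ℝ) ^ γ⌋₊) :
    (n : ℝ) ^ γ ≤ m * Real.exp (roundConst γ * (1 / m - 1 / n)) := by
  have hn1 : (1 : ℝ) ≤ n := by exact_mod_cast hn
  have hK := two_le_roundConst h0 h1
  have hnγ : (1 : ℝ) ≤ (n : ℝ) ^ γ := Real.one_le_rpow hn1 h0.le
  have hm1 : 1 ≤ m := by rw [hm]; exact Nat.le_floor (by simpa using hnγ)
  have hmr : (1 : ℝ) ≤ m := by exact_mod_cast hm1
  have hlt : (n : ℝ) ^ γ < m + 1 := by rw [hm]; exact Nat.lt_floor_add_one _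
  have hle : (m : ℝ) ≤ (n : ℝ) ^ γ := by rw [hm]; exact Nat.floor_le (by positivity)
  rcases hm1.eq_or_lt with h2 | h2
  -- For `m = 1` there is no loss if `n = 1`. If `n ≥ 2`, the exponent is at least `1` because the
  -- constant is at least `2`, and `e ≥ 2 > n^γ`.
  · rw [← h2] at hlt ⊢
    rcases (Nat.succ_le_of_lt hn).eq_or_lt with h3 | h3
    · rw [← h3]; simp
    · have hn2 : (2 : ℝ) ≤ n := by exact_mod_cast h3
      have h4 : 1 / (n : ℝ) ≤ 1 / 2 := one_div_le_one_div_of_le (by norm_num) hn2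
      have h5 : (1 : ℝ) ≤ roundConst γ * (1 / ((1 : ℕ) : ℝ) - 1 / n) := by
        push_cast
        nlinarith
      have h6 := Real.add_one_le_exp (roundConst γ * (1 / ((1 : ℕ) : ℝ) - 1 / n))
      push_cast at hlt h5 h6 ⊢
      linarith
  · have hm2 : (2 : ℝ) ≤ m := by exact_mod_cast h2
    have hm0 : (0 : ℝ) < m := by linarith
    have h3 : (m : ℝ) ^ (1 / γ) ≤ n := by
      calc (m : ℝ) ^ (1 / γ) ≤ ((n : ℝ) ^ γ) ^ (1 / γ) :=
            Real.rpow_le_rpow (by positivity) hle (by positivity)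
        _ = n := by rw [← Real.rpow_mul (by positivity), mul_one_div_cancel h0.ne', Real.rpow_one]
    -- Since `n ≥ m^{1/γ}`, the reciprocal `1/n` is smaller than `1/m` by a fixed ratio below `1`.
    -- The difference `1/m - 1/n` is then a fixed fraction of the rounding loss `1/m`, which is why
    -- the loss can be charged to a telescoping sum.
    have h4 : 1 / (n : ℝ) ≤ (2 : ℝ) ^ (-(1 / γ - 1)) * (1 / m) := by
      calc 1 / (n : ℝ) ≤ 1 / (m : ℝ) ^ (1 / γ) := one_div_le_one_div_of_le (by positivity) h3
        _ = (m : ℝ) ^ (-(1 / γ - 1)) * (1 / m) := by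
          rw [show 1 / (m : ℝ) = (m : ℝ) ^ (-1 : ℝ) by rw [Real.rpow_neg_one, one_div],
            one_div ((m : ℝ) ^ (1 / γ)), ← Real.rpow_neg hm0.le, ← Real.rpow_add hm0]
          congr 1; ring
        _ ≤ _ := by
          refine mul_le_mul_of_nonneg_right ?_ (by positivity)
          refine Real.rpow_le_rpow_of_nonpos (by norm_num) hm2 ?_
          have : 1 < 1 / γ := by rw [lt_div_iff₀ h0]; linarith
          linarith
    have hρ := two_rpow_lt_one h0 h1
    have h5 : 1 / (m : ℝ) ≤ roundConst γ * (1 / m - 1 / n) := by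
      have h6 : roundConst γ * ((1 - (2 : ℝ) ^ (-(1 / γ - 1))) * (1 / m)) = 2 * (1 / m) := by
        rw [roundConst, ← mul_assoc, div_mul_cancel₀]
        linarith
      have h7 : (0 : ℝ) < 1 / m := by positivity
      have h8 : roundConst γ * ((1 - (2 : ℝ) ^ (-(1 / γ - 1))) * (1 / m)) ≤
          roundConst γ * (1 / m - 1 / n) := by
        refine mul_le_mul_of_nonneg_left ?_ (by linarith)
        linarith
      linarith
    calc (n : ℝ) ^ γ ≤ m * (1 / m + 1) := by rw [mul_add, mul_one_div_cancel hm0.ne']; linarith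
      _ ≤ m * Real.exp (1 / m) := by gcongr; exact Real.add_one_le_exp _
      _ ≤ _ := by gcongr

section Split

variable {γ : ℝ} {M : ℕ} {g : ℕ → ℕ}

lemma IsSplit.pos (h : IsSplit γ M g) (h0 : 0 < γ) {i : ℕ} (hi : i < M) : 0 < g i := by
  by_cases hlast : i = M - 1
  · rw [hlast, h.last]; exact one_pos
  induction i with
  | zero => exact h.zero_pos
  | succ i ih =>
    have h1 := ih (by omega) (by omega)
    rw [h.step (i + 1) (by omega) (by omega), Nat.add_sub_cancel]
    refine Nat.floor_pos.2 (Real.one_le_rpow ?_ h0.le)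
    exact_mod_cast h1

lemma IsSplit.nBins_pos (h : IsSplit γ M g) (h0 : 0 < γ) {i : ℕ} (hi : i ≤ M) : 0 < nBins g i :=
  Finset.prod_pos fun l hl => h.pos h0 (by rw [Finset.mem_range] at hl; omega)

lemma IsSplit.nBins_mono (h : IsSplit γ M g) (h0 : 0 < γ) {i j : ℕ} (hij : i ≤ j) (hj : j ≤ M) :
    nBins g i ≤ nBins g j := by
  induction j, hij using Nat.le_induction with
  | base => exact le_rfl
  | succ j _ ih =>
    rw [nBins_succ]
    exact (ih (by omega)).trans (Nat.le_mul_of_pos_right _ (h.pos h0 (by omega)))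

lemma nBins_zero (g : ℕ → ℕ) : nBins g 0 = 1 := rfl

lemma nBins_one (g : ℕ → ℕ) : nBins g 1 = g 0 := by simp [nBins]

/-- Multiply the inequalities `g_l ≤ g_{l-1}^γ`. This relation balances the length of a batch
against the gap left by the previous layer. -/
lemma IsSplit.nBins_succ_le (h : IsSplit γ M g) {i : ℕ} (hi : i + 2 ≤ M) :
    (nBins g (i + 1) : ℝ) ≤ g 0 * (nBins g i : ℝ) ^ γ := by
  induction i with
  | zero => simp [nBins_one, nBins_zero]
  | succ i ih =>
    have h1 := h.step (i + 1) (by omega) (by omega)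
    rw [Nat.add_sub_cancel] at h1
    have h2 : (g (i + 1) : ℝ) ≤ (g i : ℝ) ^ γ := by
      rw [h1]; exact Nat.floor_le (by positivity)
    rw [nBins_succ, Nat.cast_mul]
    calc (nBins g (i + 1) : ℝ) * g (i + 1) ≤ (g 0 * (nBins g i : ℝ) ^ γ) * (g i : ℝ) ^ γ :=
          mul_le_mul (ih (by omega)) h2 (by positivity) (by positivity)
      _ = _ := by
        rw [nBins_succ, Nat.cast_mul, Real.mul_rpow (by positivity) (by positivity), mul_assoc]

/-- The exponent `1 / (1 - γ)` is the fixed point of `s ↦ 1 + γ s`, so the recursion preserves the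
bound. -/
lemma IsSplit.nBins_le (h : IsSplit γ M g) (h0 : 0 < γ) (h1 : γ < 1) {i : ℕ} (hi : i + 1 ≤ M) :
    (nBins g i : ℝ) ≤ (g 0 : ℝ) ^ (1 / (1 - γ)) := by
  have hg : (1 : ℝ) ≤ g 0 := by exact_mod_cast h.zero_pos
  have h1' : 0 < 1 - γ := by linarith
  induction i with
  | zero => rw [nBins_zero, Nat.cast_one]; exact Real.one_le_rpow hg (by positivity)
  | succ i ih =>
    calc (nBins g (i + 1) : ℝ) ≤ g 0 * (nBins g i : ℝ) ^ γ := h.nBins_succ_le (by omega)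
      _ ≤ g 0 * ((g 0 : ℝ) ^ (1 / (1 - γ))) ^ γ := by
        gcongr
        exact ih (by omega)
      _ = (g 0 : ℝ) ^ (1 + 1 / (1 - γ) * γ) := by
        rw [← Real.rpow_mul (by positivity), Real.rpow_add (by linarith), Real.rpow_one]
      _ = _ := by congr 1; field_simp; ring

/-- The reverse of `IsSplit.nBins_succ_le` up to rounding, with the losses of all layers collected
in one telescoped exponential. -/
lemma IsSplit.le_nBins_succ (h : IsSplit γ M g) (h0 : 0 < γ) (h1 : γ < 1) {i : ℕ}
    (hi : i + 2 ≤ M) : g 0 * (nBins g i : ℝ) ^ γ ≤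
      nBins g (i + 1) * Real.exp (roundConst γ * (1 / g i - 1 / g 0)) := by
  induction i with
  | zero => simp [nBins_one, nBins_zero]
  | succ i ih =>
    have hs := h.step (i + 1) (by omega) (by omega)
    rw [Nat.add_sub_cancel] at hs
    have h2 := rpow_le_floor_mul_exp h0 h1 (h.pos h0 (show i < M by omega)) hs
    calc g 0 * (nBins g (i + 1) : ℝ) ^ γ = (g 0 * (nBins g i : ℝ) ^ γ) * (g i : ℝ) ^ γ := by
          rw [nBins_succ, Nat.cast_mul, Real.mul_rpow (by positivity) (by positivity), mul_assoc]
      _ ≤ (nBins g (i + 1) * Real.exp (roundConst γ * (1 / g i - 1 / g 0))) *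
          (g (i + 1) * Real.exp (roundConst γ * (1 / g (i + 1) - 1 / g i))) :=
          mul_le_mul (ih (by omega)) h2 (by positivity) (by positivity)
      _ = (nBins g (i + 1) * g (i + 1)) * (Real.exp (roundConst γ * (1 / g i - 1 / g 0)) *
          Real.exp (roundConst γ * (1 / g (i + 1) - 1 / g i))) := by ring
      _ = _ := by
        rw [← Real.exp_add, nBins_succ g (i + 1), Nat.cast_mul]
        congr 2; ring

/-- The total rounding loss is at most `exp (roundConst γ)`, hence `N_{i+1} ≥ x N_i^γ` with `x = exp
(-roundConst γ) g_0`. Iterating `s ↦ 1 + γ s` from `0` gives the exponent `(1 - γ^i) / (1 - γ)`. -/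
lemma IsSplit.le_nBins (h : IsSplit γ M g) (h0 : 0 < γ) (h1 : γ < 1) {i : ℕ} (hi : i + 1 ≤ M) :
    (Real.exp (-roundConst γ) * g 0) ^ ((1 - γ ^ i) / (1 - γ)) ≤ nBins g i := by
  have hg : (0 : ℝ) < g 0 := by exact_mod_cast h.zero_pos
  set x := Real.exp (-roundConst γ) * g 0 with hx
  have hx0 : 0 < x := by positivity
  have h1' : 0 < 1 - γ := by linarith
  induction i with
  | zero => simp [nBins_zero]
  | succ i ih =>
    have h2 := h.le_nBins_succ h0 h1 (i := i) (by omega)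
    have hgi : (1 : ℝ) ≤ g i := by exact_mod_cast h.pos h0 (show i < M by omega)
    have h3 : Real.exp (roundConst γ * (1 / g i - 1 / g 0)) ≤ Real.exp (roundConst γ) := by
      refine Real.exp_le_exp.2 ?_
      have hK := two_le_roundConst h0 h1
      have a1 : 1 / (g i : ℝ) ≤ 1 := by rw [div_le_one (by linarith)]; exact hgi
      have a2 : 0 < 1 / (g 0 : ℝ) := by positivity
      nlinarith
    have h4 : x * (nBins g i : ℝ) ^ γ ≤ nBins g (i + 1) := by
      rw [hx, Real.exp_neg, mul_assoc, inv_mul_le_iff₀ (Real.exp_pos _), mul_comm (Real.exp _)]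
      exact h2.trans (by gcongr)
    calc x ^ ((1 - γ ^ (i + 1)) / (1 - γ)) = x * (x ^ ((1 - γ ^ i) / (1 - γ))) ^ γ := by
          rw [← Real.rpow_mul hx0.le]
          nth_rewrite 2 [← Real.rpow_one x]
          rw [← Real.rpow_add hx0]
          congr 1
          field_simp
          ring
      _ ≤ x * (nBins g i : ℝ) ^ γ := by
          gcongr
          exact ih (by omega)
      _ ≤ _ := h4

end Split

/-! ### Consequences of the tuning recipe -/

section Tuned

variable {d : ℕ} {p : ClassParams} {q : TuningConsts} {A : Inputs} {b : ℝ} {l : ℕ → ℝ}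

lemma width_rpow_neg {g : ℕ → ℕ} {i : ℕ} (hN : 0 < nBins g i) (β : ℝ) :
    width g i ^ (-(2 * β + d)) = (nBins g i : ℝ) ^ (2 * β) * (nBins g i : ℝ) ^ d := by
  have hN' : (0 : ℝ) < nBins g i := by exact_mod_cast hN
  rw [width, Real.inv_rpow hN'.le, Real.rpow_neg hN'.le, inv_inv, Real.rpow_add hN',
    Real.rpow_natCast]

lemma width_pow {g : ℕ → ℕ} {i : ℕ} : width g i ^ d = ((nBins g i : ℝ) ^ d)⁻¹ := by
  rw [width, inv_pow]

lemma width_rpow {g : ℕ → ℕ} {i : ℕ} (β : ℝ) : width g i ^ β = ((nBins g i : ℝ) ^ β)⁻¹ := by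
  rw [width, Real.inv_rpow (by positivity)]

lemma width_rpow_sq {g : ℕ → ℕ} {i : ℕ} (β : ℝ) :
    (width g i ^ β) ^ 2 = ((nBins g i : ℝ) ^ (2 * β))⁻¹ := by
  rw [width_rpow, inv_pow, ← Real.rpow_natCast, ← Real.rpow_mul (by positivity)]
  congr 2
  push_cast; ring

lemma IsTuned.isSplit (h : IsTuned d p q A b l) (hg : 0 < A.g 0) :
    IsSplit (gam d p.α p.β) A.M A.g :=
  ⟨h.two_le_M, hg, h.g_step, h.g_last⟩

/-- The size of batch `j` before rounding. -/
lemma IsTuned.batch_bounds (h : IsTuned d p q A b l) (hg : 0 < A.g 0)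
    (hγ : 0 < gam d p.α p.β) {j : ℕ} (h1 : 1 ≤ j) (h2 : j < A.M) :
    ((A.t j - A.t (j - 1) : ℕ) : ℝ) ≤ l j * ((nBins A.g j : ℝ) ^ (2 * p.β) *
      (nBins A.g j : ℝ) ^ d) * Real.log (A.T * width A.g j ^ d) ∧
    l j * ((nBins A.g j : ℝ) ^ (2 * p.β) * (nBins A.g j : ℝ) ^ d) *
      Real.log (A.T * width A.g j ^ d) ≤ 2 * ((A.t j - A.t (j - 1) : ℕ) : ℝ) := by
  have hN := (h.isSplit hg).nBins_pos hγ h2.le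
  have hs := h.t_step j h1 h2
  have hlt := h.t_lt (j - 1) (by omega)
  rw [Nat.sub_add_cancel h1] at hlt
  rw [width_rpow_neg hN] at hs
  set x := l j * ((nBins A.g j : ℝ) ^ (2 * p.β) * (nBins A.g j : ℝ) ^ d) *
    Real.log (A.T * width A.g j ^ d) with hx
  have e : A.t j - A.t (j - 1) = ⌊x⌋₊ := by omega
  -- The grid is strictly increasing, so the batch is not empty, and a real number with positive
  -- integer part is at most twice that part.
  have hpos : 1 ≤ ⌊x⌋₊ := by omega
  have hx1 : 1 ≤ x := Nat.one_le_floor_iff x |>.1 hpos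
  rw [e]
  refine ⟨Nat.floor_le (by linarith), ?_⟩
  have h3 := Nat.lt_floor_add_one x
  have h4 : (1 : ℝ) ≤ ⌊x⌋₊ := by exact_mod_cast hpos
  linarith

/-- Every layer `j ≥ 1` has at least `g_0` bins along an axis, so a large `g_0` gives the lower
bound on the visits and the bound on the radius for all layers at once. The upper bound on the
visits is the upper bound on `l_j`. -/
lemma IsTuned.isReliable (h : IsTuned d p q A b l) (hp : p.Valid) (hl : 0 < q.lLow)
    (hγ : 0 < gam d p.α p.β) (hg : 0 < A.g 0)
    (hg1 : 8 / (p.cLow * q.lLow) ≤ (A.g 0 : ℝ) ^ (2 * p.β))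
    (hg2 : radConst p q.lLow / p.δ₀ ≤ (A.g 0 : ℝ) ^ p.β)
    (hlog : ∀ j, 1 ≤ j → j < A.M → 2 ≤ Real.log (A.T * width A.g j ^ d)) :
    IsReliable d p q.lLow A := by
  have hS := h.isSplit hg
  have hcL := hp.cLow_pos
  have hβ := hp.β_pos
  have hN : ∀ j, 1 ≤ j → j < A.M → (A.g 0 : ℝ) ≤ nBins A.g j ∧ (0 : ℝ) < nBins A.g j := by
    intro j h1 h2
    have := hS.nBins_mono hγ h1 h2.le
    rw [nBins_one] at this
    exact ⟨by exact_mod_cast this, by exact_mod_cast hS.nBins_pos hγ h2.le⟩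
  have hB : ∀ j, 1 ≤ j → j < A.M → q.lLow * ((nBins A.g j : ℝ) ^ (2 * p.β) *
      (nBins A.g j : ℝ) ^ d) * Real.log (A.T * width A.g j ^ d) ≤
      2 * ((A.t j - A.t (j - 1) : ℕ) : ℝ) := by
    intro j h1 h2
    refine le_trans ?_ (h.batch_bounds hg hγ h1 h2).2
    have := hlog j h1 h2
    have := (hN j h1 h2).2
    gcongr
    exact h.l_lower j h1 h2
  refine ⟨h.t_zero, h.t_last, h.t_lt, fun i hi => hS.pos hγ hi, hlog, ?_, ?_, ?_, ?_⟩
  · intro j h1 h2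
    obtain ⟨n1, n2⟩ := hN j h1 h2
    have hQ : 8 / (p.cLow * q.lLow) ≤ (nBins A.g j : ℝ) ^ (2 * p.β) :=
      hg1.trans (Real.rpow_le_rpow (by positivity) n1 (by positivity))
    rw [div_le_iff₀ (by positivity)] at hQ
    have hb := hB j h1 h2
    have hy := hlog j h1 h2
    set y := Real.log (A.T * width A.g j ^ d)
    rw [width_pow]
    set Q := (nBins A.g j : ℝ) ^ (2 * p.β)
    set D := (nBins A.g j : ℝ) ^ d with hD
    have hD0 : 0 < D := by positivity
    calc 4 * y = 8 * y / 2 := by ring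
      _ ≤ (Q * (p.cLow * q.lLow)) * y / 2 := by gcongr
      _ = p.cLow * D⁻¹ * ((q.lLow * (Q * D) * y) / 2) := by field_simp
      _ ≤ p.cLow * D⁻¹ * ((2 * ((A.t j - A.t (j - 1) : ℕ) : ℝ)) / 2) := by gcongr
      _ = _ := by ring
  · intro j h1 h2
    obtain ⟨n1, n2⟩ := hN j h1 h2
    have hb := (h.batch_bounds hg hγ h1 h2).1
    have hu := h.l_upper j h1 h2
    rw [mul_pow, width_rpow_sq]
    have hc := c0_pos (d := d) hp
    have hcU := hp.cUp_pos
    set y := Real.log (A.T * width A.g j ^ d)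
    set Λ := Real.log (2 * A.T * width A.g j ^ d)
    rw [width_pow]
    set Q := (nBins A.g j : ℝ) ^ (2 * p.β)
    set D := (nBins A.g j : ℝ) ^ d with hD
    have hD0 : 0 < D := by positivity
    have hQ0 : 0 < Q := by positivity
    calc p.cUp * D⁻¹ * ((A.t j - A.t (j - 1) : ℕ) : ℝ) ≤ p.cUp * D⁻¹ * (l j * (Q * D) * y) := by
          gcongr
      _ = p.cUp * Q * (l j * y) := by field_simp
      _ ≤ p.cUp * Q * (2 / (c0 d p ^ 2 * p.cUp) * Λ) := by gcongr
      _ = _ := by field_simp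
  · intro j h1 h2
    obtain ⟨n1, n2⟩ := hN j h1 h2
    have hb := hB j h1 h2
    rw [width_rpow_sq]
    set y := Real.log (A.T * width A.g j ^ d)
    rw [width_pow]
    set Q := (nBins A.g j : ℝ) ^ (2 * p.β)
    set D := (nBins A.g j : ℝ) ^ d with hD
    have hD0 : 0 < D := by positivity
    have hQ0 : 0 < Q := by positivity
    calc q.lLow * y = (q.lLow * (Q * D) * y) * (D⁻¹ * Q⁻¹) := by field_simp
      _ ≤ (2 * ((A.t j - A.t (j - 1) : ℕ) : ℝ)) * (D⁻¹ * Q⁻¹) := by gcongr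
      _ = _ := by ring
  · intro j h1 h2
    obtain ⟨n1, n2⟩ := hN j h1 h2
    have hR : radConst p q.lLow / p.δ₀ ≤ (nBins A.g j : ℝ) ^ p.β :=
      hg2.trans (Real.rpow_le_rpow (by positivity) n1 (by positivity))
    rw [div_le_iff₀ hp.δ₀_pos] at hR
    rw [width_rpow, mul_inv_le_iff₀ (by positivity), mul_comm]
    exact hR

/-- Since `γ (2β + d) = β (1 + α)`, the bound from the margin condition is a power of the number of
bins. In the first batch that number is `1`, and the summand `1` of the constant covers the trivial
bound. -/
lemma stepBound_le (hp : p.Valid) {lL : ℝ} (g : ℕ → ℕ) (i : ℕ) (hd : (0 : ℝ) < 2 * p.β + d) :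
    stepBound p lL g (i + 1) ≤ (1 + p.D₀ * radConst p lL ^ (1 + p.α)) *
      ((nBins g i : ℝ) ^ (gam d p.α p.β * (2 * p.β + d)))⁻¹ := by
  have hr : 0 ≤ radConst p lL := by unfold radConst; positivity
  have hD := hp.D₀_pos
  have hα := hp.α_pos
  have hexp : gam d p.α p.β * (2 * p.β + d) = p.β * (1 + p.α) := by
    rw [gam, div_mul_cancel₀ _ hd.ne']
  rw [hexp]
  unfold stepBound
  split_ifs with h
  · have hi : i = 0 := by omega
    rw [hi, nBins_zero]
    simp only [Nat.cast_one, Real.one_rpow, inv_one, mul_one]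
    have : 0 ≤ p.D₀ * radConst p lL ^ (1 + p.α) := by positivity
    linarith
  · have hw : 0 ≤ width g i := by unfold width; positivity
    have hρ : 0 ≤ radConst p lL * width g i ^ p.β := by positivity
    rw [radius, if_neg h, Nat.add_sub_cancel]
    have e : (radConst p lL * width g i ^ p.β) *
        (p.D₀ * (radConst p lL * width g i ^ p.β) ^ p.α) =
        p.D₀ * radConst p lL ^ (1 + p.α) * ((nBins g i : ℝ) ^ (p.β * (1 + p.α)))⁻¹ := by
      have e1 : (radConst p lL * width g i ^ p.β) * (radConst p lL * width g i ^ p.β) ^ p.α =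
          (radConst p lL * width g i ^ p.β) ^ (1 + p.α) := by
        rw [Real.rpow_add' hρ (by linarith), Real.rpow_one]
      rw [mul_left_comm, e1, Real.mul_rpow hr (by positivity), ← Real.rpow_mul hw, width_rpow,
        mul_assoc]
    rw [e]
    have : 0 ≤ ((nBins g i : ℝ) ^ (p.β * (1 + p.α)))⁻¹ := by positivity
    linarith

/-- The sum over the batches is split at a batch `i₀`: before it the contributions of the batches
are bounded one by one, and from it on they are bounded by the horizon. -/
lemma IsTuned.sum_le (h : IsTuned d p q A b l) (hp : p.Valid) (hd : 1 ≤ d)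
    (hγ : 0 < gam d p.α p.β) (hg : 0 < A.g 0) (hb : (A.g 0 : ℝ) ^ (2 * p.β + d) ≤ b)
    (hT : 2 ≤ A.T)
    {i₀ : ℕ} (hi₀ : i₀ < A.M) :
    ∑ i ∈ Finset.range A.M, (A.t (i + 1) - A.t i : ℕ) * stepBound p q.lLow A.g (i + 1) ≤
      (1 + p.D₀ * radConst p q.lLow ^ (1 + p.α)) *
        (i₀ * (4 / (c0 d p ^ 2 * p.cUp) * Real.log A.T * b) +
          A.T * ((nBins A.g i₀ : ℝ) ^ (gam d p.α p.β * (2 * p.β + d)))⁻¹) := by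
  have hS := h.isSplit hg
  have hβ := hp.β_pos
  have hd' : (0 : ℝ) < 2 * p.β + d := by positivity
  set Cs := 1 + p.D₀ * radConst p q.lLow ^ (1 + p.α) with hCs
  have hCs0 : 0 ≤ Cs := by
    have hr : 0 ≤ radConst p q.lLow := by unfold radConst; positivity
    have hD := hp.D₀_pos
    positivity
  set η := gam d p.α p.β * (2 * p.β + d) with hη
  have hη0 : 0 < η := by positivity
  have hc := c0_pos (d := d) hp
  have hcU := hp.cUp_pos
  have hT' : (2 : ℝ) ≤ A.T := by exact_mod_cast hT
  have hN : ∀ j, j ≤ A.M → (1 : ℝ) ≤ nBins A.g j := fun j hj => by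
    exact_mod_cast hS.nBins_pos hγ hj
  have early : ∀ i ∈ Finset.range i₀, (A.t (i + 1) - A.t i : ℕ) * stepBound p q.lLow A.g (i + 1) ≤
      Cs * (4 / (c0 d p ^ 2 * p.cUp) * Real.log A.T * b) := by
    intro i hi
    rw [Finset.mem_range] at hi
    have h1 := (h.batch_bounds hg hγ (j := i + 1) (by omega) (by omega)).1
    rw [Nat.add_sub_cancel] at h1
    have h2 := stepBound_le (lL := q.lLow) hp A.g i hd'
    have hNi := hN i (by omega)
    have hNi1 := hN (i + 1) (by omega)
    -- The power of `N_i` that appears here is the one by which the cost of a decision decreases, so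
    -- an early batch costs `b log T` whatever its index.
    have h3 : (nBins A.g (i + 1) : ℝ) ^ (2 * p.β) * (nBins A.g (i + 1) : ℝ) ^ d ≤
        b * (nBins A.g i : ℝ) ^ η := by
      rw [← Real.rpow_natCast, ← Real.rpow_add (by linarith)]
      calc (nBins A.g (i + 1) : ℝ) ^ (2 * p.β + d) ≤
            (A.g 0 * (nBins A.g i : ℝ) ^ gam d p.α p.β) ^ (2 * p.β + d) :=
            Real.rpow_le_rpow (by positivity) (hS.nBins_succ_le (by omega)) hd'.le
        _ = (A.g 0 : ℝ) ^ (2 * p.β + d) * (nBins A.g i : ℝ) ^ η := by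
            rw [Real.mul_rpow (by positivity) (by positivity), ← Real.rpow_mul (by positivity)]
        _ ≤ _ := by gcongr
    have h4 : l (i + 1) * Real.log (A.T * width A.g (i + 1) ^ d) ≤
        4 / (c0 d p ^ 2 * p.cUp) * Real.log A.T := by
      refine (h.l_upper (i + 1) (by omega) (by omega)).trans ?_
      have hw0 : 0 < width A.g (i + 1) := by unfold width; positivity
      have hw1 : width A.g (i + 1) ^ d ≤ 1 := by
        refine pow_le_one₀ hw0.le ?_
        unfold width; exact inv_le_one_of_one_le₀ hNi1
      have h5 : Real.log (2 * A.T * width A.g (i + 1) ^ d) ≤ 2 * Real.log A.T := by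
        calc _ ≤ Real.log (A.T * A.T) := by
              refine Real.log_le_log (by positivity) ?_
              calc 2 * A.T * width A.g (i + 1) ^ d ≤ 2 * A.T * 1 := by gcongr
                _ ≤ _ := by nlinarith
          _ = _ := by rw [Real.log_mul (by positivity) (by positivity)]; ring
      calc _ ≤ 2 / (c0 d p ^ 2 * p.cUp) * (2 * Real.log A.T) := by gcongr
        _ = _ := by ring
    have hb0 : 0 ≤ b := le_trans (by positivity) hb
    have hlT : 0 ≤ Real.log A.T := Real.log_nonneg (by linarith)
    have hpow : 0 < (nBins A.g i : ℝ) ^ η := by positivity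
    calc _ ≤ (l (i + 1) * ((nBins A.g (i + 1) : ℝ) ^ (2 * p.β) * (nBins A.g (i + 1) : ℝ) ^ d) *
          Real.log (A.T * width A.g (i + 1) ^ d)) * (Cs * ((nBins A.g i : ℝ) ^ η)⁻¹) :=
          mul_le_mul h1 h2 (stepBound_nonneg hp) (le_trans (by positivity) h1)
      _ = (l (i + 1) * Real.log (A.T * width A.g (i + 1) ^ d)) *
          ((nBins A.g (i + 1) : ℝ) ^ (2 * p.β) * (nBins A.g (i + 1) : ℝ) ^ d) *
          (Cs * ((nBins A.g i : ℝ) ^ η)⁻¹) := by ring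
      _ ≤ (4 / (c0 d p ^ 2 * p.cUp) * Real.log A.T) * (b * (nBins A.g i : ℝ) ^ η) *
          (Cs * ((nBins A.g i : ℝ) ^ η)⁻¹) := by gcongr
      _ = _ := by field_simp
  have late : ∀ i ∈ Finset.Ico i₀ A.M,
      (A.t (i + 1) - A.t i : ℕ) * stepBound p q.lLow A.g (i + 1) ≤
      (A.t (i + 1) - A.t i : ℕ) * (Cs * ((nBins A.g i₀ : ℝ) ^ η)⁻¹) := by
    intro i hi
    rw [Finset.mem_Ico] at hi
    refine mul_le_mul_of_nonneg_left ?_ (by positivity)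
    refine (stepBound_le hp A.g i hd').trans ?_
    have h1 := hN i₀ hi₀.le
    have h2 : (nBins A.g i₀ : ℝ) ≤ nBins A.g i := by exact_mod_cast hS.nBins_mono hγ hi.1 hi.2.le
    gcongr
  have hsum : ∑ i ∈ Finset.Ico i₀ A.M, ((A.t (i + 1) - A.t i : ℕ) : ℝ) ≤ A.T := by
    have := sum_Icc_grid h.t_zero h.t_last h.t_lt (fun _ => 1)
    simp only [Finset.sum_const, Nat.card_Icc, Nat.card_Ioc, nsmul_eq_mul, mul_one,
      Nat.add_sub_cancel] at this
    rw [this, Finset.range_eq_Ico]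
    exact Finset.sum_le_sum_of_subset_of_nonneg (Finset.Ico_subset_Ico_left (Nat.zero_le _))
      fun _ _ _ => by positivity
  rw [← Finset.sum_range_add_sum_Ico _ hi₀.le]
  have hinv : 0 ≤ Cs * ((nBins A.g i₀ : ℝ) ^ η)⁻¹ := by positivity
  calc _ ≤ ∑ _i ∈ Finset.range i₀, Cs * (4 / (c0 d p ^ 2 * p.cUp) * Real.log A.T * b) +
        ∑ i ∈ Finset.Ico i₀ A.M,
          (A.t (i + 1) - A.t i : ℕ) * (Cs * ((nBins A.g i₀ : ℝ) ^ η)⁻¹) :=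
        add_le_add (Finset.sum_le_sum early) (Finset.sum_le_sum late)
    _ ≤ i₀ * (Cs * (4 / (c0 d p ^ 2 * p.cUp) * Real.log A.T * b)) +
        A.T * (Cs * ((nBins A.g i₀ : ℝ) ^ η)⁻¹) := by
        rw [Finset.sum_const, Finset.card_range, nsmul_eq_mul, ← Finset.sum_mul]
        gcongr
    _ = _ := by ring

end Tuned

/-! ### The regret bound for large horizons -/

lemma pow_le_inv_of_log_le {γ ℓ : ℝ} (h0 : 0 < γ) (hℓ : 0 < ℓ) {n : ℕ}
    (h : Real.log ℓ ≤ n * (-Real.log γ)) : γ ^ n ≤ ℓ⁻¹ := by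
  rw [← Real.log_le_log_iff (by positivity) (by positivity), Real.log_pow, Real.log_inv]
  linarith

/-- The two exponents differ by at most `γ^M`, and `T^{γ^M} ≤ e` as soon as `γ^M ≤ 1 / log T`. This
is why a number of batches of order `log log T` suffices. -/
lemma rpow_exponent_bounds {γ T : ℝ} (h0 : 0 < γ) (h1 : γ < 1) (hT : 1 < T) {M : ℕ} (hM : M ≠ 0)
    (h : γ ^ M ≤ (Real.log T)⁻¹) :
    T ^ (1 - γ) ≤ T ^ ((1 - γ) / (1 - γ ^ M)) ∧
      T ^ ((1 - γ) / (1 - γ ^ M)) ≤ Real.exp 1 * T ^ (1 - γ) := by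
  have hℓ : 0 < Real.log T := Real.log_pos hT
  have hT0 : 0 < T := by linarith
  have hγM : γ ^ M ≤ γ := by
    calc γ ^ M ≤ γ ^ 1 := pow_le_pow_of_le_one h0.le h1.le (by omega)
      _ = γ := pow_one γ
  have hpos : 0 < γ ^ M := pow_pos h0 M
  have hd : 0 < 1 - γ ^ M := by linarith
  constructor
  · refine Real.rpow_le_rpow_of_exponent_le hT.le ?_
    rw [le_div_iff₀ hd]
    nlinarith
  · rw [Real.rpow_def_of_pos hT0, Real.rpow_def_of_pos hT0, ← Real.exp_add]
    refine Real.exp_le_exp.2 ?_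
    have h2 : (1 - γ) / (1 - γ ^ M) ≤ (1 - γ) + γ ^ M := by
      rw [div_le_iff₀ hd]
      nlinarith
    have h3 : Real.log T * γ ^ M ≤ 1 := by
      calc Real.log T * γ ^ M ≤ Real.log T * (Real.log T)⁻¹ := by gcongr
        _ = 1 := mul_inv_cancel₀ hℓ.ne'
    calc Real.log T * ((1 - γ) / (1 - γ ^ M)) ≤ Real.log T * ((1 - γ) + γ ^ M) := by gcongr
      _ ≤ _ := by linarith

lemma rpow_le_exp_of_le_inv_log {T s a : ℝ} (hT : 1 < T) (hs : s ≤ (Real.log T)⁻¹) (ha : 0 ≤ a) :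
    T ^ (s * a) ≤ Real.exp a := by
  have hℓ : 0 < Real.log T := Real.log_pos hT
  rw [Real.rpow_def_of_pos (by linarith)]
  refine Real.exp_le_exp.2 ?_
  calc Real.log T * (s * a) ≤ Real.log T * ((Real.log T)⁻¹ * a) := by gcongr
    _ = a := by rw [← mul_assoc, mul_inv_cancel₀ hℓ.ne', one_mul]

/-- A lower bound for the number of bins of a late layer. -/
lemma IsSplit.horizon_mul_inv_le {γ : ℝ} {M : ℕ} {g : ℕ → ℕ} (hS : IsSplit γ M g) (h0 : 0 < γ)
    (h1 : γ < 1) {i : ℕ} (hi : i < M) {T b bLow e : ℝ} (he : 0 < e) (hT : Real.exp 1 ≤ T)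
    (hbLow : 0 < bLow) (hx : 1 ≤ Real.exp (-roundConst γ) * g 0) (hgT : (g 0 : ℝ) ≤ T)
    (hγi : γ ^ i ≤ (Real.log T)⁻¹) (hb : b ≤ (2 * g 0) ^ e)
    (hb' : bLow * T ^ (1 - γ) / Real.log T ^ (2 * (1 - γ)) ≤ b) :
    T * ((nBins g i : ℝ) ^ (γ * e))⁻¹ ≤
      (((Real.exp (-roundConst γ) / 2) ^ e * bLow) ^ (γ / (1 - γ)) *
        (Real.exp (1 / (1 - γ)))⁻¹ ^ (γ * e))⁻¹ * (Real.log T ^ 2 * T ^ (1 - γ)) := by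
  have hT1 : 1 < T := lt_of_lt_of_le (by
    have := Real.add_one_le_exp (1 : ℝ); linarith) hT
  have hT0 : 0 < T := by linarith
  have hℓ : 1 ≤ Real.log T := by
    rw [Real.le_log_iff_exp_le hT0]; exact hT
  have hg0 : (0 : ℝ) < g 0 := by exact_mod_cast hS.zero_pos
  have h1' : 0 < 1 - γ := by linarith
  set x := Real.exp (-roundConst γ) * g 0 with hxdef
  have hx0 : 0 < x := by linarith
  have hxT : x ≤ T := by
    refine le_trans ?_ hgT
    refine mul_le_of_le_one_left hg0.le ?_
    rw [Real.exp_le_one_iff]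
    have := two_le_roundConst h0 h1
    linarith
  -- The exponent of `x` is short of its limit by `γ^i / (1 - γ)`, which costs only a constant
  -- factor because `x ≤ T` and `γ^i ≤ 1 / log T`.
  have hNx : x ^ (1 / (1 - γ)) * (Real.exp (1 / (1 - γ)))⁻¹ ≤ nBins g i := by
    refine le_trans ?_ (hS.le_nBins h0 h1 (i := i) (by omega))
    have e1 : (1 - γ ^ i) / (1 - γ) = 1 / (1 - γ) - γ ^ i * (1 / (1 - γ)) := by ring
    rw [e1, Real.rpow_sub hx0, div_eq_mul_inv (x ^ _)]
    gcongr
    calc x ^ (γ ^ i * (1 / (1 - γ))) ≤ T ^ (γ ^ i * (1 / (1 - γ))) :=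
          Real.rpow_le_rpow hx0.le hxT (by positivity)
      _ ≤ _ := rpow_le_exp_of_le_inv_log hT1 hγi (by positivity)
  set c := (Real.exp (-roundConst γ) / 2) ^ e with hc
  have hc0 : 0 < c := by positivity
  set E := (Real.exp (1 / (1 - γ)))⁻¹ with hE
  have hE0 : 0 < E := by positivity
  have hxe : c * b ≤ x ^ e := by
    calc c * b ≤ c * (2 * g 0) ^ e := by gcongr
      _ = x ^ e := by
        rw [hc, ← Real.mul_rpow (by positivity) (by positivity), hxdef]
        congr 1; ring
  -- The logarithm in the window for `b` amounts to replacing `T` by `T / (log T)²`; raised to the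
  -- power `γ / (1 - γ)`, it costs `(log T)^{2γ} ≤ (log T)²`.
  have hblow : bLow * (T / Real.log T ^ 2) ^ (1 - γ) ≤ b := by
    refine le_trans (le_of_eq ?_) hb'
    rw [Real.div_rpow hT0.le (by positivity), ← Real.rpow_natCast, ← Real.rpow_mul (by linarith)]
    push_cast; ring
  have key : (c * bLow) ^ (γ / (1 - γ)) * E ^ (γ * e) * (T ^ γ / Real.log T ^ 2) ≤
      (nBins g i : ℝ) ^ (γ * e) := by
    calc _ ≤ (c * bLow) ^ (γ / (1 - γ)) * E ^ (γ * e) * (T / Real.log T ^ 2) ^ γ := by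
          gcongr
          rw [Real.div_rpow hT0.le (by positivity)]
          gcongr
          calc (Real.log T ^ 2) ^ γ ≤ (Real.log T ^ 2) ^ (1 : ℝ) :=
                Real.rpow_le_rpow_of_exponent_le (one_le_pow₀ hℓ) h1.le
            _ = _ := Real.rpow_one _
      _ = (c * (bLow * (T / Real.log T ^ 2) ^ (1 - γ))) ^ (γ / (1 - γ)) * E ^ (γ * e) := by
          rw [← mul_assoc c, Real.mul_rpow (x := c * bLow) (by positivity) (by positivity),
            ← Real.rpow_mul (by positivity), mul_div_cancel₀ _ h1'.ne']
          ring
      _ ≤ (x ^ e) ^ (γ / (1 - γ)) * E ^ (γ * e) := by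
          gcongr
          exact le_trans (by gcongr) hxe
      _ = (x ^ (1 / (1 - γ)) * E) ^ (γ * e) := by
          rw [Real.mul_rpow (by positivity) hE0.le, ← Real.rpow_mul hx0.le, ← Real.rpow_mul hx0.le]
          congr 2; ring
      _ ≤ _ := Real.rpow_le_rpow (by positivity) hNx (by positivity)
  have hpos : 0 < (c * bLow) ^ (γ / (1 - γ)) * E ^ (γ * e) * (T ^ γ / Real.log T ^ 2) := by
    have : 0 < T ^ γ := Real.rpow_pos_of_pos hT0 _
    positivity
  calc T * ((nBins g i : ℝ) ^ (γ * e))⁻¹ ≤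
        T * ((c * bLow) ^ (γ / (1 - γ)) * E ^ (γ * e) * (T ^ γ / Real.log T ^ 2))⁻¹ := by
        gcongr
    _ = _ := by
        rw [Real.rpow_sub hT0, Real.rpow_one]
        have : 0 < T ^ γ := Real.rpow_pos_of_pos hT0 _
        field_simp

lemma eventually_log_rpow_le {a c C : ℝ} (hc : 0 < c) :
    ∀ᶠ T : ℝ in Filter.atTop, C * Real.log T ^ a ≤ T ^ c := by
  have h := (isLittleO_log_rpow_rpow_atTop a hc).bound (show 0 < 1 / (|C| + 1) by positivity)
  filter_upwards [h, Filter.eventually_ge_atTop 1] with T hT hT1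
  have hℓ : 0 ≤ Real.log T ^ a := Real.rpow_nonneg (Real.log_nonneg hT1) _
  have hTc : 0 ≤ T ^ c := Real.rpow_nonneg (by linarith) _
  rw [Real.norm_of_nonneg hℓ, Real.norm_of_nonneg hTc] at hT
  have h1 : (|C| + 1) * Real.log T ^ a ≤ T ^ c := by
    calc (|C| + 1) * Real.log T ^ a ≤ (|C| + 1) * (1 / (|C| + 1) * T ^ c) := by gcongr
      _ = _ := by field_simp
  nlinarith [le_abs_self C]

lemma eventually_log_log_le (a c : ℝ) :
    ∀ᶠ T : ℝ in Filter.atTop, a * Real.log (Real.log T) + c ≤ Real.log T := by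
  have h1 : ∀ᶠ x : ℝ in Filter.atTop, a * Real.log x + c ≤ x := by
    have h2 := eventually_log_rpow_le (a := 1) (c := 1) (C := |a| * 2) (by norm_num)
    filter_upwards [Filter.eventually_ge_atTop 1, h2,
      Filter.eventually_ge_atTop (2 * c)] with x hx1 hx3 hx4
    rw [Real.rpow_one, Real.rpow_one] at hx3
    have h4 : a * Real.log x ≤ |a| * Real.log x :=
      mul_le_mul_of_nonneg_right (le_abs_self a) (Real.log_nonneg hx1)
    linarith
  exact Real.tendsto_log_atTop.eventually h1

/-- A layer has at most of order `T^{d/(2β+d)}` bins, so `T w^d` is at least of order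
`T^{2β/(2β+d)}` and tends to infinity. -/
lemma IsSplit.two_le_log {γ : ℝ} {M : ℕ} {g : ℕ → ℕ} (hS : IsSplit γ M g) (h0 : 0 < γ)
    (h1 : γ < 1) {j d : ℕ} (hj : j < M) {T b Cb β : ℝ} (hβ : 0 < β) (hT : 0 < T) (hCb : 0 < Cb)
    (hg : (g 0 : ℝ) ^ (2 * β + d) ≤ b) (hb : b ≤ Cb * T ^ (1 - γ))
    (hlarge : Real.exp 2 * Cb ^ (1 / (1 - γ) * (d / (2 * β + d))) ≤ T ^ (2 * β / (2 * β + d))) :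
    2 ≤ Real.log (T * width g j ^ d) := by
  have he : 0 < 2 * β + d := by positivity
  have h1' : 0 < 1 - γ := by linarith
  have hN : (0 : ℝ) < nBins g j := by exact_mod_cast hS.nBins_pos h0 hj.le
  have hg0 : (0 : ℝ) < g 0 := by exact_mod_cast hS.zero_pos
  set s := 1 / (1 - γ) * (d / (2 * β + d)) with hs
  have hs0 : 0 ≤ s := by positivity
  have hNd : (nBins g j : ℝ) ^ d ≤ Cb ^ s * T ^ ((d : ℝ) / (2 * β + d)) := by
    calc (nBins g j : ℝ) ^ d ≤ ((g 0 : ℝ) ^ (1 / (1 - γ))) ^ d := by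
          gcongr; exact hS.nBins_le h0 h1 (by omega)
      _ = ((g 0 : ℝ) ^ (2 * β + d)) ^ s := by
          rw [← Real.rpow_natCast, ← Real.rpow_mul hg0.le, ← Real.rpow_mul hg0.le, hs]
          congr 1; field_simp
      _ ≤ (Cb * T ^ (1 - γ)) ^ s := Real.rpow_le_rpow (by positivity) (hg.trans hb) hs0
      _ = _ := by
          rw [Real.mul_rpow hCb.le (by positivity), ← Real.rpow_mul hT.le, hs]
          congr 2; field_simp
  rw [width_pow, Real.le_log_iff_exp_le (by positivity), ← div_eq_mul_inv,
    le_div_iff₀ (by positivity)]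
  calc Real.exp 2 * (nBins g j : ℝ) ^ d ≤
        Real.exp 2 * (Cb ^ s * T ^ ((d : ℝ) / (2 * β + d))) := by gcongr
    _ = (Real.exp 2 * Cb ^ s) * T ^ ((d : ℝ) / (2 * β + d)) := by ring
    _ ≤ T ^ (2 * β / (2 * β + d)) * T ^ ((d : ℝ) / (2 * β + d)) := by gcongr
    _ = T := by
        rw [← Real.rpow_add hT, ← add_div, div_self he.ne', Real.rpow_one]

lemma floor_rpow_bounds {b e : ℝ} (hb : 0 ≤ b) (he : 0 < e) {n : ℕ}
    (hn : n = ⌊b ^ (1 / e)⌋₊) (hn0 : 0 < n) : (n : ℝ) ^ e ≤ b ∧ b ≤ (2 * n) ^ e := by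
  have hn1 : (1 : ℝ) ≤ n := by exact_mod_cast hn0
  have e1 : (b ^ (1 / e)) ^ e = b := by
    rw [← Real.rpow_mul hb, one_div_mul_cancel he.ne', Real.rpow_one]
  constructor
  · calc (n : ℝ) ^ e ≤ (b ^ (1 / e)) ^ e := by
          gcongr; rw [hn]; exact Nat.floor_le (by positivity)
      _ = b := e1
  · have h1 : b ^ (1 / e) ≤ 2 * n := by
      have : b ^ (1 / e) < n + 1 := by rw [hn]; exact Nat.lt_floor_add_one _
      linarith
    calc b = (b ^ (1 / e)) ^ e := e1.symm
      _ ≤ _ := by gcongr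

/-- A large base gives a large first split factor. -/
lemma le_floor_rpow {b e R : ℝ} (he : 0 < e) (hR : 0 ≤ R) (hb : (R + 1) ^ e ≤ b) :
    R ≤ (⌊b ^ (1 / e)⌋₊ : ℝ) := by
  have h1 : R + 1 ≤ b ^ (1 / e) := by
    calc R + 1 = ((R + 1) ^ e) ^ (1 / e) := by
          rw [← Real.rpow_mul (by positivity), mul_one_div_cancel he.ne', Real.rpow_one]
      _ ≤ _ := Real.rpow_le_rpow (by positivity) hb (by positivity)
  have := Nat.lt_floor_add_one (b ^ (1 / e))
  linarith

/-- For large horizons, a sum that bounds the regret is of the order `(log T)² T^(1-γ)`. -/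
lemma IsTuned.exists_sum_bound {d : ℕ} {p : ClassParams} (hd : 1 ≤ d) (hp : p.Valid)
    (h0 : 0 < gam d p.α p.β) (h1 : gam d p.α p.β < 1) {q : TuningConsts} (hl : 0 < q.lLow)
    (hbL : 0 < q.bLow) (hbU : 0 < q.bUp) :
    ∃ K T₀ : ℝ, 0 < K ∧ ∀ (A : Inputs) (b : ℝ) (l : ℕ → ℝ), T₀ ≤ A.T →
      2 / (-Real.log (gam d p.α p.β)) * Real.log (Real.log A.T) ≤ A.M → IsTuned d p q A b l →
      IsReliable d p q.lLow A ∧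
      ∑ i ∈ Finset.range A.M, (A.t (i + 1) - A.t i : ℕ) * stepBound p q.lLow A.g (i + 1) ≤
        K * (Real.log A.T ^ 2 * (A.T : ℝ) ^ (1 - gam d p.α p.β)) := by
  have hβ := hp.β_pos
  have he : (0 : ℝ) < 2 * p.β + d := by positivity
  set γ := gam d p.α p.β with hγdef
  set lg := -Real.log γ with hlg
  have hlg0 : 0 < lg := by have := Real.log_neg h0 h1; linarith
  have h1' : 0 < 1 - γ := by linarith
  have hc := c0_pos (d := d) hp
  have hcU := hp.cUp_pos
  have hD := hp.D₀_pos
  -- `R` is the size of `g_0` beyond which the batches are reliable and the rounding constant is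
  -- absorbed.
  obtain ⟨R, hR1, hR⟩ : ∃ R : ℝ, 1 ≤ R ∧ ∀ x, R ≤ x → 8 / (p.cLow * q.lLow) ≤ x ^ (2 * p.β) ∧
      radConst p q.lLow / p.δ₀ ≤ x ^ p.β ∧ Real.exp (roundConst γ) ≤ x := by
    have a1 := (tendsto_rpow_atTop (show 0 < 2 * p.β by positivity)).eventually_ge_atTop
      (8 / (p.cLow * q.lLow))
    have a2 := (tendsto_rpow_atTop hβ).eventually_ge_atTop (radConst p q.lLow / p.δ₀)
    obtain ⟨R, hR⟩ := Filter.eventually_atTop.1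
      (a1.and (a2.and (Filter.eventually_ge_atTop (Real.exp (roundConst γ)))))
    exact ⟨max R 1, le_max_right _ _, fun x hx => hR x ((le_max_left _ _).trans hx)⟩
  set Cb := q.bUp * Real.exp 1 with hCb
  have hCb0 : 0 < Cb := by positivity
  -- In order: `log T ≥ 1`; room for `i₀` below the number of batches; `i₀ ≤ log T`; a base `b`
  -- large enough for `g_0 ≥ R`; and `2 ≤ log (T w^d)` in all layers.
  obtain ⟨T₀, hT₀⟩ := Filter.eventually_atTop.1
    ((Filter.eventually_ge_atTop (Real.exp 1)).and
    (((Real.tendsto_log_atTop.comp Real.tendsto_log_atTop).eventually_ge_atTop lg).and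
    ((eventually_log_log_le (1 / lg) 1).and
    ((eventually_log_rpow_le (a := 2 * (1 - γ)) (C := (R + 1) ^ (2 * p.β + d) / q.bLow) h1').and
    ((tendsto_rpow_atTop (show 0 < 2 * p.β / (2 * p.β + d) by positivity)).eventually_ge_atTop
      (Real.exp 2 * Cb ^ (1 / (1 - γ) * (d / (2 * p.β + d)))))))))
  set Cs := 1 + p.D₀ * radConst p q.lLow ^ (1 + p.α) with hCs
  have hCs0 : 0 < Cs := by
    have hr : 0 ≤ radConst p q.lLow := by unfold radConst; positivity
    positivity
  set c₁ := (((Real.exp (-roundConst γ) / 2) ^ (2 * p.β + d) * q.bLow) ^ (γ / (1 - γ)) *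
        (Real.exp (1 / (1 - γ)))⁻¹ ^ (γ * (2 * p.β + d)))⁻¹ with hc₁
  have hc₁0 : 0 < c₁ := by positivity
  refine ⟨Cs * (4 / (c0 d p ^ 2 * p.cUp) * Cb + c₁), T₀, by positivity, ?_⟩
  intro A b l hAT hM h
  obtain ⟨t1, t2, t3, t4, t5⟩ := hT₀ A.T hAT
  simp only [Function.comp_apply] at t2
  set T : ℝ := (A.T : ℝ) with hT
  set ℓ := Real.log T with hℓ
  have hexp1 : (2 : ℝ) ≤ Real.exp 1 := by
    have := Real.add_one_le_exp (1 : ℝ); linarith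
  have hT1 : 1 < T := by linarith
  have hT0 : 0 < T := by linarith
  have hT2 : 2 ≤ A.T := by
    have : (2 : ℝ) ≤ A.T := hexp1.trans t1
    exact_mod_cast this
  have hℓ1 : 1 ≤ ℓ := (Real.le_log_iff_exp_le hT0).2 t1
  have hM' : Real.log ℓ / lg * 2 ≤ A.M := by
    refine le_trans (le_of_eq ?_) hM
    ring
  have hll : 1 ≤ Real.log ℓ / lg := by rwa [le_div_iff₀ hlg0, one_mul]
  have hγM : γ ^ A.M ≤ ℓ⁻¹ := by
    refine pow_le_inv_of_log_le h0 (by linarith) ?_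
    rw [← div_le_iff₀ hlg0]
    linarith
  obtain ⟨r1, r2⟩ := rpow_exponent_bounds h0 h1 hT1 (by have := h.two_le_M; omega) hγM
  have hTγ : 0 < T ^ (1 - γ) := Real.rpow_pos_of_pos hT0 _
  have hbl : q.bLow * T ^ (1 - γ) / ℓ ^ (2 * (1 - γ)) ≤ b := by
    refine le_trans ?_ h.b_lower
    gcongr
  have hbu : b ≤ Cb * T ^ (1 - γ) := by
    refine h.b_upper.trans ?_
    rw [hCb, mul_assoc]
    gcongr
  have hbR : (R + 1) ^ (2 * p.β + d) ≤ b := by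
    refine le_trans ?_ hbl
    rw [le_div_iff₀ (Real.rpow_pos_of_pos (by linarith) _)]
    rw [div_mul_eq_mul_div, div_le_iff₀ hbL] at t4
    linarith
  have hgR : R ≤ A.g 0 := by
    rw [h.g_zero]; exact le_floor_rpow he (by linarith) hbR
  have hg0 : 0 < A.g 0 := by
    have : (0 : ℝ) < A.g 0 := by linarith
    exact_mod_cast this
  obtain ⟨g1, g2⟩ := floor_rpow_bounds (le_trans (by positivity) hbR) he h.g_zero hg0
  have hS := h.isSplit hg0
  have hlog : ∀ j, 1 ≤ j → j < A.M → 2 ≤ Real.log (A.T * width A.g j ^ d) := fun j _ hj =>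
    hS.two_le_log h0 h1 hj hβ hT0 hCb0 g1 hbu t5
  obtain ⟨x1, x2, x3⟩ := hR _ hgR
  refine ⟨h.isReliable hp hl h0 hg0 x1 x2 hlog, ?_⟩
  have hgT : (A.g 0 : ℝ) ≤ T := by
    have h2 := hlog 1 le_rfl (by have := h.two_le_M; omega)
    have hgd : (A.g 0 : ℝ) ≤ (A.g 0 : ℝ) ^ d :=
      le_self_pow₀ (by exact_mod_cast hg0) (by omega)
    rw [width_pow, nBins_one, Real.le_log_iff_exp_le (by positivity), ← div_eq_mul_inv,
      le_div_iff₀ (by positivity)] at h2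
    have h3 : (1 : ℝ) ≤ Real.exp 2 := Real.one_le_exp (by norm_num)
    calc (A.g 0 : ℝ) ≤ 1 * (A.g 0 : ℝ) ^ d := by rwa [one_mul]
      _ ≤ Real.exp 2 * (A.g 0 : ℝ) ^ d := by gcongr
      _ ≤ _ := h2
  -- The first batch with `γ^{i₀} ≤ 1 / log T`. The factor `2` in the lower bound on the number of
  -- batches leaves room for the rounding up, so `i₀ < M`.
  set i₀ := ⌈Real.log ℓ / lg⌉₊ with hi₀
  have hi₀1 : (i₀ : ℝ) < Real.log ℓ / lg + 1 := Nat.ceil_lt_add_one (by linarith)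
  have hi₀M : i₀ < A.M := by
    have : (i₀ : ℝ) < A.M := by linarith
    exact_mod_cast this
  have hi₀ℓ : (i₀ : ℝ) ≤ ℓ := by
    have : Real.log ℓ / lg + 1 = 1 / lg * Real.log ℓ + 1 := by ring
    linarith
  have hγi : γ ^ i₀ ≤ ℓ⁻¹ := by
    refine pow_le_inv_of_log_le h0 (by linarith) ?_
    rw [← div_le_iff₀ hlg0]
    exact Nat.le_ceil _
  have hx : 1 ≤ Real.exp (-roundConst γ) * A.g 0 := by
    rw [Real.exp_neg, le_inv_mul_iff₀ (Real.exp_pos _), mul_one]; exact x3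
  have hlate := hS.horizon_mul_inv_le h0 h1 hi₀M he t1 hbL hx hgT hγi g2 hbl
  refine (h.sum_le hp hd h0 hg0 g1 hT2 hi₀M).trans ?_
  rw [← hγdef, ← hT, ← hℓ, ← hCs, mul_assoc Cs]
  refine mul_le_mul_of_nonneg_left ?_ hCs0.le
  rw [add_mul]
  refine add_le_add ?_ hlate
  have hb0 : 0 ≤ b := le_trans (by positivity) hbR
  -- One logarithm comes from the length of a batch and the other from `i₀ ≤ log T`.
  calc (i₀ : ℝ) * (4 / (c0 d p ^ 2 * p.cUp) * ℓ * b) ≤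
        ℓ * (4 / (c0 d p ^ 2 * p.cUp) * ℓ * (Cb * T ^ (1 - γ))) := by gcongr
    _ = _ := by ring

/-- The regret bound for all tunings obtained from the recipe. -/
theorem IsTuned.exists_regret_bound {d : ℕ} {p : ClassParams} (hd : 1 ≤ d) (hp : p.Valid)
    (h0 : 0 < gam d p.α p.β) (h1 : gam d p.α p.β < 1) {q : TuningConsts} (hl : 0 < q.lLow)
    (hbL : 0 < q.bLow) (hbU : 0 < q.bUp) :
    ∃ K : ℝ, 0 < K ∧ ∀ (A : Inputs) (b : ℝ) (l : ℕ → ℝ), 2 ≤ A.T →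
      2 / (-Real.log (gam d p.α p.β)) * Real.log (Real.log A.T) ≤ A.M → IsTuned d p q A b l →
      ∀ (Ω : Type*) [MeasurableSpace Ω] (P : Measure Ω) [IsProbabilityMeasure P]
        (μ : Measure (Cov d × (Arm → ℝ))) (f : Arm → Cov d → ℝ)
        (Z : ℕ → Ω → Cov d × (Arm → ℝ)) (c : Ω → Choices d),
        IsInstance p μ f → IsIIDSample P A.T μ Z →
        (∀ i C, Measurable fun ω => (c ω).first i C) →
        (∀ t, Measurable fun ω => (c ω).final t) →
        Integrable (fun ω => cumRegret A.T f
          (fun t => (Z t ω).1) (basedb A (c ω) fun t => Z t ω)) P ∧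
        ∫ ω, cumRegret A.T f (fun t => (Z t ω).1) (basedb A (c ω) fun t => Z t ω) ∂P
          ≤ K * Real.log A.T ^ 2 * (A.T : ℝ) ^ (1 - gam d p.α p.β) := by
  obtain ⟨K, T₀, hK, hmain⟩ := IsTuned.exists_sum_bound hd hp h0 h1 hl hbL hbU
  have hcL := hp.cLow_pos
  have hlog2 : 0 < Real.log 2 := Real.log_pos (by norm_num)
  -- The second summand pays for the horizons below `T₀`, where the regret is at most `T ≤ |T₀|` and
  -- `(log T)² T^{1-γ}` is at least `(log 2)²`.
  refine ⟨(1 + p.cLow) * K + |T₀| / Real.log 2 ^ 2, by positivity, ?_⟩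
  intro A b l hT2 hM h Ω _ P _ μ f Z c hI hZ hc hc'
  obtain ⟨hint, htriv⟩ := integrable_cumRegret hp hI hZ hc hc' h.t_zero h.t_last h.t_lt
  refine ⟨hint, ?_⟩
  have hT2' : (2 : ℝ) ≤ A.T := by exact_mod_cast hT2
  have hpow : (1 : ℝ) ≤ (A.T : ℝ) ^ (1 - gam d p.α p.β) :=
    Real.one_le_rpow (by linarith) (by linarith)
  have hlog : Real.log 2 ≤ Real.log A.T := Real.log_le_log (by norm_num) hT2'
  have hX : Real.log 2 ^ 2 ≤ Real.log A.T ^ 2 * (A.T : ℝ) ^ (1 - gam d p.α p.β) := by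
    calc Real.log 2 ^ 2 = Real.log 2 ^ 2 * 1 := (mul_one _).symm
      _ ≤ _ := by gcongr
  rw [mul_assoc, add_mul]
  set X := Real.log A.T ^ 2 * (A.T : ℝ) ^ (1 - gam d p.α p.β)
  have hX0 : 0 ≤ X := le_trans (by positivity) hX
  rcases le_or_gt T₀ A.T with hlarge | hsmall
  · obtain ⟨hrel, hsum⟩ := hmain A b l hlarge hM h
    calc _ ≤ (1 + p.cLow) * ∑ i ∈ Finset.range A.M,
          (A.t (i + 1) - A.t i : ℕ) * stepBound p q.lLow A.g (i + 1) :=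
          integral_cumRegret_le hp hI hZ hc hc' hl hrel
      _ ≤ (1 + p.cLow) * (K * X) := by gcongr
      _ ≤ _ := by
        have : 0 ≤ |T₀| / Real.log 2 ^ 2 * X := by positivity
        linarith
  · calc _ ≤ (A.T : ℝ) := htriv
      _ ≤ |T₀| := hsmall.le.trans (le_abs_self _)
      _ = |T₀| / Real.log 2 ^ 2 * Real.log 2 ^ 2 := by field_simp
      _ ≤ |T₀| / Real.log 2 ^ 2 * X := by gcongr
      _ ≤ _ := by
        have : 0 ≤ (1 + p.cLow) * K * X := by positivity
        linarith

/-! ### Existence of admissible inputs -/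

/-- Iterated rounded powers of `n`. -/
noncomputable def floorPowers (γ : ℝ) (n : ℕ) : ℕ → ℕ
  | 0 => n
  | i + 1 => ⌊(floorPowers γ n i : ℝ) ^ γ⌋₊

/-- The split factors of the recipe for `M` batches, starting with `n`. -/
noncomputable def splitFactors (γ : ℝ) (n M i : ℕ) : ℕ :=
  if i + 1 < M then floorPowers γ n i else 1

lemma isSplit_splitFactors (γ : ℝ) {n M : ℕ} (hn : 0 < n) (hM : 2 ≤ M) :
    IsSplit γ M (splitFactors γ n M) := by
  refine ⟨hM, ?_, ?_, ?_⟩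
  · rw [splitFactors, if_pos (by omega)]; exact hn
  · intro i h1 h2
    obtain ⟨j, rfl⟩ : ∃ j, i = j + 1 := ⟨i - 1, by omega⟩
    rw [splitFactors, if_pos (by omega), Nat.add_sub_cancel, splitFactors, if_pos (by omega)]
    rfl
  · rw [splitFactors, if_neg (by omega)]

/-- A valid grid exists if the prescribed batches are nonempty and fit into the horizon. -/
lemma IsSplit.exists_isTuned {d : ℕ} {p : ClassParams} {q : TuningConsts} {T M : ℕ} {g : ℕ → ℕ}
    {b : ℝ} (hS : IsSplit (gam d p.α p.β) M g)
    (hg : g 0 = ⌊b ^ (1 / (2 * p.β + d))⌋₊)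
    (hb : q.bLow * (T : ℝ) ^ ((1 - gam d p.α p.β) / (1 - gam d p.α p.β ^ M)) /
      Real.log T ^ (2 * (1 - gam d p.α p.β)) ≤ b)
    (hb' : b ≤ q.bUp * (T : ℝ) ^ ((1 - gam d p.α p.β) / (1 - gam d p.α p.β ^ M)))
    (hone : ∀ j, 1 ≤ j → j < M →
      1 ≤ q.lLow * width g j ^ (-(2 * p.β + d)) * Real.log (T * width g j ^ d))
    (hsum : ∑ j ∈ Finset.Icc 1 (M - 1),
      q.lLow * width g j ^ (-(2 * p.β + d)) * Real.log (T * width g j ^ d) < T)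
    (hup : ∀ j, 1 ≤ j → j < M → q.lLow * Real.log (T * width g j ^ d) ≤
      2 / (c0 d p ^ 2 * p.cUp) * Real.log (2 * T * width g j ^ d)) :
    ∃ A : Inputs, A.T = T ∧ A.M = M ∧ IsTuned d p q A b fun _ => q.lLow := by
  set x : ℕ → ℝ := fun j =>
    q.lLow * width g j ^ (-(2 * p.β + d)) * Real.log (T * width g j ^ d) with hx
  have hM := hS.two_le
  have hstep : ∀ i, i + 1 < M → ∑ j ∈ Finset.Icc 1 (i + 1), ⌊x j⌋₊ =
      ∑ j ∈ Finset.Icc 1 i, ⌊x j⌋₊ + ⌊x (i + 1)⌋₊ := fun i _ =>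
    Finset.sum_Icc_succ_top (by omega) _
  -- The grid is made of the prescribed lengths, and the last batch takes the rest of the horizon.
  refine ⟨⟨T, M, g, fun i => if i < M then ∑ j ∈ Finset.Icc 1 i, ⌊x j⌋₊ else T⟩, rfl, rfl,
    hM, hb, hb', hg, hS.step, hS.last, ?_, ?_, ?_, ?_, fun _ _ _ => le_rfl, hup⟩
  · simp [show 0 < M by omega]
  · simp
  · intro i (hi : i < M)
    simp only [if_pos hi]
    split_ifs with h
    · rw [hstep i h]
      have := Nat.floor_pos.2 (hone (i + 1) (by omega) h)
      exact Nat.lt_add_of_pos_right this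
    · have e : i = M - 1 := by omega
      have h1 : (∑ j ∈ Finset.Icc 1 i, ((⌊x j⌋₊ : ℕ) : ℝ)) < T := by
        refine lt_of_le_of_lt (Finset.sum_le_sum fun j hj => ?_) (e ▸ hsum)
        rw [Finset.mem_Icc] at hj
        exact Nat.floor_le (zero_le_one.trans (hone j hj.1 (by omega)))
      exact_mod_cast h1
  · intro i h1 (hi : i < M)
    obtain ⟨j, rfl⟩ : ∃ j, i = j + 1 := ⟨i - 1, by omega⟩
    simp only [Nat.add_sub_cancel, if_pos hi, if_pos (show j < M by omega)]
    exact hstep j hi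

/-- The number of bins is far below the horizon. -/
lemma IsSplit.nBins_rpow_le {γ : ℝ} {M : ℕ} {g : ℕ → ℕ} (hS : IsSplit γ M g) (h0 : 0 < γ)
    (h1 : γ < 1) {i : ℕ} (hi : i < M) {b e η Y : ℝ} (he : 0 < e) (hη : 0 < η)
    (hη1 : η ≤ 1) (hY : 1 ≤ Y) (hg : (g 0 : ℝ) ^ e ≤ b) (hb : b ≤ η * Y ^ (1 - γ)) :
    (nBins g i : ℝ) ^ e ≤ η * Y := by
  have h1' : 0 < 1 - γ := by linarith
  have hinv : 1 ≤ 1 / (1 - γ) := by rw [le_div_iff₀ h1']; linarith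
  calc (nBins g i : ℝ) ^ e ≤ ((g 0 : ℝ) ^ (1 / (1 - γ))) ^ e := by
        gcongr; exact hS.nBins_le h0 h1 (by omega)
    _ = ((g 0 : ℝ) ^ e) ^ (1 / (1 - γ)) := by
        rw [← Real.rpow_mul (by positivity), ← Real.rpow_mul (by positivity), mul_comm]
    _ ≤ (η * Y ^ (1 - γ)) ^ (1 / (1 - γ)) :=
        Real.rpow_le_rpow (by positivity) (hg.trans hb) (by positivity)
    _ = η ^ (1 / (1 - γ)) * Y := by
        rw [Real.mul_rpow hη.le (by positivity), ← Real.rpow_mul (by linarith),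
          mul_one_div_cancel h1'.ne', Real.rpow_one]
    _ ≤ η ^ (1 : ℝ) * Y := by
        gcongr ?_ * Y
        exact Real.rpow_le_rpow_of_exponent_ge hη hη1 hinv
    _ = _ := by rw [Real.rpow_one]

/-- For large horizons the recipe can be carried out with any number of batches between
`2 log log T / log (1/γ)` and `D₁ log T`. -/
lemma exists_isTuned_of_le {d : ℕ} {p : ClassParams} (hp : p.Valid)
    (h0 : 0 < gam d p.α p.β) (h1 : gam d p.α p.β < 1) {D₁ lLow : ℝ} (hD₁ : 0 < D₁)
    (hl : 0 < lLow) (hl' : lLow ≤ 2 / (c0 d p ^ 2 * p.cUp)) :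
    ∃ ε T₀ : ℝ, 0 < ε ∧ ∀ T M : ℕ, T₀ ≤ T →
      2 / (-Real.log (gam d p.α p.β)) * Real.log (Real.log T) ≤ M → (M : ℝ) ≤ D₁ * Real.log T →
      ∃ (A : Inputs) (b : ℝ), A.T = T ∧ A.M = M ∧
        IsTuned d p ⟨lLow, ε, ε⟩ A b fun _ => lLow := by
  have hβ := hp.β_pos
  have he : (0 : ℝ) < 2 * p.β + d := by positivity
  set γ := gam d p.α p.β with hγdef
  set lg := -Real.log γ with hlg
  have hlg0 : 0 < lg := by have := Real.log_neg h0 h1; linarith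
  have h1' : 0 < 1 - γ := by linarith
  obtain ⟨R, hR1, hR⟩ : ∃ R : ℝ, 1 ≤ R ∧ ∀ x, R ≤ x → 1 / lLow ≤ x ^ (2 * p.β + d) := by
    obtain ⟨R, hR⟩ := Filter.eventually_atTop.1
      ((tendsto_rpow_atTop he).eventually_ge_atTop (1 / lLow))
    exact ⟨max R 1, le_max_right _ _, fun x hx => hR x ((le_max_left _ _).trans hx)⟩
  -- Chosen with `lLow D₁ η < 1`, so that `D₁ log T` batches of length at most `lLow η (T / (log
  -- T)²) log T` do not exhaust the horizon.
  set η := 1 / (1 + lLow * D₁) with hη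
  have hη0 : 0 < η := by positivity
  have hη1 : η ≤ 1 := by
    rw [hη, div_le_one (by positivity)]
    have : 0 < lLow * D₁ := by positivity
    linarith
  have hηl : lLow * D₁ * η < 1 := by
    rw [hη, mul_one_div, div_lt_one (by positivity)]; linarith
  -- The factor `e` absorbs the difference between the exponents `(1 - γ) / (1 - γ^M)` and `1 - γ`.
  set ε := η / Real.exp 1 with hε
  have hε0 : 0 < ε := by positivity
  obtain ⟨T₀, hT₀⟩ := Filter.eventually_atTop.1
    ((Filter.eventually_ge_atTop (Real.exp 1)).and
    (((Real.tendsto_log_atTop.comp Real.tendsto_log_atTop).eventually_ge_atTop lg).and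
    ((eventually_log_rpow_le (a := 2) (c := 1) (C := 1) one_pos).and
    ((eventually_log_rpow_le (a := 2 * (1 - γ)) (C := (R + 1) ^ (2 * p.β + d) / ε) h1').and
    ((tendsto_rpow_atTop (show 0 < 2 * p.β / (2 * p.β + d) by positivity)).eventually_ge_atTop
      (Real.exp 2 * η ^ (1 / (1 - γ) * (d / (2 * p.β + d)))))))))
  refine ⟨ε, T₀, hε0, ?_⟩
  intro T M hTT hM hM'
  obtain ⟨t1, t2, t3, t4, t5⟩ := hT₀ T hTT
  simp only [Function.comp_apply] at t2
  set τ : ℝ := (T : ℝ) with hτ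
  set ℓ := Real.log τ with hℓ
  have hT1 : 1 < τ := by
    have := Real.add_one_le_exp (1 : ℝ); linarith
  have hT0 : 0 < τ := by linarith
  have hℓ1 : 1 ≤ ℓ := (Real.le_log_iff_exp_le hT0).2 t1
  have hM2 : 2 ≤ M := by
    have : (2 : ℝ) ≤ M := by
      refine le_trans ?_ hM
      rw [div_mul_eq_mul_div, le_div_iff₀ hlg0]
      linarith
    exact_mod_cast this
  have hγM : γ ^ M ≤ ℓ⁻¹ := by
    refine pow_le_inv_of_log_le h0 (by linarith) ?_
    rw [div_mul_eq_mul_div, div_le_iff₀ hlg0] at hM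
    have : 0 ≤ Real.log ℓ := Real.log_nonneg hℓ1
    linarith
  obtain ⟨r1, r2⟩ := rpow_exponent_bounds h0 h1 hT1 (by omega : M ≠ 0) hγM
  set θ := (1 - γ) / (1 - γ ^ M) with hθ
  have hlpow : 1 ≤ ℓ ^ (2 * (1 - γ)) := Real.one_le_rpow hℓ1 (by linarith)
  -- The lower end of the window; the window has the same constant `ε` at both ends because the
  -- logarithm is at least `1`.
  set b := ε * τ ^ θ / ℓ ^ (2 * (1 - γ)) with hb
  set Y := τ / ℓ ^ 2 with hY
  have hY1 : 1 ≤ Y := by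
    rw [hY, le_div_iff₀ (by positivity)]
    rw [Real.rpow_one, Real.rpow_ofNat] at t3
    linarith
  have hbY : b ≤ η * Y ^ (1 - γ) := by
    rw [hb, hY, Real.div_rpow hT0.le (by positivity), ← Real.rpow_natCast,
      ← Real.rpow_mul (by linarith)]
    push_cast
    rw [← mul_div_assoc]
    refine div_le_div_of_nonneg_right ?_ (by positivity)
    calc ε * τ ^ θ ≤ ε * (Real.exp 1 * τ ^ (1 - γ)) := by gcongr
      _ = _ := by rw [hε]; field_simp
  have hbu : b ≤ η * τ ^ (1 - γ) := by
    refine hbY.trans ?_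
    gcongr
    exact div_le_self hT0.le (one_le_pow₀ hℓ1)
  have hbR : (R + 1) ^ (2 * p.β + d) ≤ b := by
    rw [hb, le_div_iff₀ (by positivity)]
    rw [div_mul_eq_mul_div, div_le_iff₀ hε0] at t4
    calc _ ≤ τ ^ (1 - γ) * ε := t4
      _ ≤ τ ^ θ * ε := by gcongr
      _ = _ := mul_comm _ _
  set n := ⌊b ^ (1 / (2 * p.β + d))⌋₊ with hn
  have hnR : R ≤ n := le_floor_rpow he (by linarith) hbR
  have hn0 : 0 < n := by
    have : (0 : ℝ) < n := by linarith
    exact_mod_cast this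
  have hn1 := (floor_rpow_bounds (le_trans (by positivity) hbR) he hn hn0).1
  have hS := isSplit_splitFactors γ hn0 hM2
  set g := splitFactors γ n M with hg
  have hgn : g 0 = n := by rw [hg, splitFactors, if_pos (by omega)]; rfl
  rw [← hgn] at hn1 hnR
  have hlog : ∀ j, 1 ≤ j → j < M → 2 ≤ Real.log (τ * width g j ^ d) := fun j _ hj =>
    hS.two_le_log h0 h1 hj hβ hT0 hη0 hn1 hbu t5
  have hN1 : ∀ j, j < M → (1 : ℝ) ≤ nBins g j := fun j hj => by
    exact_mod_cast hS.nBins_pos h0 hj.le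
  have hw : ∀ j, j < M → width g j ^ (-(2 * p.β + d)) = (nBins g j : ℝ) ^ (2 * p.β + d) := by
    intro j hj
    have := hN1 j hj
    rw [width, Real.inv_rpow (by positivity), Real.rpow_neg (by positivity), inv_inv]
  have hwpos : ∀ j, j < M → 0 < width g j ∧ width g j ≤ 1 := by
    intro j hj
    have := hN1 j hj
    exact ⟨by unfold width; positivity, by unfold width; exact inv_le_one_of_one_le₀ this⟩
  have hone : ∀ j, 1 ≤ j → j < M →
      1 ≤ lLow * width g j ^ (-(2 * p.β + d)) * Real.log (τ * width g j ^ d) := by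
    intro j h1j hj
    have hgj : (g 0 : ℝ) ≤ nBins g j := by
      have := hS.nBins_mono h0 h1j hj.le
      rw [nBins_one] at this
      exact_mod_cast this
    have h3 := hR _ (hnR.trans hgj)
    rw [hw j hj]
    rw [div_le_iff₀ hl, mul_comm] at h3
    have h4 := hlog j h1j hj
    nlinarith
  have hsum : ∑ j ∈ Finset.Icc 1 (M - 1),
      lLow * width g j ^ (-(2 * p.β + d)) * Real.log (τ * width g j ^ d) < τ := by
    have hterm : ∀ j ∈ Finset.Icc 1 (M - 1),
        lLow * width g j ^ (-(2 * p.β + d)) * Real.log (τ * width g j ^ d) ≤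
          lLow * (η * Y) * ℓ := by
      intro j hj
      rw [Finset.mem_Icc] at hj
      have hjM : j < M := by omega
      obtain ⟨w0, w1⟩ := hwpos j hjM
      have hlg1 : Real.log (τ * width g j ^ d) ≤ ℓ := by
        refine Real.log_le_log (by positivity) ?_
        exact mul_le_of_le_one_right hT0.le (pow_le_one₀ w0.le w1)
      have := hlog j hj.1 hjM
      rw [hw j hjM]
      have h5 := hS.nBins_rpow_le h0 h1 hjM he hη0 hη1 hY1 hn1 hbY
      gcongr
    refine lt_of_le_of_lt (Finset.sum_le_sum hterm) ?_
    rw [Finset.sum_const, Nat.card_Icc, nsmul_eq_mul]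
    have hMM : ((M - 1 + 1 - 1 : ℕ) : ℝ) ≤ D₁ * ℓ :=
      le_trans (by exact_mod_cast (by omega : M - 1 + 1 - 1 ≤ M)) hM'
    -- The number of batches and the length of each contribute a logarithm, and the two cancel
    -- against `Y = T / (log T)²`. This is what the power of the logarithm in the window allows for.
    calc _ ≤ D₁ * ℓ * (lLow * (η * Y) * ℓ) := by gcongr
      _ = lLow * D₁ * η * τ := by rw [hY]; field_simp
      _ < 1 * τ := by gcongr
      _ = τ := one_mul _
  have hup : ∀ j, 1 ≤ j → j < M → lLow * Real.log (τ * width g j ^ d) ≤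
      2 / (c0 d p ^ 2 * p.cUp) * Real.log (2 * τ * width g j ^ d) := by
    intro j h1j hj
    have h2 := hlog j h1j hj
    obtain ⟨w0, -⟩ := hwpos j hj
    have h3 : Real.log (τ * width g j ^ d) ≤ Real.log (2 * τ * width g j ^ d) := by
      refine Real.log_le_log (by positivity) ?_
      gcongr
      linarith
    exact mul_le_mul hl' h3 (by linarith) (hl.le.trans hl')
  obtain ⟨A, hAT, hAM, hA⟩ := IsSplit.exists_isTuned (q := ⟨lLow, ε, ε⟩) (p := p) (T := T) hS
    (hgn.trans hn) (le_of_eq rfl) (div_le_self (by positivity) hlpow) hone hsum hup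
  exact ⟨A, b, hAT, hAM, hA⟩

/-- Admissible inputs exist for all large horizons. -/
theorem exists_isTuned {d : ℕ} {p : ClassParams} (hp : p.Valid)
    (h0 : 0 < gam d p.α p.β) (h1 : gam d p.α p.β < 1) {D₁ lLow : ℝ} (hD₁ : 0 < D₁)
    (hl : 0 < lLow) (hl' : lLow ≤ 2 / (c0 d p ^ 2 * p.cUp)) :
    ∃ (bLow bUp : ℝ) (T₀ : ℕ), 0 < bLow ∧ 0 < bUp ∧ ∀ T M : ℕ, T₀ ≤ T →
      2 / (-Real.log (gam d p.α p.β)) * Real.log (Real.log T) ≤ M →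
      ∃ (A : Inputs) (b : ℝ) (l : ℕ → ℝ), A.T = T ∧ A.M ≤ M ∧
        ((M : ℝ) ≤ D₁ * Real.log T → A.M = M) ∧
        2 / (-Real.log (gam d p.α p.β)) * Real.log (Real.log T) ≤ A.M ∧
        IsTuned d p ⟨lLow, bLow, bUp⟩ A b l := by
  obtain ⟨ε, T₀, hε, hmain⟩ := exists_isTuned_of_le hp h0 h1 hD₁ hl hl'
  set D₂ := 2 / (-Real.log (gam d p.α p.β)) with hD₂
  have hD₂0 : 0 < D₂ := by
    have := Real.log_neg h0 h1
    rw [hD₂]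
    exact div_pos two_pos (by linarith)
  obtain ⟨T₁, hT₁⟩ := Filter.eventually_atTop.1
    ((eventually_log_log_le (D₂ / D₁) (1 / D₁)).and
    ((Real.tendsto_log_atTop.comp Real.tendsto_log_atTop).eventually_ge_atTop 0))
  refine ⟨ε, ε, ⌈max T₀ T₁⌉₊, hε, hε, ?_⟩
  intro T M hT hM
  have hT' : max T₀ T₁ ≤ T := Nat.ceil_le.1 hT
  rcases le_or_gt (M : ℝ) (D₁ * Real.log T) with h | h
  · obtain ⟨A, b, hAT, hAM, hA⟩ := hmain T M ((le_max_left _ _).trans hT') hM h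
    exact ⟨A, b, _, hAT, hAM.le, fun _ => hAM, hAM ▸ hM, hA⟩
  · obtain ⟨u1, u2⟩ := hT₁ T ((le_max_right _ _).trans hT')
    simp only [Function.comp_apply] at u2
    -- When `M` exceeds `D₁ log T`, the smallest allowed number of batches is used instead; for
    -- large `T` it is below `D₁ log T`.
    have hle : (⌈D₂ * Real.log (Real.log T)⌉₊ : ℝ) ≤ D₁ * Real.log T := by
      refine (Nat.ceil_lt_add_one (by positivity)).le.trans ?_
      calc D₂ * Real.log (Real.log T) + 1 =
            D₁ * (D₂ / D₁ * Real.log (Real.log T) + 1 / D₁) := by field_simp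
        _ ≤ _ := by gcongr
    obtain ⟨A, b, hAT, hAM, hA⟩ := hmain T _ ((le_max_left _ _).trans hT') (Nat.le_ceil _) hle
    exact ⟨A, b, _, hAT, hAM ▸ Nat.ceil_le.2 hM, fun h' => absurd h' h.not_ge,
      hAM ▸ Nat.le_ceil _, hA⟩

end BatchedBandit

/-! ### The corollary -/

theorem corollary1 (γ : ℝ) (hγ0 : 0 < γ) (hγ1 : γ < 1) :
    ∃ D₂ : ℝ, 0 < D₂ ∧
      ∀ (d : ℕ) (p : BatchedBandit.ClassParams), 1 ≤ d → p.Valid →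
        BatchedBandit.gam d p.α p.β = γ →
        -- every admissible tuning obeys the regret bound
        (∀ q : BatchedBandit.TuningConsts, 0 < q.lLow → 0 < q.bLow → 0 < q.bUp →
          ∃ K : ℝ, 0 < K ∧
            ∀ (A : BatchedBandit.Inputs) (b : ℝ) (l : ℕ → ℝ), 2 ≤ A.T →
              D₂ * Real.log (Real.log A.T) ≤ A.M → BatchedBandit.IsTuned d p q A b l →
              ∀ (Ω : Type*) [MeasurableSpace Ω] (P : MeasureTheory.Measure Ω)
                [MeasureTheory.IsProbabilityMeasure P]
                (μ : MeasureTheory.Measure (BatchedBandit.Cov d × (BatchedBandit.Arm → ℝ)))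
                (f : BatchedBandit.Arm → BatchedBandit.Cov d → ℝ)
                (Z : ℕ → Ω → BatchedBandit.Cov d × (BatchedBandit.Arm → ℝ))
                (c : Ω → BatchedBandit.Choices d),
                BatchedBandit.IsInstance p μ f → BatchedBandit.IsIIDSample P A.T μ Z →
                (∀ i C, Measurable fun ω => (c ω).first i C) →
                (∀ t, Measurable fun ω => (c ω).final t) →
                MeasureTheory.Integrable (fun ω => BatchedBandit.cumRegret A.T f
                  (fun t => (Z t ω).1) (BatchedBandit.basedb A (c ω) fun t => Z t ω)) P ∧
                ∫ ω, BatchedBandit.cumRegret A.T f (fun t => (Z t ω).1)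
                    (BatchedBandit.basedb A (c ω) fun t => Z t ω) ∂P
                  ≤ K * Real.log A.T ^ 2 * (A.T : ℝ) ^ (1 - γ)) ∧
        -- admissible tunings exist: with exactly `M` batches when `M ≤ D₁ log T`, and with at
        -- most `M` batches in general
        (∀ D₁ lLow : ℝ, 0 < D₁ → 0 < lLow →
          lLow ≤ 2 / (BatchedBandit.c0 d p ^ 2 * p.cUp) →
          ∃ (bLow bUp : ℝ) (T₀ : ℕ), 0 < bLow ∧ 0 < bUp ∧
            ∀ T M : ℕ, T₀ ≤ T → D₂ * Real.log (Real.log T) ≤ M →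
              ∃ (A : BatchedBandit.Inputs) (b : ℝ) (l : ℕ → ℝ), A.T = T ∧ A.M ≤ M ∧
                ((M : ℝ) ≤ D₁ * Real.log T → A.M = M) ∧
                D₂ * Real.log (Real.log T) ≤ A.M ∧
                BatchedBandit.IsTuned d p ⟨lLow, bLow, bUp⟩ A b l) := by
  have hlog := Real.log_neg hγ0 hγ1
  -- About `log log T / log (1/γ)` batches bring `γ^i` below `1 / log T`. Twice as many ensure, for
  -- large `T`, that this happens before the last batch.
  refine ⟨2 / (-Real.log γ), div_pos two_pos (by linarith), ?_⟩
  rintro d p hd hp rfl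
  exact ⟨fun q hl hbL hbU => BatchedBandit.IsTuned.exists_regret_bound hd hp hγ0 hγ1 hl hbL hbU,
    fun D₁ lLow hD₁ hl hl' => BatchedBandit.exists_isTuned hp hγ0 hγ1 hD₁ hl hl'⟩
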